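/- Let $d\ge 0$, $J\ge 2$, and let $\Phi_j(x)=r_jM_jx+a_j$ ($j=1,\dots,J$) be contraction similitudes of $\mathbb R^d$, with $0<r_j<1$, $M_j\in O(d)$, $a_j\in\mathbb R^d$. Put $\Phi(A)=\bigcup_j\Phi_j(A)$, let $F$ be the attractor (the unique nonempty compact set with $F=\Phi(F)$) and $C$ its convex hull. Assume the tileset condition: $\operatorname{relint}C\not\subseteq\Phi(C)$ and $\operatorname{int}\Phi_j(C)\cap\operatorname{int}\Phi_l(C)=\emptyset$ for $j\ne l$. Assume that $T_1=\operatorname{relint}C\setminus\Phi(C)$ has finitely many connected components $G_1,\dots,G_Q$ (the generators). The self-similar tiling is $\mathcal T=\{\Phi_w(G_q)\}$, where $w$ runs over all finite words in $\{1,\dots,J\}$ (including the empty word), $q=1,\dots,Q$, and $\Phi_{w_1\cdots w_k}=\Phi_{w_k}\circ\cdots\circ\Phi_{w_1}$. For $A\subseteq\mathbb R^d$ bounded let $V(A,\varepsilon)=\operatorname{vol}_d\{x\in A:\operatorname{dist}(x,\partial A)\le\varepsilon\}$, and let $V(\mathcal T,\varepsilon)$ be this volume for the union of the tiles. Let $g_q$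 be the inradius of $G_q$ (the supremum of the radii of balls contained in it). Assume every generator is monophase: there are real $\kappa_{q,0},\dots,\kappa_{q,d-1}$ with $V(G_q,\varepsilon)=\sum_{k=0}^{d-1}\kappa_{q,k}\varepsilon^{d-k}$ for $0<\varepsilon<g_q$; put $\kappa_{q,d}=-\operatorname{vol}_d(G_q)$. Let $D$ be the real number with $\sum_jr_j^D=1$. Let $\zeta_{\mathfrak s}$ be the meromorphic extension to $\mathbb C$ of $\sum_w r_w^s$ (sum over all finite words, $r_w=r_{w_1}\cdots r_{w_k}$), and let $$\zeta_{\mathcal T}(\varepsilon,s)=\varepsilon^{d-s}\,\zeta_{\mathfrak s}(s)\sum_{q=1}^Q\sum_{k=0}^d\frac{g_q^{s-k}}{s-k}\kappa_{q,k}.$$ The complex dimensions of $\mathcal T$ are the poles of $\zeta_{\mathfrak s}$ together with $0,1,\dots,d-1$. Call $\mathcal T$ lattice if there is $r\in(0,1)$ such that every $r_j$ is a positive integer power of $r$, and nonlattice otherwise. Call $\mathcal T$ Minkowski measurable if $\lim_{\varepsilon\to0^+}V(\mathcal T,\varepsilon)\,\varepsilon^{-(d-D)}$ exists and lies in $(0,\infty)$.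 **Corollary 8.3.** 1. If $\mathcal T$ is lattice, there are infinitely many complex dimensions on the line $\operatorname{Re}s=D$, and each of them is a simple pole of $\zeta_{\mathfrak s}$. 2. If $\mathcal T$ is nonlattice, then $D$ is the only complex dimension on the line $\operatorname{Re}s=D$, and it is a simple pole of $\zeta_{\mathfrak s}$. 3. Assume moreover that $$D>d-1\qquad\text{and}\qquad\sum_{q=1}^Q\sum_{k=0}^{d-1}\frac{g_q^{D-k}}{D-k}(d-k)\,\kappa_{q,k}\ne0 .$$ Then $\mathcal T$ is Minkowski measurable if and only if it is nonlattice. If $\mathcal T$ is lattice, there are $p>0$ and an absolutely summable family $(c_n)_{n\in\mathbb Z}$ of complex numbers, infinitely many of which are nonzero, such that the complex dimensions on $\operatorname{Re}s=D$ are exactly $\omega_n=D+\mathrm i np$ ($n\in\mathbb Z$), such that $\lim_{s\to\omega_n}(s-\omega_n)\,\zeta_{\mathcal T}(\varepsilon,s)=c_n\varepsilon^{d-\omega_n}$ for all $n\in\mathbb Z$ and $\varepsilon>0$ (so that $\zeta_{\mathcal T}(\varepsilon,\cdot)$ has at most a simple pole at $\omega_n$, with this residue), and such that $$V(\mathcal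 T,\varepsilon)\,\varepsilon^{-(d-D)}-\sum_{n\in\mathbb Z}c_n\,\varepsilon^{-\mathrm i np}\longrightarrow0\qquad(\varepsilon\to0^+).$$ -/

import Mathlib

open Filter Topology MeasureTheory

noncomputable section

/-- A self-similar system of `J ≥ 2` contraction similitudes `Φ_j (x) = r_j M_j x + a_j` of
`ℝ^d`, with `0 < r_j < 1`, `M_j` a linear isometry and `a_j` a translation vector. -/
structure SelfSimilarSystem (d J : ℕ) where
  two_le : 2 ≤ J
  ratio : Fin J → ℝ
  ratio_pos : ∀ j, 0 < ratio j
  ratio_lt_one : ∀ j, ratio j < 1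
  rot : Fin J → (EuclideanSpace ℝ (Fin d) ≃ₗᵢ[ℝ] EuclideanSpace ℝ (Fin d))
  shift : Fin J → EuclideanSpace ℝ (Fin d)

namespace SelfSimilarSystem

variable {d J : ℕ} (Φ : SelfSimilarSystem d J)

/-- The similitude `Φ_j`. -/
def map (j : Fin J) (x : EuclideanSpace ℝ (Fin d)) : EuclideanSpace ℝ (Fin d) :=
  Φ.ratio j • Φ.rot j x + Φ.shift j

/-- The set operator `A ↦ Φ(A) = ⋃ j, Φ_j (A)`. -/
def setMap (A : Set (EuclideanSpace ℝ (Fin d))) : Set (EuclideanSpace ℝ (Fin d)) :=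
  ⋃ j, Φ.map j '' A

/-- `F` is the attractor of the system: the (unique) nonempty compact set with `F = Φ(F)`. -/
def IsAttractor (F : Set (EuclideanSpace ℝ (Fin d))) : Prop :=
  F.Nonempty ∧ IsCompact F ∧ F = Φ.setMap F

/-- For a finite word `w = w₁ w₂ … w_k` (possibly empty), the map `Φ_{w_k} ∘ ⋯ ∘ Φ_{w₁}`. -/
def wordMap (w : List (Fin J)) (x : EuclideanSpace ℝ (Fin d)) : EuclideanSpace ℝ (Fin d) :=
  w.foldl (fun y j => Φ.map j y) x

/-- The scaling ratio `r_w = r_{w₁} ⋯ r_{w_k}` of a word. -/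
def wordRatio (w : List (Fin J)) : ℝ :=
  (w.map Φ.ratio).prod

/-- The tileset condition for the system with attractor `F`, where `C` is the convex hull of
`F`: the relative interior of `C` is not contained in `Φ(C)`, and the images `Φ_j (C)` have
pairwise disjoint interiors. -/
def TilesetCondition (F : Set (EuclideanSpace ℝ (Fin d))) : Prop :=
  ¬ intrinsicInterior ℝ (convexHull ℝ F) ⊆ Φ.setMap (convexHull ℝ F) ∧
    ∀ j l : Fin J, j ≠ l →
      Disjoint (interior (Φ.map j '' convexHull ℝ F)) (interior (Φ.map l '' convexHull ℝ F))

/-- The set `T₁ = relint C \ Φ(C)`, where `C` is the convex hull of the attractor `F`. -/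
def firstTileset (F : Set (EuclideanSpace ℝ (Fin d))) : Set (EuclideanSpace ℝ (Fin d)) :=
  intrinsicInterior ℝ (convexHull ℝ F) \ Φ.setMap (convexHull ℝ F)

/-- `G₁, …, G_Q` is a repetition-free list of the generators of the tiling, i.e. of all the
connected components of `T₁`. -/
def IsGenerators {Q : ℕ} (F : Set (EuclideanSpace ℝ (Fin d)))
    (G : Fin Q → Set (EuclideanSpace ℝ (Fin d))) : Prop :=
  Function.Injective G ∧
    Set.range G = {A | ∃ x ∈ Φ.firstTileset F, A = connectedComponentIn (Φ.firstTileset F) x}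

/-- The self-similar tiling `{Φ_w (G_q)}`, regarded (as for every fractal spray) as the open set
which is the union of its tiles. -/
def tiling {Q : ℕ} (G : Fin Q → Set (EuclideanSpace ℝ (Fin d))) :
    Set (EuclideanSpace ℝ (Fin d)) :=
  ⋃ (w : List (Fin J)) (q : Fin Q), Φ.wordMap w '' G q

/-- The lattice case: all the scaling ratios are positive integer powers of one number `r` in
`(0, 1)`. -/
def IsLattice : Prop :=
  ∃ r : ℝ, 0 < r ∧ r < 1 ∧ ∀ j, ∃ k : ℕ, 0 < k ∧ Φ.ratio j = r ^ k

/-- `ζ` is the scaling zeta function: a meromorphic function on `ℂ` which extends the sum of the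
Dirichlet series `∑_w r_w ^ s` over all finite words, from some right half-plane. (Such a
function is unique up to its values on a discrete set, which do not affect anything below.) -/
def IsScalingZeta (ζ : ℂ → ℂ) : Prop :=
  (∀ s, MeromorphicAt ζ s) ∧
    ∃ σ : ℝ, ∀ s : ℂ, σ < s.re →
      HasSum (fun w : List (Fin J) => ((Φ.wordRatio w : ℝ) : ℂ) ^ s) (ζ s)

end SelfSimilarSystem

/-- The inner `ε`-neighbourhood `{x ∈ A | dist(x, ∂A) ≤ ε}` of `A`. -/
def innerNeighborhood {d : ℕ} (A : Set (EuclideanSpace ℝ (Fin d))) (ε : ℝ) :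
    Set (EuclideanSpace ℝ (Fin d)) :=
  {x | x ∈ A ∧ Metric.infDist x (frontier A) ≤ ε}

/-- The inner tube volume `V(A, ε)`. -/
def tubeVolume {d : ℕ} (A : Set (EuclideanSpace ℝ (Fin d))) (ε : ℝ) : ℝ :=
  (volume (innerNeighborhood A ε)).toReal

/-- The inradius: the supremum of the radii of the balls contained in `A`. -/
def inradius {d : ℕ} (A : Set (EuclideanSpace ℝ (Fin d))) : ℝ :=
  sSup {ε : ℝ | 0 < ε ∧ ∃ x, Metric.ball x ε ⊆ A}

/-- `A` is monophase with coefficients `κ_0, …, κ_d`: its inner tube volume is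
`∑_{k < d} κ_k ε ^ (d - k)` for `ε` below the inradius, and `κ_d = - vol(A)`. -/
def IsMonophase {d : ℕ} (A : Set (EuclideanSpace ℝ (Fin d))) (κ : ℕ → ℝ) : Prop :=
  (∀ ε : ℝ, 0 < ε → ε < inradius A →
    tubeVolume A ε = ∑ k ∈ Finset.range d, κ k * ε ^ (d - k)) ∧
  κ d = -(volume A).toReal

/-- The tubular zeta function
`ζ_T (ε, s) = ε ^ (d - s) ζ(s) ∑_q ∑_{k ≤ d} g_q ^ (s - k) / (s - k) κ_{q,k}` of the tiling with
scaling zeta function `ζ` and generators `G_q` of inradius `g_q` and coefficients `κ_{q,k}`. -/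
def tubularZeta {d Q : ℕ} (G : Fin Q → Set (EuclideanSpace ℝ (Fin d))) (κ : Fin Q → ℕ → ℝ)
    (ζ : ℂ → ℂ) (ε : ℝ) (s : ℂ) : ℂ :=
  (ε : ℂ) ^ ((d : ℂ) - s) * ζ s *
    ∑ q, ∑ k ∈ Finset.range (d + 1),
      ((inradius (G q) : ℝ) : ℂ) ^ (s - (k : ℂ)) / (s - (k : ℂ)) * ((κ q k : ℝ) : ℂ)

/-- The complex dimensions of the tiling: the poles of the scaling zeta function `ζ` (the scaling
dimensions), together with the integral dimensions `0, 1, …, d - 1`. -/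
def complexDimensions (d : ℕ) (ζ : ℂ → ℂ) : Set ℂ :=
  {ω | meromorphicOrderAt ζ ω < 0} ∪ {ω | ∃ k : ℕ, k < d ∧ ω = (k : ℂ)}

/-- The set `A`, of dimension parameter `D`, is Minkowski measurable: the limit of
`V(A, ε) ε ^ (-(d - D))` as `ε → 0⁺` exists in `(0, ∞)`. -/
def MinkowskiMeasurable {d : ℕ} (A : Set (EuclideanSpace ℝ (Fin d))) (D : ℝ) : Prop :=
  ∃ M : ℝ, 0 < M ∧
    Tendsto (fun ε : ℝ => tubeVolume A ε * ε ^ (-((d : ℝ) - D))) (𝓝[>] 0) (𝓝 M)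

end

/-! Put τ_j = log(1/r_j) and p_j = r_j^D, so that the p_j are probability weights. The statements
about poles concern the Moran equation Σ r_j^s = 1 on Re s = D; the statement about measurability is
a renewal theorem.

Splitting a letter off a word gives ζ(s)(1 - Σ r_j^s) = 1, so the poles of ζ are the solutions of
the Moran equation. On Re s = D the summands have moduli p_j adding up to 1, hence a sum equal to 1
forces r_j^s = p_j for every j, that is, τ_j Im s ∈ 2πℤ. The derivative of 1 - Σ r_j^s at such a
point is m = Σ p_j τ_j > 0, so the pole is simple with residue 1/m (`tendsto_residue`). If the τ_j
generate Tℤ, the solutions are D + 2πin/T; if they generate a dense group, only D remains.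

For measurability, the nonvanishing condition forces C to have interior, so the generators are open,
and comparing volumes gives D < d (`dimension_lt`). The tiling is the disjoint union of the
generators and of its own J images. Hence z(t) = e^{(d-D)t} V(𝒯, e^{-t}) satisfies z(t) = h(t) + Σ
p_j z(t - τ_j), with h the contribution of the generators (`normalizedTube_eq`). As d - 1 < D < d, h
decays exponentially at both ends and z is bounded. Along an ultrafilter realising L = limsup z, all
translates of z by the semigroup of steps tend to L too, because a weighted mean of numbers at most
L equals L only if they all do (`exists_ultrafilter_tendsto_of_renewal`). A quantity accumulating h
then identifies L. In the nonlattice case it is Σ p_j ∫_{t-τ_j}^t z, monotone and bounded, and z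
converges to a positive limit. In the lattice case, with τ_j = k_j T, it is Σ p_j Σ_{n<k_j} z(t -
nT), and z is asymptotic to (T/m) Σ_n h(t + nT) (`tendsto_sub_periodization`).

Poisson summation turns this periodization into a Fourier series whose coefficients are 1/m times
the Mellin transforms of the generators at D + 2πin/T: these are the residues of the tubular zeta
function. They are O(n⁻²) because the tube polynomials match the volumes at the inradii. With
denominators cleared they form an exponential polynomial in n, which obeys a linear recurrence; if
it vanished for all large n it would vanish at n = 0, against the assumption. So infinitely many are
nonzero, the periodic asymptotics is not constant, and the limit defining measurability does not
exist. -/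

/-- Lists over `α` are either empty or consist of a head and a tail. -/
def unitSumProdEquivList (α : Type*) : Unit ⊕ (α × List α) ≃ List α where
  toFun := Sum.elim (fun _ => []) (fun x => x.1 :: x.2)
  invFun l := match l with
    | [] => Sum.inl ()
    | a :: l => Sum.inr (a, l)
  left_inv x := by rcases x with _ | _ <;> rfl
  right_inv l := by rcases l with _ | _ <;> rfl

/-! ### The scaling zeta function and the Moran equation. -/

namespace SelfSimilarSystem

variable {d J : ℕ} (Φ : SelfSimilarSystem d J)

/-- The Dirichlet polynomial `∑ j, r_j ^ s`. -/
noncomputable def dirichletPoly (s : ℂ) : ℂ := ∑ j, ((Φ.ratio j : ℝ) : ℂ) ^ s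

/-- The step `log (1 / r_j)`. -/
noncomputable def logStep (j : Fin J) : ℝ := -Real.log (Φ.ratio j)

lemma logStep_pos (j : Fin J) : 0 < Φ.logStep j :=
  neg_pos.2 (Real.log_neg (Φ.ratio_pos j) (Φ.ratio_lt_one j))

lemma exp_neg_logStep (j : Fin J) : Real.exp (-Φ.logStep j) = Φ.ratio j := by
  rw [logStep, neg_neg, Real.exp_log (Φ.ratio_pos j)]

lemma ratio_ne_zero (j : Fin J) : ((Φ.ratio j : ℝ) : ℂ) ≠ 0 := by
  exact_mod_cast (Φ.ratio_pos j).ne'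

lemma ratio_cpow (j : Fin J) (s : ℂ) :
    ((Φ.ratio j : ℝ) : ℂ) ^ s = Complex.exp (-(Φ.logStep j : ℂ) * s) := by
  rw [Complex.cpow_def_of_ne_zero (Φ.ratio_ne_zero j), ← Complex.ofReal_log (Φ.ratio_pos j).le,
    logStep]
  push_cast
  ring_nf

lemma dirichletPoly_eq_exp (s : ℂ) :
    Φ.dirichletPoly s = ∑ j, Complex.exp (-(Φ.logStep j : ℂ) * s) := by
  simp only [dirichletPoly, ratio_cpow]

lemma hasDerivAt_dirichletPoly (s : ℂ) :
    HasDerivAt Φ.dirichletPoly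
      (∑ j, -(Φ.logStep j : ℂ) * ((Φ.ratio j : ℝ) : ℂ) ^ s) s := by
  have : Φ.dirichletPoly = fun s => ∑ j, Complex.exp (-(Φ.logStep j : ℂ) * s) :=
    funext Φ.dirichletPoly_eq_exp
  rw [this]
  refine HasDerivAt.fun_sum fun j _ => ?_
  rw [ratio_cpow]
  simpa [mul_comm] using ((hasDerivAt_id s).const_mul (-(Φ.logStep j : ℂ))).cexp

lemma analyticAt_dirichletPoly (s : ℂ) : AnalyticAt ℂ Φ.dirichletPoly s :=
  (show Differentiable ℂ Φ.dirichletPoly from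
    fun s => (Φ.hasDerivAt_dirichletPoly s).differentiableAt).analyticAt s

/-- A word is empty, contributing 1, or a letter `j` followed by a word `w`, contributing r_j^s
r_w^s. Hence `S = 1 + dirichletPoly s * S` wherever the series converges. -/
lemma mul_one_sub_dirichletPoly_of_hasSum {s S : ℂ}
    (h : HasSum (fun w : List (Fin J) => ((Φ.wordRatio w : ℝ) : ℂ) ^ s) S) :
    S * (1 - Φ.dirichletPoly s) = 1 := by
  have hcons : ∀ j w, ((Φ.wordRatio (j :: w) : ℝ) : ℂ) ^ s =
      ((Φ.ratio j : ℝ) : ℂ) ^ s * ((Φ.wordRatio w : ℝ) : ℂ) ^ s := by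
    intro j w
    simp only [wordRatio, List.map_cons, List.prod_cons, Complex.ofReal_mul]
    refine Complex.mul_cpow_ofReal_nonneg (Φ.ratio_pos j).le (List.prod_nonneg fun a ha => ?_) _
    obtain ⟨i, -, rfl⟩ := List.mem_map.1 ha
    exact (Φ.ratio_pos i).le
  have hinj : Function.Injective (fun x : Fin J × List (Fin J) => x.1 :: x.2) := by
    rintro ⟨a, b⟩ ⟨c, e⟩ hx
    simpa using hx
  have hprod := (h.summable.comp_injective hinj).hasSum
  have hfib := hprod.prod_fiberwise (g := fun j => ((Φ.ratio j : ℝ) : ℂ) ^ s * S) fun j => by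
    simpa only [Function.comp_def, hcons] using h.mul_left _
  have htot := hfib.unique (hasSum_fintype _)
  rw [htot] at hprod
  have hall := (unitSumProdEquivList (Fin J)).hasSum_iff.2 h
  have hsum := HasSum.sum (f := (fun w : List (Fin J) => ((Φ.wordRatio w : ℝ) : ℂ) ^ s) ∘
    unitSumProdEquivList (Fin J)) (a := 1) (b := ∑ j, ((Φ.ratio j : ℝ) : ℂ) ^ s * S)
    (by simp [unitSumProdEquivList, Function.comp_def, wordRatio])
    (by simpa [unitSumProdEquivList, Function.comp_def] using hprod)
  have := hall.unique hsum
  rw [← Finset.sum_mul] at this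
  rw [dirichletPoly, mul_sub, mul_one]
  nth_rewrite 1 [this]
  ring

/-- Identity theorem: the difference of the two sides vanishes on a half-plane, so it has infinite
order at one point and therefore at every point of ℂ. Only punctured neighbourhoods can appear,
since single values of `ζ` are not constrained. -/
lemma IsScalingZeta.eventually_mul_eq_one {Φ : SelfSimilarSystem d J} {ζ : ℂ → ℂ}
    (hζ : Φ.IsScalingZeta ζ) (ω : ℂ) :
    ∀ᶠ s in 𝓝[≠] ω, ζ s * (1 - Φ.dirichletPoly s) = 1 := by
  obtain ⟨hm, σ, hσ⟩ := hζ
  set f : ℂ → ℂ := fun s => ζ s * (1 - Φ.dirichletPoly s) - 1 with hf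
  have hfm : Meromorphic f := fun s =>
    ((hm s).mul ((MeromorphicAt.const 1 s).sub (Φ.analyticAt_dirichletPoly s).meromorphicAt)).sub
      (MeromorphicAt.const 1 s)
  have htop : meromorphicOrderAt f ((σ + 1 : ℝ) : ℂ) = ⊤ := by
    rw [meromorphicOrderAt_eq_top_iff]
    refine Filter.Eventually.filter_mono nhdsWithin_le_nhds ?_
    have : {s : ℂ | σ < s.re} ∈ 𝓝 ((σ + 1 : ℝ) : ℂ) :=
      (isOpen_lt continuous_const Complex.continuous_re).mem_nhds (by simp)
    filter_upwards [this] with s hs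
    simp only [hf]
    rw [Φ.mul_one_sub_dirichletPoly_of_hasSum (hσ s hs), sub_self]
  have hω : meromorphicOrderAt f ω = ⊤ := by
    by_contra hne
    exact (hfm.exists_meromorphicOrderAt_ne_top_iff_forall.1 ⟨ω, hne⟩ _) htop
  filter_upwards [meromorphicOrderAt_eq_top_iff.1 hω] with s hs
  exact sub_eq_zero.1 hs

lemma IsScalingZeta.meromorphicOrderAt_eq {Φ : SelfSimilarSystem d J} {ζ : ℂ → ℂ}
    (hζ : Φ.IsScalingZeta ζ) (ω : ℂ) :
    meromorphicOrderAt ζ ω = -meromorphicOrderAt (fun s => 1 - Φ.dirichletPoly s) ω := by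
  rw [← meromorphicOrderAt_inv]
  refine meromorphicOrderAt_congr ?_
  filter_upwards [hζ.eventually_mul_eq_one ω] with s hs
  exact eq_inv_of_mul_eq_one_left hs

lemma IsScalingZeta.meromorphicOrderAt_neg_iff {Φ : SelfSimilarSystem d J} {ζ : ℂ → ℂ}
    (hζ : Φ.IsScalingZeta ζ) (ω : ℂ) :
    meromorphicOrderAt ζ ω < 0 ↔ Φ.dirichletPoly ω = 1 := by
  have han : AnalyticAt ℂ (fun s => 1 - Φ.dirichletPoly s) ω :=
    analyticAt_const.sub (Φ.analyticAt_dirichletPoly ω)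
  have hpos : meromorphicOrderAt ζ ω < 0 ↔
      0 < meromorphicOrderAt (fun s => 1 - Φ.dirichletPoly s) ω := by
    rw [hζ.meromorphicOrderAt_eq]
    cases h : meromorphicOrderAt (fun s => 1 - Φ.dirichletPoly s) ω with
    -- Infinite order would make 1 - Σ r_j^s vanish near `ω`, but its product with `ζ` is 1 there.
    | top =>
      exfalso
      have h1 := meromorphicOrderAt_eq_top_iff.1 h
      obtain ⟨s, hs, hs'⟩ := (h1.and (hζ.eventually_mul_eq_one ω)).exists
      simp [hs] at hs'
    | coe n =>
      norm_cast
      exact neg_lt_zero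
  rw [hpos, ← tendsto_zero_iff_meromorphicOrderAt_pos han.meromorphicAt]
  have hc : Tendsto (fun s => 1 - Φ.dirichletPoly s) (𝓝[≠] ω) (𝓝 (1 - Φ.dirichletPoly ω)) :=
    han.continuousAt.tendsto.mono_left nhdsWithin_le_nhds
  constructor
  · intro h
    exact (sub_eq_zero.1 (tendsto_nhds_unique hc h)).symm
  · intro h
    rwa [h, sub_self] at hc

variable {D : ℝ}

lemma ratio_cpow_of_re {s : ℂ} (hre : s.re = D) (j : Fin J) :
    ((Φ.ratio j : ℝ) : ℂ) ^ s =
      ((Φ.ratio j ^ D : ℝ) : ℂ) * Complex.exp (((-(Φ.logStep j * s.im) : ℝ) : ℂ) * Complex.I) := by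
  have : ((Φ.ratio j ^ D : ℝ) : ℂ) = Complex.exp (-(Φ.logStep j : ℂ) * (D : ℂ)) := by
    rw [← ratio_cpow, Complex.ofReal_cpow (Φ.ratio_pos j).le]
  rw [this, ratio_cpow, ← Complex.exp_add]
  congr 1
  conv_lhs => rw [← Complex.re_add_im s, hre]
  push_cast
  ring

/-- On the line `re s = D`, `∑ j, r_j ^ s = 1` forces `r_j ^ s = r_j ^ D` for all `j`. -/
lemma dirichletPoly_eq_one_iff (hD : ∑ j, Φ.ratio j ^ D = 1) {s : ℂ} (hre : s.re = D) :
    Φ.dirichletPoly s = 1 ↔ ∀ j, ((Φ.ratio j : ℝ) : ℂ) ^ s = ((Φ.ratio j ^ D : ℝ) : ℂ) := by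
  constructor
  · intro h
    -- Each real part is at most the modulus r_j^D and both families sum to 1, so equality holds
    -- termwise; a number whose real part is its modulus is a nonnegative real.
    have hle : ∀ j, (((Φ.ratio j : ℝ) : ℂ) ^ s).re ≤ Φ.ratio j ^ D := fun j => by
      refine (Complex.re_le_norm _).trans ?_
      rw [Complex.norm_cpow_eq_rpow_re_of_pos (Φ.ratio_pos j), hre]
    have hsum : ∑ j, (((Φ.ratio j : ℝ) : ℂ) ^ s).re = ∑ j, Φ.ratio j ^ D := by
      rw [hD, ← Complex.re_sum]
      have := congrArg Complex.re h
      simpa [dirichletPoly] using this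
    have heq := (Finset.sum_eq_sum_iff_of_le fun j _ => hle j).1 hsum
    intro j
    have h1 := heq j (Finset.mem_univ j)
    have h2 : ‖((Φ.ratio j : ℝ) : ℂ) ^ s‖ = Φ.ratio j ^ D := by
      rw [Complex.norm_cpow_eq_rpow_re_of_pos (Φ.ratio_pos j), hre]
    have h3 : (((Φ.ratio j : ℝ) : ℂ) ^ s).re = ‖((Φ.ratio j : ℝ) : ℂ) ^ s‖ := by rw [h1, h2]
    have h4 := (Complex.re_eq_norm.1 h3)
    rw [← h1]
    exact Complex.ext rfl (by simpa using (Complex.nonneg_iff.1 h4).2.symm)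
  · intro h
    rw [dirichletPoly, Finset.sum_congr rfl fun j _ => h j]
    exact_mod_cast hD

/-- On the line, r_j^s has modulus r_j^D and phase `-logStep j * s.im`, so only the phase is left to
be trivial. -/
lemma dirichletPoly_eq_one_iff_int (hD : ∑ j, Φ.ratio j ^ D = 1) {s : ℂ} (hre : s.re = D) :
    Φ.dirichletPoly s = 1 ↔ ∀ j, ∃ n : ℤ, Φ.logStep j * s.im = n * (2 * Real.pi) := by
  rw [Φ.dirichletPoly_eq_one_iff hD hre]
  refine forall_congr' fun j => ?_
  have hne : ((Φ.ratio j ^ D : ℝ) : ℂ) ≠ 0 := by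
    exact_mod_cast (Real.rpow_pos_of_pos (Φ.ratio_pos j) D).ne'
  rw [Φ.ratio_cpow_of_re hre, show ∀ z : ℂ, ((Φ.ratio j ^ D : ℝ) : ℂ) * z =
    ((Φ.ratio j ^ D : ℝ) : ℂ) ↔ z = 1 from fun z => mul_eq_left₀ hne, Complex.exp_eq_one_iff]
  constructor
  · rintro ⟨n, hn⟩
    refine ⟨-n, ?_⟩
    have := congrArg Complex.im hn
    simp at this
    push_cast
    linarith
  · rintro ⟨n, hn⟩
    refine ⟨-n, ?_⟩
    rw [hn]
    push_cast
    ring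

/-- The mean `∑ j, r_j ^ D log (1 / r_j)`. -/
noncomputable def meanStep (D : ℝ) : ℝ := ∑ j, Φ.ratio j ^ D * Φ.logStep j

lemma index_nonempty (Φ : SelfSimilarSystem d J) : Nonempty (Fin J) :=
    ⟨⟨0, by have := Φ.two_le; omega⟩⟩

lemma meanStep_pos (D : ℝ) : 0 < Φ.meanStep D :=
  haveI := Φ.index_nonempty
  Finset.sum_pos (fun j _ => mul_pos (Real.rpow_pos_of_pos (Φ.ratio_pos j) D) (Φ.logStep_pos j))
    Finset.univ_nonempty

/-- Since r_j^ω = r_j^D at every solution on the line, the derivative is the same positive number at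
all of them. This makes all these poles simple, with one common residue. -/
lemma hasDerivAt_one_sub_dirichletPoly (hD : ∑ j, Φ.ratio j ^ D = 1) {ω : ℂ} (hre : ω.re = D)
    (hω : Φ.dirichletPoly ω = 1) :
    HasDerivAt (fun s => 1 - Φ.dirichletPoly s) (Φ.meanStep D : ℂ) ω := by
  have this := (Φ.dirichletPoly_eq_one_iff hD hre).1 hω
  have h2 : -∑ j, -(Φ.logStep j : ℂ) * ((Φ.ratio j : ℝ) : ℂ) ^ ω = (Φ.meanStep D : ℂ) := by
    rw [Finset.sum_congr rfl fun j _ => by rw [this j], meanStep, ← Finset.sum_neg_distrib]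
    push_cast
    exact Finset.sum_congr rfl fun j _ => by ring
  rw [← h2]
  exact (Φ.hasDerivAt_dirichletPoly ω).const_sub 1

/-- The residue of the scaling zeta function at a pole with real part `D`. -/
lemma IsScalingZeta.tendsto_residue {Φ : SelfSimilarSystem d J} {ζ : ℂ → ℂ}
    (hζ : Φ.IsScalingZeta ζ) (hD : ∑ j, Φ.ratio j ^ D = 1) {ω : ℂ} (hre : ω.re = D)
    (hω : Φ.dirichletPoly ω = 1) :
    Tendsto (fun s => (s - ω) * ζ s) (𝓝[≠] ω) (𝓝 ((Φ.meanStep D : ℂ)⁻¹)) := by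
  have h := (Φ.hasDerivAt_one_sub_dirichletPoly hD hre hω).tendsto_slope
  have hne : (Φ.meanStep D : ℂ) ≠ 0 := by exact_mod_cast (Φ.meanStep_pos D).ne'
  refine (h.inv₀ hne).congr' ?_
  filter_upwards [hζ.eventually_mul_eq_one ω] with s hs
  rw [eq_inv_of_mul_eq_one_left hs, slope_def_field, hω]
  simp [div_eq_mul_inv]

lemma IsScalingZeta.meromorphicOrderAt_eq_neg_one {Φ : SelfSimilarSystem d J} {ζ : ℂ → ℂ}
    (hζ : Φ.IsScalingZeta ζ) (hD : ∑ j, Φ.ratio j ^ D = 1) {ω : ℂ} (hre : ω.re = D)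
    (hω : Φ.dirichletPoly ω = 1) : meromorphicOrderAt ζ ω = -1 := by
  have hne : (Φ.meanStep D : ℂ) ≠ 0 := by exact_mod_cast (Φ.meanStep_pos D).ne'
  have h := hζ.tendsto_residue hD hre hω
  have hm : MeromorphicAt (fun s => (s - ω) * ζ s) ω :=
    (((analyticAt_id).sub analyticAt_const).meromorphicAt).mul (hζ.1 ω)
  have h0 := (tendsto_ne_zero_iff_meromorphicOrderAt_eq_zero hm).1 ⟨_, inv_ne_zero hne, h⟩
  have hmul := meromorphicOrderAt_mul (x := ω) (f := fun s => s - ω) (g := ζ)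
    (((analyticAt_id).sub analyticAt_const).meromorphicAt) (hζ.1 ω)
  have h1 : meromorphicOrderAt (fun s : ℂ => s - ω) ω = 1 := by
    simp
  have h2 : (1 : WithTop ℤ) + meromorphicOrderAt ζ ω = 0 := by
    rw [← h1, ← hmul]; exact h0
  cases h3 : meromorphicOrderAt ζ ω with
  | top =>
    rw [h3] at h2
    exact absurd h2 (by simp)
  | coe n =>
    rw [h3] at h2
    have h2' : ((1 + n : ℤ) : WithTop ℤ) = ((0 : ℤ) : WithTop ℤ) := by exact_mod_cast h2
    have : n = -1 := by have := WithTop.coe_injective h2'; omega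
    rw [this]; rfl

lemma dirichletPoly_ofReal (hD : ∑ j, Φ.ratio j ^ D = 1) : Φ.dirichletPoly (D : ℂ) = 1 :=
  (Φ.dirichletPoly_eq_one_iff hD (Complex.ofReal_re D)).2 fun j =>
    (Complex.ofReal_cpow (Φ.ratio_pos j).le D).symm

/-- The complex dimensions on the line `re s = D` are the solutions of the Moran equation. -/
lemma mem_complexDimensions_iff {Φ : SelfSimilarSystem d J} {ζ : ℂ → ℂ}
    (hζ : Φ.IsScalingZeta ζ) (hD : ∑ j, Φ.ratio j ^ D = 1) {ω : ℂ} (hre : ω.re = D) :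
    ω ∈ complexDimensions d ζ ↔ Φ.dirichletPoly ω = 1 := by
  rw [← hζ.meromorphicOrderAt_neg_iff]
  refine ⟨?_, fun h => Or.inl h⟩
  rintro (h | ⟨k, -, rfl⟩)
  · exact h
  -- An integral dimension on the line is the point `D` itself, which solves the Moran equation
  -- anyway.
  · rw [hζ.meromorphicOrderAt_neg_iff]
    rw [Complex.natCast_re] at hre
    have := Φ.dirichletPoly_ofReal hD
    rw [← hre] at this
    exact_mod_cast this

/-! ### The group of steps: lattice and nonlattice case. -/

/-- The additive group generated by the steps `log (1 / r_j)`. -/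
noncomputable def stepGroup : AddSubgroup ℝ := AddSubgroup.closure (Set.range Φ.logStep)

lemma logStep_mem_stepGroup (j : Fin J) : Φ.logStep j ∈ Φ.stepGroup :=
  AddSubgroup.subset_closure ⟨j, rfl⟩

/-- The steps are positive, so `τ ≠ 0` and replacing `τ` by its absolute value makes all multipliers
positive; the common base is then exp(-|τ|). -/
lemma isLattice_of_forall_int {τ : ℝ} (h : ∀ j, ∃ n : ℤ, Φ.logStep j = n * τ) :
    Φ.IsLattice := by
  have hτ : τ ≠ 0 := by
    rintro rfl
    obtain ⟨j⟩ := Φ.index_nonempty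
    obtain ⟨n, hn⟩ := h j
    have := Φ.logStep_pos j
    simp [hn] at this
  refine ⟨Real.exp (-|τ|), Real.exp_pos _, ?_, fun j => ?_⟩
  · rw [Real.exp_lt_one_iff]
    simpa using hτ
  · obtain ⟨n, hn⟩ := h j
    have hpos := Φ.logStep_pos j
    have habs : Φ.logStep j = n.natAbs * |τ| := by
      rw [Nat.cast_natAbs, Int.cast_abs, ← abs_mul, ← hn, abs_of_pos hpos]
    refine ⟨n.natAbs, ?_, ?_⟩
    · rcases Nat.eq_zero_or_pos n.natAbs with h0 | h0
      · rw [habs, h0] at hpos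
        simp at hpos
      · exact h0
    · rw [← Φ.exp_neg_logStep, ← Real.exp_nat_mul, habs]
      ring_nf

/-- A subgroup of ℝ is dense or cyclic, and multiples of log(1/r) leave a gap above 0. The number
log(1/r) itself may be finer than the group; the exact generator is needed for the poles on the line
to be exactly an arithmetic progression. -/
lemma IsLattice.exists_stepGroup_eq {Φ : SelfSimilarSystem d J} (h : Φ.IsLattice) :
    ∃ τ : ℝ, 0 < τ ∧ Φ.stepGroup = AddSubgroup.zmultiples τ := by
  obtain ⟨r, hr0, hr1, hr⟩ := h
  have hle : Φ.stepGroup ≤ AddSubgroup.zmultiples (-Real.log r) := by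
    rw [stepGroup, AddSubgroup.closure_le]
    rintro _ ⟨j, rfl⟩
    obtain ⟨k, -, hk⟩ := hr j
    exact ⟨k, by simp [logStep, hk, Real.log_pow]⟩
  have hcyc : ∃ a, Φ.stepGroup = AddSubgroup.closure {a} := by
    rcases Φ.stepGroup.dense_or_cyclic with hd | hc
    · exfalso
      have hl : 0 < -Real.log r := neg_pos.2 (Real.log_neg hr0 hr1)
      obtain ⟨x, hx, hx1, hx2⟩ := hd.exists_between hl
      obtain ⟨n, hn⟩ := hle hx
      simp only [zsmul_eq_mul] at hn
      rw [← hn] at hx1 hx2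
      have h1 : (0 : ℝ) < n := pos_of_mul_pos_left hx1 hl.le
      have h2 : (n : ℝ) < 1 := by
        by_contra hcon
        nlinarith [not_lt.1 hcon]
      have h1' : 0 < n := by exact_mod_cast h1
      have h2' : n < 1 := by exact_mod_cast h2
      omega
    · exact hc
  obtain ⟨a, ha⟩ := hcyc
  rw [← AddSubgroup.zmultiples_eq_closure] at ha
  have ha0 : a ≠ 0 := by
    rintro rfl
    obtain ⟨j⟩ := Φ.index_nonempty
    have := Φ.logStep_mem_stepGroup j
    rw [ha] at this
    simp at this
    exact (Φ.logStep_pos j).ne' this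
  refine ⟨|a|, abs_pos.2 ha0, ?_⟩
  rcases abs_choice a with h | h <;> rw [h, ha]
  simp

lemma dense_stepGroup (h : ¬ Φ.IsLattice) : Dense (Φ.stepGroup : Set ℝ) := by
  rcases Φ.stepGroup.dense_or_cyclic with hd | ⟨a, ha⟩
  · exact hd
  · refine absurd (Φ.isLattice_of_forall_int (τ := a) fun j => ?_) h
    have := Φ.logStep_mem_stepGroup j
    rw [ha, ← AddSubgroup.zmultiples_eq_closure] at this
    obtain ⟨n, hn⟩ := this
    exact ⟨n, by simpa using hn.symm⟩

/-- The complex dimensions on the line `re s = D` in the nonlattice case. -/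
lemma complexDimensions_inter_of_not_isLattice {Φ : SelfSimilarSystem d J} {ζ : ℂ → ℂ}
    (hζ : Φ.IsScalingZeta ζ) (hD : ∑ j, Φ.ratio j ^ D = 1) (h : ¬ Φ.IsLattice) :
    complexDimensions d ζ ∩ {ω | ω.re = D} = {(D : ℂ)} := by
  ext ω
  constructor
  · rintro ⟨hω, hre⟩
    rw [mem_complexDimensions_iff hζ hD hre, Φ.dirichletPoly_eq_one_iff_int hD hre] at hω
    have him : ω.im = 0 := by
      by_contra hne
      refine h (Φ.isLattice_of_forall_int (τ := 2 * Real.pi / ω.im) fun j => ?_)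
      obtain ⟨n, hn⟩ := hω j
      exact ⟨n, by field_simp; linarith⟩
    exact Complex.ext hre him
  · rintro rfl
    exact ⟨(mem_complexDimensions_iff hζ hD (Complex.ofReal_re D)).2
      (Φ.dirichletPoly_ofReal hD), Complex.ofReal_re D⟩

/-- The Moran equation on the line `re s = D` in the lattice case. -/
lemma dirichletPoly_eq_one_iff_of_stepGroup (hD : ∑ j, Φ.ratio j ^ D = 1) {τ : ℝ} (hτ : 0 < τ)
    (hg : Φ.stepGroup = AddSubgroup.zmultiples τ) {ω : ℂ} (hre : ω.re = D) :
    Φ.dirichletPoly ω = 1 ↔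
      ∃ n : ℤ, (D : ℂ) + (n : ℂ) * ((2 * Real.pi / τ : ℝ) : ℂ) * Complex.I = ω := by
  rw [Φ.dirichletPoly_eq_one_iff_int hD hre]
  constructor
  · intro h
    -- The `x` with `x * ω.im` in 2πℤ form a group; containing all steps, it contains the generator
    -- `τ`.
    have hall : ∀ x ∈ Φ.stepGroup, ∃ n : ℤ, x * ω.im = n * (2 * Real.pi) := by
      intro x hx
      refine AddSubgroup.closure_induction (p := fun x _ => ∃ n : ℤ, x * ω.im = n * (2 * Real.pi))
        ?_ ⟨0, by simp⟩ ?_ ?_ hx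
      · rintro _ ⟨j, rfl⟩
        exact h j
      · rintro x y - - ⟨n, hn⟩ ⟨m, hm⟩
        exact ⟨n + m, by push_cast; linarith⟩
      · rintro x - ⟨n, hn⟩
        exact ⟨-n, by push_cast; linarith⟩
    obtain ⟨n, hn⟩ := hall τ (hg ▸ AddSubgroup.mem_zmultiples τ)
    refine ⟨n, Complex.ext (by simp [hre]) ?_⟩
    have : ω.im = n * (2 * Real.pi / τ) := by field_simp; linarith
    simp [this, -Complex.ofReal_div, -Complex.ofReal_mul]
  · rintro ⟨n, rfl⟩ j
    have := Φ.logStep_mem_stepGroup j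
    rw [hg] at this
    obtain ⟨k, hk⟩ := this
    refine ⟨k * n, ?_⟩
    simp only [zsmul_eq_mul] at hk
    rw [← hk]
    simp [-Complex.ofReal_div, -Complex.ofReal_mul]
    field_simp

lemma complexDimensions_inter_of_stepGroup {Φ : SelfSimilarSystem d J} {ζ : ℂ → ℂ}
    (hζ : Φ.IsScalingZeta ζ) (hD : ∑ j, Φ.ratio j ^ D = 1) {τ : ℝ} (hτ : 0 < τ)
    (hg : Φ.stepGroup = AddSubgroup.zmultiples τ) :
    complexDimensions d ζ ∩ {ω | ω.re = D} =
      Set.range (fun n : ℤ => (D : ℂ) + (n : ℂ) * ((2 * Real.pi / τ : ℝ) : ℂ) * Complex.I) := by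
  have key : ∀ n : ℤ, ((D : ℂ) + (n : ℂ) * ((2 * Real.pi / τ : ℝ) : ℂ) * Complex.I).re = D := by
    intro n
    simp [-Complex.ofReal_div, -Complex.ofReal_mul]
  ext ω
  constructor
  · rintro ⟨hω, hre⟩
    rw [mem_complexDimensions_iff hζ hD hre] at hω
    exact (Φ.dirichletPoly_eq_one_iff_of_stepGroup hD hτ hg hre).1 hω
  · rintro ⟨n, rfl⟩
    refine ⟨(mem_complexDimensions_iff hζ hD (key n)).2 ?_, key n⟩
    exact (Φ.dirichletPoly_eq_one_iff_of_stepGroup hD hτ hg (key n)).2 ⟨n, rfl⟩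

lemma infinite_complexDimensions_inter {Φ : SelfSimilarSystem d J} {ζ : ℂ → ℂ}
    (hζ : Φ.IsScalingZeta ζ) (hD : ∑ j, Φ.ratio j ^ D = 1) (h : Φ.IsLattice) :
    (complexDimensions d ζ ∩ {ω | ω.re = D}).Infinite := by
  obtain ⟨τ, hτ, hg⟩ := h.exists_stepGroup_eq
  rw [complexDimensions_inter_of_stepGroup hζ hD hτ hg]
  refine Set.infinite_range_of_injective fun n m hnm => ?_
  have := congrArg Complex.im hnm
  have hp : 2 * Real.pi / τ ≠ 0 := by positivity
  simpa [-Complex.ofReal_div, -Complex.ofReal_mul, hp, Real.pi_ne_zero, hτ.ne'] using this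

end SelfSimilarSystem

/-! ### Renewal theorems. -/

/-- A submonoid of `ℝ` containing two elements at distance `e` meets every half-open interval
of length `e` which is far enough to the right. -/
lemma AddSubmonoid.exists_forall_ge_exists_mem_Ioc {S : AddSubmonoid ℝ} {a b e : ℝ}
    (ha : a ∈ S) (hb : b ∈ S) (hb0 : 0 < b) (he : 0 < e) (hab : a = b + e) :
    ∃ A : ℝ, ∀ u, A ≤ u → ∃ σ ∈ S, u - e < σ ∧ σ ≤ u := by
  -- The elements (N - k) b + k a = N b + k e with 0 ≤ k ≤ N have gaps `e` and run from N b to N b +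
  -- N e. Beyond this threshold N = ⌊u / b⌋ satisfies N e ≥ b, so they reach past `u`.
  refine ⟨(⌈b / e⌉₊ + 1) * b, fun u hu => ?_⟩
  have hu0 : 0 ≤ u := le_trans (by positivity) hu
  set N := ⌊u / b⌋₊ with hN
  have hN1 : N * b ≤ u := by
    have := Nat.floor_le (div_nonneg hu0 hb0.le)
    rwa [le_div_iff₀ hb0] at this
  have hN2 : u < (N + 1) * b := by
    have := Nat.lt_floor_add_one (u / b)
    rwa [div_lt_iff₀ hb0] at this
  have hN3 : b / e ≤ N := by
    have h1 : ((⌈b / e⌉₊ : ℝ) + 1) < N + 1 := lt_of_mul_lt_mul_right (hu.trans_lt hN2) hb0.le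
    have h2 := Nat.le_ceil (b / e)
    linarith
  set k := ⌊(u - N * b) / e⌋₊ with hk
  have hk1 : k * e ≤ u - N * b := by
    have := Nat.floor_le (div_nonneg (sub_nonneg.2 hN1) he.le)
    rwa [le_div_iff₀ he] at this
  have hk2 : u - N * b < (k + 1) * e := by
    have := Nat.lt_floor_add_one ((u - N * b) / e)
    rwa [div_lt_iff₀ he] at this
  have hkN : k ≤ N := by
    have h1 : (k : ℝ) * e ≤ N * e := by
      rw [div_le_iff₀ he] at hN3
      linarith
    exact_mod_cast le_of_mul_le_mul_right h1 he
  refine ⟨(N - k) • b + k • a, S.add_mem (S.nsmul_mem hb _) (S.nsmul_mem ha _), ?_, ?_⟩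
  all_goals
    simp only [nsmul_eq_mul, Nat.cast_sub hkN]
    rw [hab]
    nlinarith

/-- Group elements are differences of semigroup elements, so a small element of the group yields two
elements of the semigroup at that small distance. -/
lemma AddSubgroup.exists_add_eq_of_mem_closure {A : Type*} [AddCommGroup A] {X : Set A} {e : A}
    (he : e ∈ AddSubgroup.closure X) :
    ∃ a ∈ AddSubmonoid.closure X, ∃ b ∈ AddSubmonoid.closure X, a = b + e := by
  induction he using AddSubgroup.closure_induction with
  | mem x hx => exact ⟨x, AddSubmonoid.subset_closure hx, 0, zero_mem _, by simp⟩
  | zero => exact ⟨0, zero_mem _, 0, zero_mem _, by simp⟩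
  | add x y _ _ hx hy =>
    obtain ⟨a, ha, b, hb, h⟩ := hx
    obtain ⟨a', ha', b', hb', h'⟩ := hy
    exact ⟨a + a', add_mem ha ha', b + b', add_mem hb hb', by rw [h, h']; abel⟩
  | neg x _ hx =>
    obtain ⟨a, ha, b, hb, h⟩ := hx
    exact ⟨b, hb, a, ha, by rw [h]; abel⟩

section Renewal

variable {ι : Type*} {p τ : ι → ℝ}

lemma exists_forall_ge_exists_mem_closure_Ioc [Nonempty ι] (hτ : ∀ i, 0 < τ i) {e : ℝ}
    (he : 0 < e) (hmem : e ∈ AddSubgroup.closure (Set.range τ)) :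
    ∃ A : ℝ, ∀ u, A ≤ u → ∃ σ ∈ AddSubmonoid.closure (Set.range τ), u - e < σ ∧ σ ≤ u := by
  obtain ⟨a, ha, b, hb, hab⟩ := AddSubgroup.exists_add_eq_of_mem_closure hmem
  obtain ⟨i⟩ := ‹Nonempty ι›
  have hi : τ i ∈ AddSubmonoid.closure (Set.range τ) := AddSubmonoid.subset_closure ⟨i, rfl⟩
  have hnonneg : ∀ x ∈ AddSubmonoid.closure (Set.range τ), 0 ≤ x := by
    intro x hx
    induction hx using AddSubmonoid.closure_induction with
    | mem x hx => obtain ⟨j, rfl⟩ := hx; exact (hτ j).le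
    | zero => exact le_rfl
    | add x y _ _ hx hy => exact add_nonneg hx hy
  have hb0 := hnonneg b hb
  -- Adding one step to both elements keeps their difference and makes the smaller one positive.
  exact AddSubmonoid.exists_forall_ge_exists_mem_Ioc (add_mem ha hi) (add_mem hb hi)
    (by have := hτ i; linarith) he (by rw [hab]; ring)

variable [Fintype ι]

/-- Every bounded solution of the renewal equation with vanishing inhomogeneity at infinity comes
close to its upper limit on all translates by the semigroup of the steps. -/
lemma exists_ultrafilter_tendsto_of_renewal (hp : ∀ i, 0 < p i) (hp1 : ∑ i, p i = 1)
    {z : ℝ → ℝ} {B : ℝ} (hB : ∀ t, |z t| ≤ B)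
    (hz : Tendsto (fun t => z t - ∑ i, p i * z (t - τ i)) atTop (𝓝 0)) :
    ∃ (L : ℝ) (U : Ultrafilter ℝ), (U : Filter ℝ) ≤ atTop ∧
      (∀ ε > 0, ∀ᶠ t in atTop, z t < L + ε) ∧
      ∀ σ ∈ AddSubmonoid.closure (Set.range τ), Tendsto (fun t => z (t - σ)) U (𝓝 L) := by
  have hbdd : atTop.IsBoundedUnder (· ≤ ·) z := ⟨B, by
    simpa using Eventually.of_forall (f := atTop) fun t => (abs_le.1 (hB t)).2⟩
  have hcob : atTop.IsCoboundedUnder (· ≤ ·) z :=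
    IsBoundedUnder.isCoboundedUnder_le ⟨-B, by
      simpa using Eventually.of_forall (f := atTop) fun t => (abs_le.1 (hB t)).1⟩
  set L := limsup z atTop with hL
  have hup : ∀ ε > 0, ∀ᶠ t in atTop, z t < L + ε := fun ε hε =>
    eventually_lt_of_limsup_lt (by linarith) hbdd
  have hclus : MapClusterPt L atTop z := by
    rw [mapClusterPt_iff_frequently]
    intro s hs
    obtain ⟨ε, hε, hsub⟩ := Metric.mem_nhds_iff.1 hs
    have h1 : ∃ᶠ t in atTop, L - ε < z t :=
      frequently_lt_of_lt_limsup hcob (by linarith)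
    refine (h1.and_eventually (hup ε hε)).mono fun t ht => hsub ?_
    rw [Metric.mem_ball, Real.dist_eq, abs_lt]
    constructor <;> linarith [ht.1, ht.2]
  -- Along an ultrafilter every bounded translate of `z` converges, so no diagonal choice of
  -- sequences is needed.
  obtain ⟨U, hU, hUL⟩ := mapClusterPt_iff_ultrafilter.1 hclus
  have hshift : ∀ σ : ℝ, Tendsto (fun t => t - σ) (U : Filter ℝ) atTop := fun σ =>
    (tendsto_atTop_add_const_right _ (-σ) hU)
  have hlim : ∀ σ : ℝ, ∃ g ≤ L, Tendsto (fun t => z (t - σ)) U (𝓝 g) := by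
    intro σ
    have hK : IsCompact (Set.Icc (-B) B) := isCompact_Icc
    obtain ⟨g, -, hg⟩ := hK.ultrafilter_le_nhds (U.map fun t => z (t - σ)) (by
      rw [le_principal_iff]
      exact Filter.mem_map.2 (Filter.univ_mem' fun t => abs_le.1 (hB _)))
    have hg' : Tendsto (fun t => z (t - σ)) U (𝓝 g) := hg
    refine ⟨g, le_of_forall_pos_le_add fun ε hε => ?_, hg'⟩
    exact le_of_tendsto hg' (((hshift σ).eventually (hup ε hε)).mono fun t ht => ht.le)
  refine ⟨L, U, hU, hup, fun σ hσ => ?_⟩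
  induction hσ using AddSubmonoid.closure_induction_left with
  | zero => simpa using hUL
  | add_left x hx y hy ih =>
    obtain ⟨j, rfl⟩ := hx
    choose g hgL hg using fun i => hlim (y + τ i)
    have h1 : Tendsto (fun t => ∑ i, p i * z (t - (y + τ i))) U (𝓝 (∑ i, p i * g i)) :=
      tendsto_finsetSum _ fun i _ => (hg i).const_mul _
    have h2 : Tendsto (fun t => z (t - y) - ∑ i, p i * z (t - y - τ i)) U (𝓝 0) :=
      hz.comp (hshift y)
    have h3 : ∑ i, p i * g i = L := by
      refine tendsto_nhds_unique h1 ?_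
      have := ih.sub h2
      rw [sub_zero] at this
      refine this.congr fun t => ?_
      simp only [sub_sub_cancel, sub_sub]
    -- The weighted mean of the limits `g i ≤ L` equals `L` and the weights are positive, so each `g
    -- i` is `L`.
    have h4 : ∑ i, p i * g i = ∑ i, p i * L := by
      rw [h3, ← Finset.sum_mul, hp1, one_mul]
    have h5 := (Finset.sum_eq_sum_iff_of_le fun i _ =>
      mul_le_mul_of_nonneg_left (hgL i) (hp i).le).1 h4 j (Finset.mem_univ j)
    have h6 : g j = L := mul_left_cancel₀ (hp j).ne' h5
    rw [add_comm, ← h6]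
    exact hg j

lemma tendsto_of_forall_eventually_lt {z : ℝ → ℝ} {M : ℝ}
    (h1 : ∀ ε > 0, ∀ᶠ t in atTop, z t < M + ε) (h2 : ∀ ε > 0, ∀ᶠ t in atTop, -z t < -M + ε) :
    Tendsto z atTop (𝓝 M) := by
  rw [Metric.tendsto_nhds]
  intro ε hε
  filter_upwards [h1 ε hε, h2 ε hε] with t ht1 ht2
  rw [Real.dist_eq, abs_lt]
  constructor <;> linarith

/-- Boundedness of solutions of a renewal inequality with exponentially decaying
inhomogeneity. -/
lemma exists_forall_le_of_renewal [Nonempty ι] (hp : ∀ i, 0 < p i) (hp1 : ∑ i, p i = 1)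
    (hτ : ∀ i, 0 < τ i) {z : ℝ → ℝ} {a C T B : ℝ} (ha : 0 < a) (hC : 0 ≤ C)
    (hz : ∀ t, T ≤ t → z t ≤ C * Real.exp (-a * t) + ∑ i, p i * z (t - τ i))
    (hB : ∀ t, t ≤ T → z t ≤ B) : ∃ B', ∀ t, z t ≤ B' := by
  obtain ⟨i₀, hi₀⟩ := Finite.exists_min τ
  set μ := τ i₀
  have hμ : 0 < μ := hτ i₀
  set K := ∑ i, τ i
  have hK : ∀ i, τ i ≤ K := fun i =>
    Finset.single_le_sum (f := τ) (fun j _ => (hτ j).le) (Finset.mem_univ i)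
  have hK0 : 0 < K := hμ.trans_le (hK i₀)
  set s := ∑ i, p i * Real.exp (a * τ i) - 1 with hs
  have hs0 : 0 < s := by
    have : ∑ i, p i < ∑ i, p i * Real.exp (a * τ i) := by
      refine Finset.sum_lt_sum_of_nonempty Finset.univ_nonempty fun i _ => ?_
      have : 1 < Real.exp (a * τ i) := Real.one_lt_exp_iff.2 (mul_pos ha (hτ i))
      nlinarith [hp i]
    rw [hs]; linarith
  -- The barrier `B₁ - C' * exp (-a t)` is a supersolution: averaging exp(-a(t - τ_i)) multiplies it
  -- by `s + 1`, and the surplus `C' * s = C` absorbs the inhomogeneity. `B₁` makes it at least `B`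
  -- on [T - K, T]; it then propagates by the shortest step `μ`.
  set C' := C / s with hC'
  have hC'0 : 0 ≤ C' := div_nonneg hC hs0.le
  set B₁ := B + C' * Real.exp (-a * (T - K)) with hB₁
  have key : ∀ n : ℕ, ∀ t, T - K ≤ t → t ≤ T + n * μ → z t ≤ B₁ - C' * Real.exp (-a * t) := by
    intro n
    induction n with
    | zero =>
      intro t ht1 ht2
      have h1 := hB t (by simpa using ht2)
      have h2 : Real.exp (-a * t) ≤ Real.exp (-a * (T - K)) :=
        Real.exp_le_exp.2 (by nlinarith)
      have := mul_le_mul_of_nonneg_left h2 hC'0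
      linarith
    | succ n ih =>
      intro t ht1 ht2
      rcases le_or_gt t (T + n * μ) with h | h
      · exact ih t ht1 h
      · have hnμ : 0 ≤ n * μ := by positivity
        have h1 := hz t (by linarith)
        have h2 : ∑ i, p i * z (t - τ i) ≤
            ∑ i, (p i * B₁ - C' * Real.exp (-a * t) * (p i * Real.exp (a * τ i))) := by
          refine Finset.sum_le_sum fun i _ => ?_
          have h3 := ih (t - τ i) (by linarith [hK i]) (by
            push_cast at ht2
            linarith [hi₀ i])
          have h4 : Real.exp (-a * (t - τ i)) = Real.exp (-a * t) * Real.exp (a * τ i) := by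
            rw [← Real.exp_add]; ring_nf
          rw [h4] at h3
          nlinarith [hp i]
        rw [Finset.sum_sub_distrib, ← Finset.sum_mul, ← Finset.mul_sum, hp1] at h2
        have h5 : ∑ i, p i * Real.exp (a * τ i) = s + 1 := by rw [hs]; ring
        rw [h5] at h2
        have h6 : C' * s = C := by rw [hC']; field_simp
        have h7 : C' * Real.exp (-a * t) * (s + 1) =
            C * Real.exp (-a * t) + C' * Real.exp (-a * t) := by rw [← h6]; ring
        linarith
  refine ⟨max B B₁, fun t => ?_⟩
  rcases le_total t T with h | h
  · exact (hB t h).trans (le_max_left _ _)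
  · obtain ⟨n, hn⟩ := exists_nat_ge ((t - T) / μ)
    rw [div_le_iff₀ hμ] at hn
    have h1 := key n t (by linarith) (by linarith)
    have h2 : 0 ≤ C' * Real.exp (-a * t) := by positivity
    exact (by linarith : z t ≤ B₁).trans (le_max_right _ _)

/-- The lattice renewal theorem, for the deviation from the periodic limit. -/
lemma tendsto_zero_of_lattice_renewal [Nonempty ι] (hp : ∀ i, 0 < p i) (hp1 : ∑ i, p i = 1)
    {T : ℝ} (hT : 0 < T) {k : ι → ℕ} (hk : ∀ i, 0 < k i) (hτ : ∀ i, τ i = k i * T)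
    (hmem : T ∈ AddSubgroup.closure (Set.range τ))
    {w : ℝ → ℝ} {B : ℝ} (hB : ∀ t, |w t| ≤ B)
    (hw : Tendsto (fun t => w t - ∑ i, p i * w (t - τ i)) atTop (𝓝 0))
    (hI : Tendsto (fun t => ∑ i, p i * ∑ n ∈ Finset.range (k i), w (t - n * T)) atTop (𝓝 0)) :
    Tendsto w atTop (𝓝 0) := by
  have hτ0 : ∀ i, 0 < τ i := fun i => by
    rw [hτ]; exact mul_pos (by exact_mod_cast hk i) hT
  obtain ⟨A, hA⟩ := exists_forall_ge_exists_mem_closure_Ioc hτ0 hT hmem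
  have hmul : ∀ σ ∈ AddSubmonoid.closure (Set.range τ), ∃ m : ℤ, σ = m * T := by
    intro σ hσ
    induction hσ using AddSubmonoid.closure_induction with
    | mem x hx => obtain ⟨j, rfl⟩ := hx; exact ⟨k j, by simp [hτ]⟩
    | zero => exact ⟨0, by simp⟩
    | add x y _ _ hx hy =>
      obtain ⟨m, rfl⟩ := hx
      obtain ⟨n, rfl⟩ := hy
      exact ⟨m + n, by push_cast; ring⟩
  -- The semigroup meets (nT - T, nT] for large `n`, and the only multiple of `T` in that interval
  -- is nT.
  have hbig : ∀ n : ℕ, A ≤ n * T → (n : ℝ) * T ∈ AddSubmonoid.closure (Set.range τ) := by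
    intro n hn
    obtain ⟨σ, hσ, h1, h2⟩ := hA _ hn
    obtain ⟨m, rfl⟩ := hmul σ hσ
    have h3 : ((n : ℤ) - 1 : ℝ) < m := by
      refine lt_of_mul_lt_mul_right ?_ hT.le
      push_cast; linarith
    have h4 : (m : ℝ) ≤ (n : ℤ) := le_of_mul_le_mul_right (by push_cast; exact h2) hT
    have h5 : m = n := by
      have : (n : ℤ) - 1 < m := by exact_mod_cast h3
      have : m ≤ n := by exact_mod_cast h4
      omega
    rw [h5] at hσ
    simpa using hσ
  obtain ⟨n₀, hn₀⟩ := exists_nat_ge (A / T)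
  rw [div_le_iff₀ hT] at hn₀
  have key : ∀ v : ℝ → ℝ, (∀ t, |v t| ≤ B) →
      Tendsto (fun t => v t - ∑ i, p i * v (t - τ i)) atTop (𝓝 0) →
      Tendsto (fun t => ∑ i, p i * ∑ n ∈ Finset.range (k i), v (t - n * T)) atTop (𝓝 0) →
      ∀ ε > 0, ∀ᶠ t in atTop, v t < 0 + ε := by
    intro v hvB hv hvI
    obtain ⟨L, U, hU, hup, hlim⟩ := exists_ultrafilter_tendsto_of_renewal hp hp1 hvB hv
    -- Shifting by `n₀ * T` moves all translates in the weighted sum into the semigroup, where the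
    -- limit is `L`; that sum tends to 0, so (Σ p_i k_i) L = 0.
    have h1 : Tendsto (fun t => t - n₀ * T) (U : Filter ℝ) atTop :=
      tendsto_atTop_add_const_right _ (-(n₀ * T)) hU
    have h2 := hvI.comp h1
    have h3 : Tendsto ((fun t => ∑ i, p i * ∑ n ∈ Finset.range (k i), v (t - n * T)) ∘
        fun t => t - n₀ * T) U (𝓝 (∑ i, p i * ∑ n ∈ Finset.range (k i), L)) := by
      refine tendsto_finsetSum _ fun i _ => Tendsto.const_mul _ ?_
      refine tendsto_finsetSum _ fun n _ => ?_
      have hmem' := hbig (n₀ + n) (by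
        have : (0 : ℝ) ≤ n * T := by positivity
        push_cast
        linarith)
      refine (hlim _ hmem').congr fun t => ?_
      congr 1
      push_cast
      ring
    have h4 := tendsto_nhds_unique h2 h3
    have h5 : ∑ i, p i * ∑ n ∈ Finset.range (k i), L = (∑ i, p i * k i) * L := by
      rw [Finset.sum_mul]
      refine Finset.sum_congr rfl fun i _ => ?_
      simp only [Finset.sum_const, Finset.card_range, nsmul_eq_mul]
      ring
    have h6 : 0 < ∑ i, p i * k i :=
      Finset.sum_pos (fun i _ => mul_pos (hp i) (by exact_mod_cast hk i)) Finset.univ_nonempty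
    rw [h5] at h4
    have h7 : L = 0 := by
      rcases mul_eq_zero.1 h4.symm with h | h
      · exact absurd h h6.ne'
      · exact h
    rw [h7] at hup
    exact hup
  refine tendsto_of_forall_eventually_lt (key w hB hw hI) ?_
  rw [neg_zero]
  refine key (fun t => -w t) (by simpa using hB) ?_ ?_
  · have h := hw.neg
    rw [neg_zero] at h
    refine h.congr fun t => ?_
    simp only [mul_neg, Finset.sum_neg_distrib]
    ring
  · simpa [Finset.sum_neg_distrib] using hI.neg

/-- The values of a slowly increasing function which converges along the translates by an
asymptotically dense set are eventually uniformly close to the limit on a window. -/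
lemma eventually_forall_abs_sub_le {S : Set ℝ} {U : Ultrafilter ℝ} {z : ℝ → ℝ} {L η δ A : ℝ}
    (hδ : 0 < δ) (hη : 0 < η)
    (hA : ∀ u, A ≤ u → ∃ σ ∈ S, u - δ / 2 < σ ∧ σ ≤ u)
    (hlim : ∀ σ ∈ S, Tendsto (fun t => z (t - σ)) U (𝓝 L))
    (hz : ∀ x y, x ≤ y → y ≤ x + δ → z y ≤ z x + η) (K : ℝ) :
    ∀ᶠ t in U, ∀ u, A ≤ u → u ≤ A + K → |z (t - u) - L| ≤ 2 * η := by
  choose! s hsS hs1 hs2 using hA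
  have hgrid : ∀ i : ℕ, A ≤ A + i * (δ / 2) := fun i => by
    have : (0 : ℝ) ≤ i * (δ / 2) := by positivity
    linarith
  obtain ⟨N, hN⟩ := exists_nat_ge (K / (δ / 2) + 2)
  have hev : ∀ᶠ t in U, ∀ i ∈ Finset.range (N + 1), |z (t - s (A + i * (δ / 2))) - L| < η := by
    rw [eventually_all_finset]
    intro i _
    have := (Metric.tendsto_nhds.1 (hlim _ (hsS _ (hgrid i)))) η hη
    simpa [Real.dist_eq] using this
  filter_upwards [hev] with t ht u hu1 hu2
  set i := ⌊(u - A) / (δ / 2)⌋₊ with hi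
  have hδ2 : 0 < δ / 2 := by positivity
  have hi1 : i * (δ / 2) ≤ u - A := by
    have := Nat.floor_le (div_nonneg (sub_nonneg.2 hu1) hδ2.le)
    rwa [le_div_iff₀ hδ2] at this
  have hi2 : u - A < (i + 1) * (δ / 2) := by
    have := Nat.lt_floor_add_one ((u - A) / (δ / 2))
    rwa [div_lt_iff₀ hδ2] at this
  have hiN : i + 2 ≤ N := by
    have h1 : (i : ℝ) ≤ K / (δ / 2) := by
      rw [le_div_iff₀ hδ2]; linarith
    have : ((i + 2 : ℕ) : ℝ) ≤ N := by push_cast; linarith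
    exact_mod_cast this
  -- Semigroup points taken near grid points two cells apart enclose `u`: σ ≤ u ≤ σ', each within
  -- `δ` of `u`. One cell would not suffice, as σ' may lie δ/2 below its grid point. Slow increase
  -- and convergence cost `η` each.
  have a1 := hs1 _ (hgrid i)
  have a2 := hs2 _ (hgrid i)
  have b1 := hs1 _ (hgrid (i + 2))
  have b2 := hs2 _ (hgrid (i + 2))
  have ti := abs_lt.1 (ht i (Finset.mem_range.2 (by omega)))
  have ti2 := abs_lt.1 (ht (i + 2) (Finset.mem_range.2 (by omega)))
  set σ := s (A + i * (δ / 2))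
  set σ' := s (A + ((i + 2 : ℕ) : ℝ) * (δ / 2))
  push_cast at b1 b2
  have c1 := hz (t - u) (t - σ) (by linarith) (by linarith)
  have c2 := hz (t - σ') (t - u) (by linarith) (by linarith)
  rw [abs_le]
  constructor <;> linarith [ti.1, ti.2, ti2.1, ti2.2]

/-- The nonlattice renewal theorem for slowly increasing solutions. -/
lemma exists_tendsto_of_nonlattice_renewal [Nonempty ι] (hp : ∀ i, 0 < p i)
    (hp1 : ∑ i, p i = 1) (hτ : ∀ i, 0 < τ i)
    (hdense : Dense (AddSubgroup.closure (Set.range τ) : Set ℝ))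
    {z : ℝ → ℝ} {B b : ℝ} (hb : 0 < b) (hz0 : ∀ t, 0 ≤ z t) (hB : ∀ t, z t ≤ B)
    (hren : ∀ t, ∑ i, p i * z (t - τ i) ≤ z t)
    (hlim : Tendsto (fun t => z t - ∑ i, p i * z (t - τ i)) atTop (𝓝 0))
    (hanti : Antitone fun t => Real.exp (-b * t) * z t) (hpos : ∃ t, 0 < z t) :
    ∃ M, 0 < M ∧ Tendsto z atTop (𝓝 M) := by
  -- Measurability comes from the monotonicity assumption alone.
  have hzmeas : Measurable z := by
    have h : z = fun t => Real.exp (b * t) * (Real.exp (-b * t) * z t) := by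
      ext t
      rw [← mul_assoc, ← Real.exp_add]
      simp
    rw [h]
    exact (by fun_prop : Measurable fun t : ℝ => Real.exp (b * t)).mul hanti.measurable
  have hint : ∀ x y, IntervalIntegrable z volume x y := fun x y => by
    refine (intervalIntegrable_const (c := B)).mono_fun hzmeas.aestronglyMeasurable ?_
    refine Eventually.of_forall fun t => ?_
    simp only [Real.norm_eq_abs]
    rw [abs_of_nonneg (hz0 t)]
    exact (hB t).trans (le_abs_self B)
  have hgrow : ∀ x y, x ≤ y → z y ≤ Real.exp (b * (y - x)) * z x := by
    intro x y hxy
    have h1 := hanti hxy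
    have h2 : Real.exp (b * (y - x)) * z x =
        Real.exp (b * y) * (Real.exp (-b * x) * z x) := by
      rw [← mul_assoc, ← Real.exp_add]; ring_nf
    have h3 : z y = Real.exp (b * y) * (Real.exp (-b * y) * z y) := by
      rw [← mul_assoc, ← Real.exp_add]; simp
    rw [h2, h3]
    exact mul_le_mul_of_nonneg_left h1 (Real.exp_pos _).le
  have hB0 : 0 ≤ B := (hz0 0).trans (hB 0)
  set m := ∑ i, p i * τ i with hm
  have hm0 : 0 < m := Finset.sum_pos (fun i _ => mul_pos (hp i) (hτ i)) Finset.univ_nonempty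
  -- The increments of `I` are the integrals of the nonnegative inhomogeneity, so `I` increases to a
  -- limit `c`. Where `z` is nearly `L` on a whole window, `I` is nearly `m * L`; hence every
  -- cluster value obtained this way is `c / m`.
  set I : ℝ → ℝ := fun t => ∑ i, p i * ∫ u in (t - τ i)..t, z u with hI
  have hshift : ∀ (x y c : ℝ), ∫ u in (x - c)..(y - c), z u = ∫ u in x..y, z (u - c) :=
    fun x y c => (intervalIntegral.integral_comp_sub_right (fun u => z u) c).symm
  have hImono : Monotone I := by
    intro x y hxy
    have h1 : I y - I x = ∫ u in x..y, (z u - ∑ i, p i * z (u - τ i)) := by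
      have hint' : ∀ i, IntervalIntegrable (fun u => z (u - τ i)) volume x y := fun i => by
        simpa using (hint (x - τ i) (y - τ i)).comp_sub_right (τ i)
      rw [intervalIntegral.integral_sub (hint x y)
        (by
          have := IntervalIntegrable.sum Finset.univ
            (f := fun i u => p i * z (u - τ i)) fun i _ => (hint' i).const_mul (p i)
          simpa [Finset.sum_fn] using this),
        intervalIntegral.integral_finsetSum fun i _ => (hint' i).const_mul (p i)]
      simp only [intervalIntegral.integral_const_mul, ← hshift]
      rw [hI]
      have h2 : ∫ u in x..y, z u = ∑ i, p i * ∫ u in x..y, z u := by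
        rw [← Finset.sum_mul, hp1, one_mul]
      rw [h2, ← Finset.sum_sub_distrib, ← Finset.sum_sub_distrib]
      refine Finset.sum_congr rfl fun i _ => ?_
      rw [← mul_sub, ← mul_sub]
      congr 1
      have e1 := intervalIntegral.integral_add_adjacent_intervals (hint (x - τ i) (y - τ i))
        (hint (y - τ i) y)
      have e2 := intervalIntegral.integral_add_adjacent_intervals (hint (x - τ i) x) (hint x y)
      linarith
    have h2 : 0 ≤ ∫ u in x..y, (z u - ∑ i, p i * z (u - τ i)) :=
      intervalIntegral.integral_nonneg hxy fun u _ => sub_nonneg.2 (hren u)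
    linarith
  have hIbdd : ∀ t, I t ≤ m * B := by
    intro t
    rw [hm, Finset.sum_mul]
    refine Finset.sum_le_sum fun i _ => ?_
    rw [mul_assoc]
    refine mul_le_mul_of_nonneg_left ?_ (hp i).le
    have : ∫ u in (t - τ i)..t, z u ≤ ∫ u in (t - τ i)..t, B :=
      intervalIntegral.integral_mono_on (by linarith [hτ i]) (hint _ _)
        intervalIntegrable_const fun u _ => hB u
    simpa using this
  have hIlim : Tendsto I atTop (𝓝 (⨆ t, I t)) :=
    tendsto_atTop_ciSup hImono ⟨m * B, by rintro _ ⟨t, rfl⟩; exact hIbdd t⟩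
  set c := ⨆ t, I t with hc
  have hc0 : 0 < c := by
    obtain ⟨t, ht⟩ := hpos
    have h1 : I t ≤ c := hImono.ge_of_tendsto hIlim t
    refine lt_of_lt_of_le ?_ h1
    refine Finset.sum_pos (fun i _ => mul_pos (hp i) ?_) Finset.univ_nonempty
    have h2 : ∫ u in (t - τ i)..t, Real.exp (-(b * τ i)) * z t ≤ ∫ u in (t - τ i)..t, z u := by
      refine intervalIntegral.integral_mono_on (by linarith [hτ i]) intervalIntegrable_const
        (hint _ _) fun u hu => ?_
      have h3 := hgrow u t hu.2
      have h4 : Real.exp (b * (t - u)) ≤ Real.exp (b * τ i) :=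
        Real.exp_le_exp.2 (mul_le_mul_of_nonneg_left (by linarith [hu.1]) hb.le)
      have h5 : z t ≤ Real.exp (b * τ i) * z u :=
        h3.trans (mul_le_mul_of_nonneg_right h4 (hz0 u))
      calc Real.exp (-(b * τ i)) * z t
          ≤ Real.exp (-(b * τ i)) * (Real.exp (b * τ i) * z u) :=
            mul_le_mul_of_nonneg_left h5 (Real.exp_pos _).le
        _ = z u := by rw [← mul_assoc, ← Real.exp_add]; simp
    refine lt_of_lt_of_le ?_ h2
    simp only [intervalIntegral.integral_const, sub_sub_cancel, smul_eq_mul]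
    have := hτ i
    positivity
  set K := ∑ i, τ i
  have hK : ∀ i, τ i ≤ K := fun i =>
    Finset.single_le_sum (f := τ) (fun j _ => (hτ j).le) (Finset.mem_univ i)
  have key : ∀ (L : ℝ) (U : Ultrafilter ℝ), (U : Filter ℝ) ≤ atTop →
      (∀ σ ∈ AddSubmonoid.closure (Set.range τ), Tendsto (fun t => z (t - σ)) U (𝓝 L)) →
      L = c / m := by
    intro L U hU hL
    have hle : ∀ η > 0, |c - m * L| ≤ m * (2 * η) := by
      intro η hη
      have hcont : Tendsto (fun δ : ℝ => B * (Real.exp (b * δ) - 1)) (𝓝[>] 0) (𝓝 0) := by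
        have : Continuous fun δ : ℝ => B * (Real.exp (b * δ) - 1) := by fun_prop
        simpa using (this.tendsto 0).mono_left nhdsWithin_le_nhds
      obtain ⟨δ, hδη, hδ⟩ := ((hcont.eventually (gt_mem_nhds hη)).and
        self_mem_nhdsWithin).exists
      have hδ : 0 < δ := hδ
      have hslow : ∀ x y, x ≤ y → y ≤ x + δ → z y ≤ z x + η := by
        intro x y hxy hyx
        have h1 := hgrow x y hxy
        have h2 : Real.exp (b * (y - x)) ≤ Real.exp (b * δ) :=
          Real.exp_le_exp.2 (mul_le_mul_of_nonneg_left (by linarith) hb.le)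
        have h3 : 1 ≤ Real.exp (b * δ) := Real.one_le_exp (by positivity)
        nlinarith [hz0 x, hB x]
      obtain ⟨e, heG, he0, he1⟩ := hdense.exists_between (half_pos hδ)
      obtain ⟨A, hA⟩ := exists_forall_ge_exists_mem_closure_Ioc hτ he0 heG
      have hev := eventually_forall_abs_sub_le (S := AddSubmonoid.closure (Set.range τ)) hδ hη
        (fun u hu => by
          obtain ⟨σ, h1, h2, h3⟩ := hA u hu
          exact ⟨σ, h1, by linarith, h3⟩) hL hslow K
      have hIU : Tendsto (fun t => I (t - A)) U (𝓝 c) :=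
        hIlim.comp (tendsto_atTop_add_const_right _ (-A) hU)
      refine le_of_tendsto ((hIU.sub_const (m * L)).abs) ?_
      filter_upwards [hev] with t ht
      have h1 : I (t - A) - m * L = ∑ i, p i * ∫ u in (t - A - τ i)..(t - A), (z u - L) := by
        rw [hI, hm, Finset.sum_mul, ← Finset.sum_sub_distrib]
        refine Finset.sum_congr rfl fun i _ => ?_
        rw [intervalIntegral.integral_sub (hint _ _) intervalIntegrable_const]
        simp only [intervalIntegral.integral_const, sub_sub_cancel, smul_eq_mul]
        ring
      rw [h1, hm, Finset.sum_mul]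
      refine (Finset.abs_sum_le_sum_abs _ _).trans (Finset.sum_le_sum fun i _ => ?_)
      rw [abs_mul, abs_of_pos (hp i), mul_assoc]
      refine mul_le_mul_of_nonneg_left ?_ (hp i).le
      have h2 := intervalIntegral.norm_integral_le_of_norm_le_const (a := t - A - τ i)
        (b := t - A) (f := fun u => z u - L) (C := 2 * η) (fun u hu => by
          rw [Set.uIoc_of_le (by linarith [hτ i])] at hu
          have := ht (t - u) (by linarith [hu.2]) (by linarith [hu.1, hK i])
          simpa using this)
      rw [Real.norm_eq_abs, sub_sub_cancel, abs_of_pos (hτ i)] at h2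
      linarith
    have h0 : |c - m * L| ≤ 0 := by
      refine le_of_forall_pos_le_add fun ε hε => ?_
      have := hle (ε / (2 * m)) (by positivity)
      have h2 : m * (2 * (ε / (2 * m))) = ε := by field_simp
      linarith
    have h1 : c - m * L = 0 := abs_nonpos_iff.1 h0
    rw [eq_div_iff hm0.ne']
    linarith
  have hBabs : ∀ t, |z t| ≤ B := fun t => by rw [abs_of_nonneg (hz0 t)]; exact hB t
  refine ⟨c / m, div_pos hc0 hm0, tendsto_of_forall_eventually_lt ?_ ?_⟩
  · obtain ⟨L, U, hU, hup, hL⟩ := exists_ultrafilter_tendsto_of_renewal hp hp1 hBabs hlim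
    rwa [key L U hU hL] at hup
  -- The lower limit of `z` is the upper limit of `-z`, and the same identification applies to it.
  · obtain ⟨L, U, hU, hup, hL⟩ := exists_ultrafilter_tendsto_of_renewal (τ := τ)
      (z := fun t => -z t) hp hp1 (by simpa using hBabs)
      (by
        have h := hlim.neg
        rw [neg_zero] at h
        refine h.congr fun t => ?_
        simp only [mul_neg, Finset.sum_neg_distrib]
        ring)
    have := key (-L) U hU fun σ hσ => by simpa using (hL σ hσ).neg
    rw [← this, neg_neg]
    exact hup

end Renewal

/-! ### Compactness of convex hulls. -/

section ConvexHull

variable {E : Type*} [NormedAddCommGroup E] [NormedSpace ℝ E] [FiniteDimensional ℝ E]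

/-- In a finite-dimensional space, the convex hull of a compact set is compact. -/
theorem isCompact_convexHull_of_finiteDimensional {s : Set E} (hs : IsCompact s) :
    IsCompact (convexHull ℝ s) := by
  -- By Carathéodory's theorem `finrank + 1` points suffice, so the hull is a finite union of
  -- continuous images of compact sets.
  have heq : convexHull ℝ s = ⋃ m ∈ Finset.range (Module.finrank ℝ E + 2),
      (fun p : (Fin m → ℝ) × (Fin m → E) => ∑ i, p.1 i • p.2 i) ''
        (stdSimplex ℝ (Fin m) ×ˢ Set.univ.pi fun _ => s) := by
    refine subset_antisymm (fun x hx => ?_) (Set.iUnion₂_subset fun m _ => ?_)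
    · obtain ⟨ι, hι, z, w, hz, hind, hw, hw1, hx⟩ := eq_pos_convex_span_of_mem_convexHull hx
      have hcard : Fintype.card ι ≤ Module.finrank ℝ E + 1 :=
        hind.card_le_finrank_succ.trans (by
          gcongr
          exact Submodule.finrank_le _)
      let e := Fintype.equivFin ι
      refine Set.mem_iUnion₂.2 ⟨Fintype.card ι, Finset.mem_range.2 (by omega),
        (w ∘ e.symm, z ∘ e.symm), ⟨⟨fun i => (hw _).le, ?_⟩, fun i _ => hz ⟨_, rfl⟩⟩, ?_⟩
      · rw [← hw1]
        exact e.symm.sum_comp w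
      · rw [← hx]
        exact e.symm.sum_comp fun i => w i • z i
    · rintro _ ⟨⟨w, z⟩, ⟨hw, hz⟩, rfl⟩
      exact (convex_convexHull ℝ s).sum_mem (fun i _ => hw.1 i) hw.2
        fun i _ => subset_convexHull ℝ s (hz i trivial)
  rw [heq]
  refine (Finset.range _).isCompact_biUnion fun m _ => ?_
  refine ((isCompact_stdSimplex ℝ (Fin m)).prod (isCompact_univ_pi fun _ => hs)).image ?_
  fun_prop

end ConvexHull

/-! ### Level sets of the distance function. -/

section LevelSet

variable {E : Type*} [NormedAddCommGroup E] [NormedSpace ℝ E] [FiniteDimensional ℝ E]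
  [MeasurableSpace E] [BorelSpace E]

/-- Level sets of the distance function to a set, for positive values, are null sets. -/
theorem addHaar_infDist_eq (μ : Measure E) [μ.IsAddHaarMeasure] (K : Set E) {g : ℝ} (hg : 0 < g) :
    μ {x | Metric.infDist x K = g} = 0 := by
  rcases K.eq_empty_or_nonempty with rfl | hK
  · simp [hg.ne]
  set S := {x | Metric.infDist x K = g} with hS
  have hSc : IsClosed S := isClosed_eq (Metric.continuous_infDist_pt K) continuous_const
  -- Lebesgue density: at almost every point of `S` the complement has density 0. But from any point
  -- of `S`, moving by r/2 towards a nearest point of the closure of `K` gives a ball of radius r/2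
  -- free of `S`, hence density at least 2^{-n} with n the dimension of the space.
  have hae := Besicovitch.ae_tendsto_measure_inter_div_of_measurableSet μ
    hSc.measurableSet.compl
  rw [← nonpos_iff_eq_zero]
  refine (measure_mono fun x hx => ?_).trans hae.le
  change ¬ _
  intro hlim
  replace hlim : Tendsto (fun r => μ (Sᶜ ∩ Metric.closedBall x r) / μ (Metric.closedBall x r))
      (𝓝[>] 0) (𝓝 (Sᶜ.indicator 1 x)) := hlim
  rw [Set.indicator_of_notMem (by simpa using hx)] at hlim
  have hx' : Metric.infDist x K = g := hx
  obtain ⟨y, hy, hxy⟩ := Metric.exists_mem_closure_infDist_eq_dist hK x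
  rw [hx'] at hxy
  set c0 : ENNReal := ENNReal.ofReal ((1 / 2 : ℝ) ^ Module.finrank ℝ E) with hc0
  have hc0pos : 0 < c0 := by rw [hc0, ENNReal.ofReal_pos]; positivity
  refine absurd (ge_of_tendsto (b := c0) hlim ?_) (not_le.2 hc0pos)
  filter_upwards [Ioo_mem_nhdsGT hg] with r hr
  have hr0 : 0 < r := hr.1
  have hμ : μ (Metric.closedBall x r) =
      ENNReal.ofReal (r ^ Module.finrank ℝ E) * μ (Metric.ball 0 1) :=
    Measure.addHaar_closedBall μ x hr0.le
  rw [ENNReal.le_div_iff_mul_le (Or.inl (Metric.measure_closedBall_pos μ x hr0).ne')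
    (Or.inl measure_closedBall_lt_top.ne)]
  set t := r / 2 / g with ht
  set c := AffineMap.lineMap x y t with hc
  have hcx : dist c x = r / 2 := by
    rw [hc, dist_lineMap_left, ← hxy, Real.norm_eq_abs, abs_of_pos (by positivity), ht]
    field_simp
  have ht1 : t < 1 := by rw [ht, div_lt_one hg]; linarith [hr.2]
  have hcy : dist c y = g - r / 2 := by
    rw [hc, dist_lineMap_right, ← hxy, Real.norm_eq_abs, abs_of_pos (by linarith), ht]
    field_simp
  have hsub : Metric.ball c (r / 2) ⊆ Sᶜ ∩ Metric.closedBall x r := by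
    intro w hw
    rw [Metric.mem_ball] at hw
    constructor
    · intro hwS
      have h1 : Metric.infDist w K ≤ dist w y := by
        rw [← Metric.infDist_closure]
        exact Metric.infDist_le_dist_of_mem hy
      have h2 : Metric.infDist w K = g := hwS
      have := dist_triangle w c y
      linarith
    · rw [Metric.mem_closedBall]
      have := dist_triangle w c x
      linarith
  refine le_trans (le_of_eq ?_) (measure_mono hsub)
  rw [hμ, Measure.addHaar_ball_of_pos μ c (by positivity), hc0, ← mul_assoc,
    ← ENNReal.ofReal_mul (by positivity), ← mul_pow]
  ring_nf

end LevelSet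

/-! ### Inner tube volumes of open sets. -/

section Tube

variable {d : ℕ}

lemma Bornology.IsBounded.compl_nonempty [Nontrivial (EuclideanSpace ℝ (Fin d))]
    {A : Set (EuclideanSpace ℝ (Fin d))}
    (hA : Bornology.IsBounded A) : Aᶜ.Nonempty := by
  rw [Set.nonempty_compl]
  rintro rfl
  exact NormedSpace.unbounded_univ ℝ (EuclideanSpace ℝ (Fin d)) hA

/-- A nearest point of the complement can be taken on the frontier. Distances to complements behave
better under unions than distances to frontiers. -/
lemma infDist_frontier_eq_infDist_compl {A : Set (EuclideanSpace ℝ (Fin d))} (hA : IsOpen A)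
    (hne : Aᶜ.Nonempty) {x : EuclideanSpace ℝ (Fin d)}
    (hx : x ∈ A) : Metric.infDist x (frontier A) = Metric.infDist x Aᶜ := by
  obtain ⟨y, hy, hxy⟩ := exists_mem_frontier_infDist_compl_eq_dist hx (Set.nonempty_compl.1 hne)
  refine le_antisymm ?_ ?_
  · rw [hxy]
    exact Metric.infDist_le_dist_of_mem hy
  · refine Metric.infDist_le_infDist_of_subset ?_ ⟨y, hy⟩
    rw [hA.frontier_eq]
    exact fun z hz => hz.2

lemma innerNeighborhood_eq {A : Set (EuclideanSpace ℝ (Fin d))} (hA : IsOpen A) (hne : Aᶜ.Nonempty)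
    (ε : ℝ) :
    innerNeighborhood A ε = {x | x ∈ A ∧ Metric.infDist x Aᶜ ≤ ε} := by
  ext x
  refine and_congr_right fun hx => ?_
  rw [infDist_frontier_eq_infDist_compl hA hne hx]

lemma measurableSet_innerNeighborhood {A : Set (EuclideanSpace ℝ (Fin d))} (hA : IsOpen A) (ε : ℝ) :
    MeasurableSet (innerNeighborhood A ε) :=
  hA.measurableSet.inter
    (isClosed_le (Metric.continuous_infDist_pt _) continuous_const).measurableSet

lemma innerNeighborhood_subset (A : Set (EuclideanSpace ℝ (Fin d))) (ε : ℝ) :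
    innerNeighborhood A ε ⊆ A := fun _ hx => hx.1

lemma volume_innerNeighborhood_ne_top {A : Set (EuclideanSpace ℝ (Fin d))}
    (hb : Bornology.IsBounded A) (ε : ℝ) :
    volume (innerNeighborhood A ε) ≠ ⊤ :=
  (hb.subset (innerNeighborhood_subset A ε)).measure_lt_top.ne

lemma tubeVolume_nonneg (A : Set (EuclideanSpace ℝ (Fin d))) (ε : ℝ) : 0 ≤ tubeVolume A ε :=
    ENNReal.toReal_nonneg

lemma tubeVolume_mono {A : Set (EuclideanSpace ℝ (Fin d))} (hb : Bornology.IsBounded A) :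
    Monotone (tubeVolume A) := by
  intro x y hxy
  refine ENNReal.toReal_mono (volume_innerNeighborhood_ne_top hb y) (measure_mono ?_)
  exact fun z hz => ⟨hz.1, hz.2.trans hxy⟩

lemma bddAbove_radii [Nontrivial (EuclideanSpace ℝ (Fin d))] {A : Set (EuclideanSpace ℝ (Fin d))}
    (hb : Bornology.IsBounded A) :
    BddAbove {ε : ℝ | 0 < ε ∧ ∃ x, Metric.ball x ε ⊆ A} := by
  refine ⟨Metric.diam A, ?_⟩
  rintro ε ⟨hε, x, hx⟩
  -- The points x ± e of the ball are at distance `ε`. In dimension 0 no such `e` exists and the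
  -- radii are unbounded.
  obtain ⟨e, he⟩ := exists_norm_eq (EuclideanSpace ℝ (Fin d)) (show (0 : ℝ) ≤ ε / 2 by positivity)
  have h1 : x + e ∈ A := hx (by rw [mem_ball_iff_norm]; simp [he, hε])
  have h2 : x - e ∈ A := hx (by rw [mem_ball_iff_norm]; simp [he, hε])
  have h3 := Metric.dist_le_diam_of_mem hb h1 h2
  have h4 : x + e - (x - e) = (2 : ℝ) • e := by rw [two_smul]; abel
  rw [dist_eq_norm, h4, norm_smul, he] at h3
  norm_num at h3
  linarith

lemma infDist_compl_le_inradius [Nontrivial (EuclideanSpace ℝ (Fin d))]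
    {A : Set (EuclideanSpace ℝ (Fin d))} (hA : IsOpen A)
    (hb : Bornology.IsBounded A) {x : EuclideanSpace ℝ (Fin d)} (hx : x ∈ A) :
    Metric.infDist x Aᶜ ≤ inradius A := by
  refine le_csSup (bddAbove_radii hb) ⟨?_, x, Metric.ball_infDist_compl_subset⟩
  exact (hA.isClosed_compl.notMem_iff_infDist_pos hb.compl_nonempty).1 (by simpa using hx)

lemma inradius_pos [Nontrivial (EuclideanSpace ℝ (Fin d))] {A : Set (EuclideanSpace ℝ (Fin d))}
    (hA : IsOpen A) (hb : Bornology.IsBounded A)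
    (hne : A.Nonempty) : 0 < inradius A := by
  obtain ⟨x, hx⟩ := hne
  refine lt_of_lt_of_le ?_ (infDist_compl_le_inradius hA hb hx)
  exact (hA.isClosed_compl.notMem_iff_infDist_pos hb.compl_nonempty).1 (by simpa using hx)

lemma tubeVolume_of_inradius_le [Nontrivial (EuclideanSpace ℝ (Fin d))]
    {A : Set (EuclideanSpace ℝ (Fin d))} (hA : IsOpen A)
    (hb : Bornology.IsBounded A) {ε : ℝ} (hε : inradius A ≤ ε) :
    tubeVolume A ε = (volume A).toReal := by
  have : innerNeighborhood A ε = A := by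
    rw [innerNeighborhood_eq hA hb.compl_nonempty]
    ext x
    exact ⟨fun h => h.1, fun h => ⟨h, (infDist_compl_le_inradius hA hb h).trans hε⟩⟩
  rw [tubeVolume, this]

/-- For a monophase open set, the tube polynomial matches the volume at the inradius. -/
lemma IsMonophase.sum_eq_zero [Nontrivial (EuclideanSpace ℝ (Fin d))]
    {A : Set (EuclideanSpace ℝ (Fin d))} (hA : IsOpen A)
    (hb : Bornology.IsBounded A) (hne : A.Nonempty) {κ : ℕ → ℝ} (hκ : IsMonophase A κ) :
    ∑ k ∈ Finset.range (d + 1), κ k * inradius A ^ (d - k) = 0 := by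
  set g := inradius A with hg
  have hg0 : 0 < g := inradius_pos hA hb hne
  have hC := hb.compl_nonempty
  -- Radii increasing to `g` from below, the first being g/2; the polynomial formula holds only
  -- strictly below `g`.
  set u : ℕ → ℝ := fun n => g - g / (n + 2) with hu
  have hu_mono : Monotone u := by
    intro m n hmn
    have : (m : ℝ) ≤ n := by exact_mod_cast hmn
    have : g / (n + 2) ≤ g / (m + 2) := by gcongr
    simp only [hu]; linarith
  have hu_lt : ∀ n, u n < g := fun n => by
    have : 0 < g / ((n : ℝ) + 2) := by positivity
    simp only [hu]; linarith
  have hu_pos : ∀ n, 0 < u n := fun n => by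
    have : g / ((n : ℝ) + 2) < g := div_lt_self hg0 (by linarith [n.cast_nonneg (α := ℝ)])
    simp only [hu]; linarith
  have hu_lim : Tendsto u atTop (𝓝 g) := by
    have h1 : Tendsto (fun n : ℕ => (n : ℝ) + 2) atTop atTop :=
      tendsto_atTop_add_const_right _ _ tendsto_natCast_atTop_atTop
    simpa using tendsto_const_nhds.sub (h1.const_div_atTop g)
  have hmono : Monotone fun n => innerNeighborhood A (u n) := fun m n hmn z hz =>
    ⟨hz.1, hz.2.trans (hu_mono hmn)⟩
  have hunion : ⋃ n, innerNeighborhood A (u n) = {x | x ∈ A ∧ Metric.infDist x Aᶜ < g} := by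
    ext x
    simp only [Set.mem_iUnion, innerNeighborhood_eq hA hC, Set.mem_ofPred_eq]
    constructor
    · rintro ⟨n, h1, h2⟩
      exact ⟨h1, h2.trans_lt (hu_lt n)⟩
    · rintro ⟨h1, h2⟩
      obtain ⟨n, hn⟩ := (hu_lim.eventually (lt_mem_nhds h2)).exists
      exact ⟨n, h1, hn.le⟩
  have hvol : volume (⋃ n, innerNeighborhood A (u n)) = volume A := by
    rw [hunion]
    refine le_antisymm (measure_mono fun x hx => hx.1) ?_
    -- The limit of the tubes misses only points at distance exactly `g` from the complement, a null
    -- set.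
    have hcov : A ⊆ {x | x ∈ A ∧ Metric.infDist x Aᶜ < g} ∪ {x | Metric.infDist x Aᶜ = g} := by
      intro x hx
      rcases (infDist_compl_le_inradius hA hb hx).lt_or_eq with h | h
      · exact Or.inl ⟨hx, h⟩
      · exact Or.inr h
    refine (measure_mono hcov).trans ((measure_union_le _ _).trans ?_)
    rw [addHaar_infDist_eq volume _ hg0, add_zero]
  have hlim1 : Tendsto (fun n => tubeVolume A (u n)) atTop (𝓝 (volume A).toReal) := by
    have h := tendsto_measure_iUnion_atTop
      (μ := (volume : Measure (EuclideanSpace ℝ (Fin d)))) hmono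
    rw [hvol] at h
    exact (ENNReal.tendsto_toReal hb.measure_lt_top.ne).comp h
  have hlim2 : Tendsto (fun n => tubeVolume A (u n)) atTop
      (𝓝 (∑ k ∈ Finset.range d, κ k * g ^ (d - k))) := by
    have hcont : Continuous fun ε : ℝ => ∑ k ∈ Finset.range d, κ k * ε ^ (d - k) := by fun_prop
    refine ((hcont.tendsto g).comp hu_lim).congr fun n => ?_
    exact (hκ.1 _ (hu_pos n) (hu_lt n)).symm
  rw [Finset.sum_range_succ, tendsto_nhds_unique hlim2 hlim1, hκ.2]
  simp

/-- Distances to the complement of a disjoint union of open sets. -/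
lemma infDist_compl_iUnion {ι : Type*} {U : ι → Set (EuclideanSpace ℝ (Fin d))}
    (hU : ∀ i, IsOpen (U i))
    (hdisj : Pairwise (Function.onFun Disjoint U)) (hne : (⋃ i, U i)ᶜ.Nonempty) {i : ι}
    {x : EuclideanSpace ℝ (Fin d)}
    (hx : x ∈ U i) : Metric.infDist x (⋃ i, U i)ᶜ = Metric.infDist x (U i)ᶜ := by
  have hsub : (⋃ i, U i)ᶜ ⊆ (U i)ᶜ := Set.compl_subset_compl.2 (Set.subset_iUnion U i)
  refine le_antisymm ?_ (Metric.infDist_le_infDist_of_subset hsub hne)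
  set δ := Metric.infDist x (⋃ i, U i)ᶜ
  have hball : Metric.ball x δ ⊆ ⋃ i, U i := Metric.ball_infDist_compl_subset
  rw [Metric.le_infDist (hne.mono hsub)]
  intro y hy
  by_contra! hlt
  have hcov : Metric.ball x δ ⊆ U i ∪ ⋃ j ∈ {j | j ≠ i}, U j := by
    intro z hz
    obtain ⟨j, hj⟩ := Set.mem_iUnion.1 (hball hz)
    by_cases h : j = i
    · exact Or.inl (h ▸ hj)
    · exact Or.inr (Set.mem_biUnion (show j ∈ {j | j ≠ i} from h) hj)
  have hδ : 0 < δ := dist_nonneg.trans_lt hlt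
  -- A ball inside a disjoint union of open sets is connected, so it stays in the piece containing
  -- its centre.
  have := IsPreconnected.subset_left_of_subset_union (hU i)
    (isOpen_biUnion fun j _ => hU j)
    (Set.disjoint_iUnion₂_right.2 fun j hj => hdisj (Ne.symm hj)) hcov
    ⟨x, Metric.mem_ball_self hδ, hx⟩ (convex_ball x δ).isPreconnected
  exact hy (this (Metric.mem_ball'.2 hlt))

lemma tubeVolume_iUnion [Nontrivial (EuclideanSpace ℝ (Fin d))] {ι : Type*} [Fintype ι]
    {U : ι → Set (EuclideanSpace ℝ (Fin d))}
    (hU : ∀ i, IsOpen (U i)) (hdisj : Pairwise (Function.onFun Disjoint U))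
    (hb : Bornology.IsBounded (⋃ i, U i)) (ε : ℝ) :
    tubeVolume (⋃ i, U i) ε = ∑ i, tubeVolume (U i) ε := by
  have hbi : ∀ i, Bornology.IsBounded (U i) := fun i => hb.subset (Set.subset_iUnion U i)
  have hset : innerNeighborhood (⋃ i, U i) ε = ⋃ i, innerNeighborhood (U i) ε := by
    ext x
    simp only [innerNeighborhood_eq (isOpen_iUnion hU) hb.compl_nonempty,
      fun i => innerNeighborhood_eq (hU i) (hbi i).compl_nonempty, Set.mem_iUnion,
      Set.mem_ofPred_eq]
    constructor
    · rintro ⟨⟨i, hi⟩, h⟩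
      exact ⟨i, hi, by rwa [infDist_compl_iUnion hU hdisj hb.compl_nonempty hi] at h⟩
    · rintro ⟨i, hi, h⟩
      exact ⟨⟨i, hi⟩, by rwa [infDist_compl_iUnion hU hdisj hb.compl_nonempty hi]⟩
  rw [tubeVolume, hset, measure_iUnion
    (fun i j hij => (hdisj hij).mono (innerNeighborhood_subset _ _) (innerNeighborhood_subset _ _))
    (fun i => measurableSet_innerNeighborhood (hU i) ε), tsum_fintype,
    ENNReal.toReal_sum fun i _ => volume_innerNeighborhood_ne_top (hbi i) ε]
  rfl

end Tube

/-! ### Geometry of the tiling and its renewal equation. -/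

namespace SelfSimilarSystem

variable {d J : ℕ} (Φ : SelfSimilarSystem d J)

/-- The similitude `Φ_j` as a homeomorphism. -/
noncomputable def mapHomeomorph (j : Fin J) : (EuclideanSpace ℝ (Fin d)) ≃ₜ
    (EuclideanSpace ℝ (Fin d)) :=
  ((Φ.rot j).toHomeomorph.trans
    (Homeomorph.smulOfNeZero (Φ.ratio j) (Φ.ratio_pos j).ne')).trans
      (Homeomorph.addRight (Φ.shift j))

lemma coe_mapHomeomorph (j : Fin J) : ⇑(Φ.mapHomeomorph j) = Φ.map j := rfl

open scoped Pointwise in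
lemma image_map_eq (j : Fin J) (A : Set (EuclideanSpace ℝ (Fin d))) :
    Φ.map j '' A = (fun x => x + Φ.shift j) '' (Φ.ratio j • (Φ.rot j '' A)) := by
  simp only [← Set.image_smul, Set.image_image]
  rfl

lemma infDist_image_map (j : Fin J) (A : Set (EuclideanSpace ℝ (Fin d)))
    (x : EuclideanSpace ℝ (Fin d)) :
    Metric.infDist (Φ.map j x) (Φ.map j '' A) = Φ.ratio j * Metric.infDist x A := by
  rw [image_map_eq, map, Metric.infDist_image (Φ := fun x => x + Φ.shift j)
    (fun x y => by simp), infDist_smul₀ (Φ.ratio_pos j).ne',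
    Metric.infDist_image (Φ.rot j).isometry, Real.norm_of_nonneg (Φ.ratio_pos j).le]

lemma volume_image_map (j : Fin J) (A : Set (EuclideanSpace ℝ (Fin d))) :
    volume (Φ.map j '' A) = ENNReal.ofReal (Φ.ratio j ^ d) * volume A := by
  rw [image_map_eq, Set.image_add_right, measure_preimage_add_right, Measure.addHaar_smul,
    (Φ.rot j).image_eq_preimage_symm,
    (Φ.rot j).symm.measurePreserving.measure_preimage_emb
      (Φ.rot j).symm.toHomeomorph.measurableEmbedding,
    finrank_euclideanSpace_fin, abs_of_pos (pow_pos (Φ.ratio_pos j) d)]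

lemma tubeVolume_image_map (j : Fin J) (A : Set (EuclideanSpace ℝ (Fin d))) (ε : ℝ) :
    tubeVolume (Φ.map j '' A) ε = Φ.ratio j ^ d * tubeVolume A (ε / Φ.ratio j) := by
  have hset : innerNeighborhood (Φ.map j '' A) ε =
      Φ.map j '' innerNeighborhood A (ε / Φ.ratio j) := by
    have hfr : frontier (Φ.map j '' A) = Φ.map j '' frontier A := by
      rw [← coe_mapHomeomorph, Homeomorph.image_frontier]
    ext y
    constructor
    · rintro ⟨⟨x, hx, rfl⟩, h⟩
      rw [hfr, infDist_image_map] at h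
      exact ⟨x, ⟨hx, by rw [le_div_iff₀ (Φ.ratio_pos j)]; linarith⟩, rfl⟩
    · rintro ⟨x, ⟨hx, h⟩, rfl⟩
      refine ⟨⟨x, hx, rfl⟩, ?_⟩
      rw [hfr, infDist_image_map]
      rw [le_div_iff₀ (Φ.ratio_pos j)] at h
      linarith
  rw [tubeVolume, hset, volume_image_map, ENNReal.toReal_mul,
    ENNReal.toReal_ofReal (pow_pos (Φ.ratio_pos j) d).le]
  rfl

lemma wordMap_append_singleton (w : List (Fin J)) (j : Fin J) (x : EuclideanSpace ℝ (Fin d)) :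
    Φ.wordMap (w ++ [j]) x = Φ.map j (Φ.wordMap w x) := by
  simp [wordMap]

/-- The tiling is the union of the generators and of its images under the similitudes. -/
lemma tiling_eq {Q : ℕ} (G : Fin Q → Set (EuclideanSpace ℝ (Fin d))) :
    Φ.tiling G = ⋃ i : Fin Q ⊕ Fin J, Sum.elim G (fun j => Φ.map j '' Φ.tiling G) i := by
  rw [Set.iUnion_sum]
  simp only [Sum.elim_inl, Sum.elim_inr]
  ext x
  constructor
  · intro hx
    simp only [tiling, Set.mem_iUnion] at hx
    obtain ⟨w, q, y, hy, rfl⟩ := hx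
    -- The last letter of a word acts outermost, so here words are split at their end.
    rcases w.eq_nil_or_concat' with rfl | ⟨w, j, rfl⟩
    · exact Or.inl (Set.mem_iUnion.2 ⟨q, hy⟩)
    · refine Or.inr (Set.mem_iUnion.2 ⟨j, Φ.wordMap w y, ?_, ?_⟩)
      · exact Set.mem_iUnion₂.2 ⟨w, q, y, hy, rfl⟩
      · rw [wordMap_append_singleton]
  · rintro (hx | hx)
    · obtain ⟨q, hq⟩ := Set.mem_iUnion.1 hx
      exact Set.mem_iUnion₂.2 ⟨[], q, x, hq, rfl⟩
    · obtain ⟨j, y, hy, rfl⟩ := Set.mem_iUnion.1 hx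
      simp only [tiling, Set.mem_iUnion] at hy
      obtain ⟨w, q, z, hz, rfl⟩ := hy
      refine Set.mem_iUnion₂.2 ⟨w ++ [j], q, z, hz, ?_⟩
      rw [wordMap_append_singleton]

variable {Φ} {F : Set (EuclideanSpace ℝ (Fin d))}

lemma isCompact_convexHull (hF : Φ.IsAttractor F) : IsCompact (convexHull ℝ F) :=
  isCompact_convexHull_of_finiteDimensional hF.2.1

lemma image_map_convexHull_subset (hF : Φ.IsAttractor F) (j : Fin J) :
    Φ.map j '' convexHull ℝ F ⊆ convexHull ℝ F := by
  have h : Φ.map j = ⇑((Φ.ratio j • (Φ.rot j).toLinearEquiv.toLinearMap).toAffineMap +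
      AffineMap.const ℝ (EuclideanSpace ℝ (Fin d)) (Φ.shift j)) := by
    ext x
    simp [map]
  rw [h, AffineMap.image_convexHull, ← h]
  refine convexHull_mono ?_
  conv_rhs => rw [hF.2.2]
  exact Set.subset_iUnion (fun j => Φ.map j '' F) j

lemma isClosed_setMap_convexHull (hF : Φ.IsAttractor F) :
    IsClosed (Φ.setMap (convexHull ℝ F)) := by
  refine isClosed_iUnion_of_finite fun j => ?_
  rw [← coe_mapHomeomorph]
  exact (Φ.mapHomeomorph j).isClosedMap _ (isCompact_convexHull hF).isClosed

/-- A set with interior spans the whole space, so the relative topology of its affine span is the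
ambient one. -/
lemma intrinsicInterior_eq_interior {C : Set (EuclideanSpace ℝ (Fin d))}
    (hC : (interior C).Nonempty) :
    intrinsicInterior ℝ C = interior C := by
  refine subset_antisymm ?_ interior_subset_intrinsicInterior
  have htop := affineSpan_eq_top_of_nonempty_interior (s := C)
    (hC.mono (interior_mono (subset_convexHull ℝ C)))
  rintro _ ⟨y, hy, rfl⟩
  have hopen : IsOpen (Subtype.val '' interior ((↑) ⁻¹' C : Set (affineSpan ℝ C))) := by
    refine IsOpen.isOpenMap_subtype_val ?_ _ isOpen_interior
    rw [htop]
    exact isOpen_univ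
  refine interior_maximal ?_ hopen ⟨y, hy, rfl⟩
  rintro _ ⟨z, hz, rfl⟩
  exact interior_subset (s := ((↑) ⁻¹' C : Set (affineSpan ℝ C))) hz

section Geometry

variable {Q : ℕ} {G : Fin Q → Set (EuclideanSpace ℝ (Fin d))}

lemma IsGenerators.subset_firstTileset (hG : Φ.IsGenerators F G) (q : Fin Q) :
    G q ⊆ Φ.firstTileset F := by
  obtain ⟨x, hx, h⟩ : G q ∈ {A | ∃ x ∈ Φ.firstTileset F,
    A = connectedComponentIn (Φ.firstTileset F) x} := hG.2 ▸ ⟨q, rfl⟩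
  rw [h]
  exact connectedComponentIn_subset _ _

lemma IsGenerators.nonempty (hG : Φ.IsGenerators F G) (q : Fin Q) : (G q).Nonempty := by
  obtain ⟨x, hx, h⟩ : G q ∈ {A | ∃ x ∈ Φ.firstTileset F,
    A = connectedComponentIn (Φ.firstTileset F) x} := hG.2 ▸ ⟨q, rfl⟩
  rw [h]
  exact ⟨x, mem_connectedComponentIn hx⟩

lemma IsGenerators.disjoint (hG : Φ.IsGenerators F G) {q q' : Fin Q} (hne : q ≠ q') :
    Disjoint (G q) (G q') := by
  rw [Set.disjoint_left]
  intro y hy hy'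
  obtain ⟨x, hx, h⟩ : G q ∈ {A | ∃ x ∈ Φ.firstTileset F,
    A = connectedComponentIn (Φ.firstTileset F) x} := hG.2 ▸ ⟨q, rfl⟩
  obtain ⟨x', hx', h'⟩ : G q' ∈ {A | ∃ x ∈ Φ.firstTileset F,
    A = connectedComponentIn (Φ.firstTileset F) x} := hG.2 ▸ ⟨q', rfl⟩
  rw [h] at hy
  rw [h'] at hy'
  refine hne (hG.1 ?_)
  rw [h, h', connectedComponentIn_eq hy, connectedComponentIn_eq hy']

lemma isOpen_firstTileset (hF : Φ.IsAttractor F) (hC : (interior (convexHull ℝ F)).Nonempty) :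
    IsOpen (Φ.firstTileset F) := by
  rw [firstTileset, intrinsicInterior_eq_interior hC]
  exact isOpen_interior.sdiff (isClosed_setMap_convexHull hF)

lemma IsGenerators.isOpen (hG : Φ.IsGenerators F G) (hF : Φ.IsAttractor F)
    (hC : (interior (convexHull ℝ F)).Nonempty) (q : Fin Q) : IsOpen (G q) := by
  obtain ⟨x, hx, h⟩ : G q ∈ {A | ∃ x ∈ Φ.firstTileset F,
    A = connectedComponentIn (Φ.firstTileset F) x} := hG.2 ▸ ⟨q, rfl⟩
  rw [h]
  exact (isOpen_firstTileset hF hC).connectedComponentIn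

lemma IsGenerators.subset_convexHull (hG : Φ.IsGenerators F G) (q : Fin Q) :
    G q ⊆ convexHull ℝ F :=
  (hG.subset_firstTileset q).trans (Set.sdiff_subset.trans intrinsicInterior_subset)

lemma IsGenerators.isBounded (hG : Φ.IsGenerators F G) (hF : Φ.IsAttractor F) (q : Fin Q) :
    Bornology.IsBounded (G q) :=
  (isCompact_convexHull hF).isBounded.subset (hG.subset_convexHull q)

lemma tiling_subset (hG : Φ.IsGenerators F G) (hF : Φ.IsAttractor F) :
    Φ.tiling G ⊆ convexHull ℝ F := by
  refine Set.iUnion₂_subset fun w q => ?_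
  rintro _ ⟨x, hx, rfl⟩
  induction w using List.reverseRecOn with
  | nil => exact hG.subset_convexHull q hx
  | append_singleton w j ih =>
    rw [wordMap_append_singleton]
    exact image_map_convexHull_subset hF j ⟨_, ih, rfl⟩

lemma isBounded_tiling (hG : Φ.IsGenerators F G) (hF : Φ.IsAttractor F) :
    Bornology.IsBounded (Φ.tiling G) :=
  (isCompact_convexHull hF).isBounded.subset (tiling_subset hG hF)

lemma isOpen_tiling (hG : Φ.IsGenerators F G) (hF : Φ.IsAttractor F)
    (hC : (interior (convexHull ℝ F)).Nonempty) : IsOpen (Φ.tiling G) := by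
  refine isOpen_iUnion fun w => isOpen_iUnion fun q => ?_
  induction w using List.reverseRecOn with
  | nil =>
    have : Φ.wordMap [] = id := rfl
    rw [this, Set.image_id]
    exact hG.isOpen hF hC q
  | append_singleton w j ih =>
    have : Φ.wordMap (w ++ [j]) = Φ.map j ∘ Φ.wordMap w :=
      funext fun x => Φ.wordMap_append_singleton w j x
    rw [this, Set.image_comp, ← coe_mapHomeomorph]
    exact (Φ.mapHomeomorph j).isOpenMap _ ih

/-- The renewal equation for the tube volume of the tiling. -/
lemma tubeVolume_tiling [Nontrivial (EuclideanSpace ℝ (Fin d))] (hF : Φ.IsAttractor F)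
    (hT : Φ.TilesetCondition F)
    (hG : Φ.IsGenerators F G) (hC : (interior (convexHull ℝ F)).Nonempty) (ε : ℝ) :
    tubeVolume (Φ.tiling G) ε = ∑ q, tubeVolume (G q) ε +
      ∑ j, Φ.ratio j ^ d * tubeVolume (Φ.tiling G) (ε / Φ.ratio j) := by
  have hopen : ∀ j, IsOpen (Φ.map j '' Φ.tiling G) := fun j => by
    rw [← coe_mapHomeomorph]
    exact (Φ.mapHomeomorph j).isOpenMap _ (isOpen_tiling hG hF hC)
  have hsub : ∀ j, Φ.map j '' Φ.tiling G ⊆ Φ.map j '' convexHull ℝ F := fun j =>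
    Set.image_mono (tiling_subset hG hF)
  have hGj : ∀ q j, Disjoint (G q) (Φ.map j '' Φ.tiling G) := by
    intro q j
    rw [Set.disjoint_left]
    intro x hx hx'
    exact (hG.subset_firstTileset q hx).2 (Set.mem_iUnion.2 ⟨j, hsub j hx'⟩)
  have h := tubeVolume_iUnion (U := Sum.elim G (fun j => Φ.map j '' Φ.tiling G))
    (by rintro (q | j); exacts [hG.isOpen hF hC q, hopen j])
    (by
      rintro (q | j) (q' | j') hne
      · exact hG.disjoint fun h => hne (by rw [h])
      · exact hGj q j'
      · exact (hGj q' j).symm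
      · exact (hT.2 j j' fun h => hne (by rw [h])).mono
          (interior_maximal (hsub j) (hopen j)) (interior_maximal (hsub j') (hopen j')))
    (by rw [← tiling_eq]; exact isBounded_tiling hG hF) ε
  rw [← tiling_eq, Fintype.sum_sum_type] at h
  simpa only [Sum.elim_inl, Sum.elim_inr, tubeVolume_image_map] using h

lemma generators_index_nonempty (hT : Φ.TilesetCondition F) (hG : Φ.IsGenerators F G) :
    Nonempty (Fin Q) := by
  obtain ⟨x, hx, hx'⟩ := Set.not_subset.1 hT.1
  have : connectedComponentIn (Φ.firstTileset F) x ∈ Set.range G := by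
    rw [hG.2]
    exact ⟨x, ⟨hx, hx'⟩, rfl⟩
  obtain ⟨q, -⟩ := this
  exact ⟨q⟩

lemma tiling_nonempty (hT : Φ.TilesetCondition F) (hG : Φ.IsGenerators F G) :
    (Φ.tiling G).Nonempty := by
  obtain ⟨q⟩ := generators_index_nonempty hT hG
  obtain ⟨x, hx⟩ := hG.nonempty q
  exact ⟨x, Set.mem_iUnion₂.2 ⟨[], q, x, hx, rfl⟩⟩

lemma volume_toReal_pos_of_isOpen {A : Set (EuclideanSpace ℝ (Fin d))} (hA : IsOpen A)
    (hb : Bornology.IsBounded A)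
    (hne : A.Nonempty) : 0 < (volume A).toReal :=
  ENNReal.toReal_pos (hA.measure_pos volume hne).ne' hb.measure_lt_top.ne

/-- The similarity dimension is smaller than the dimension of the ambient space. -/
lemma dimension_lt [Nontrivial (EuclideanSpace ℝ (Fin d))] (hF : Φ.IsAttractor F)
    (hT : Φ.TilesetCondition F)
    (hG : Φ.IsGenerators F G) (hC : (interior (convexHull ℝ F)).Nonempty) {D : ℝ}
    (hD : ∑ j, Φ.ratio j ^ D = 1) : D < d := by
  have hTo := isOpen_tiling hG hF hC
  have hTb := isBounded_tiling hG hF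
  obtain ⟨q₀⟩ := generators_index_nonempty hT hG
  -- At this scale the tube of the tiling, also after dividing `ε` by r_j, is the full tiling, and
  -- the tube of G_{q₀} is all of G_{q₀}. The renewal equation then gives Σ r_j^d < 1 = Σ r_j^D.
  set ε := max (inradius (Φ.tiling G)) (inradius (G q₀)) with hε
  have hε0 : 0 < ε := (inradius_pos hTo hTb (tiling_nonempty hT hG)).trans_le (le_max_left _ _)
  have h := tubeVolume_tiling hF hT hG hC ε
  rw [tubeVolume_of_inradius_le hTo hTb (le_max_left _ _)] at h
  have h2 : ∀ j, tubeVolume (Φ.tiling G) (ε / Φ.ratio j) = (volume (Φ.tiling G)).toReal := by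
    intro j
    refine tubeVolume_of_inradius_le hTo hTb ((le_max_left _ (inradius (G q₀))).trans ?_)
    rw [le_div_iff₀ (Φ.ratio_pos j), ← hε]
    nlinarith [Φ.ratio_lt_one j]
  simp only [h2, ← Finset.sum_mul] at h
  have h3 : 0 < ∑ q, tubeVolume (G q) ε := by
    refine Finset.sum_pos' (fun q _ => tubeVolume_nonneg _ _) ⟨q₀, Finset.mem_univ _, ?_⟩
    rw [tubeVolume_of_inradius_le (hG.isOpen hF hC q₀) (hG.isBounded hF q₀) (le_max_right _ _)]
    exact volume_toReal_pos_of_isOpen (hG.isOpen hF hC q₀) (hG.isBounded hF q₀) (hG.nonempty q₀)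
  have h4 := volume_toReal_pos_of_isOpen hTo hTb (tiling_nonempty hT hG)
  have h5 : ∑ j, Φ.ratio j ^ d < 1 := by nlinarith
  by_contra! hcon
  have h6 : ∑ j, Φ.ratio j ^ D ≤ ∑ j, Φ.ratio j ^ d := by
    refine Finset.sum_le_sum fun j _ => ?_
    rw [← Real.rpow_natCast]
    exact Real.rpow_le_rpow_of_exponent_ge (Φ.ratio_pos j) (Φ.ratio_lt_one j).le hcon
  linarith

/-- If some generator has nonzero inradius, the convex hull of the attractor has interior. -/
lemma interior_nonempty_of_inradius_ne_zero (hG : Φ.IsGenerators F G) {q : Fin Q}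
    (h : inradius (G q) ≠ 0) : (interior (convexHull ℝ F)).Nonempty := by
  have hne : {ε : ℝ | 0 < ε ∧ ∃ x, Metric.ball x ε ⊆ G q}.Nonempty := by
    by_contra hcon
    rw [Set.not_nonempty_iff_eq_empty] at hcon
    exact h (by rw [inradius, hcon, Real.sSup_empty])
  obtain ⟨ε, hε, x, hx⟩ := hne
  exact ⟨x, interior_maximal (hx.trans (hG.subset_convexHull q)) Metric.isOpen_ball
    (Metric.mem_ball_self hε)⟩

end Geometry

end SelfSimilarSystem

/-! ### Poisson summation for exponentially decaying functions. -/

section ExponentialDecay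

open FourierTransform

lemma summable_exp_neg_mul_abs_int {r : ℝ} (hr : 0 < r) :
    Summable fun n : ℤ => Real.exp (-r * |(n : ℝ)|) := by
  have h : Summable fun n : ℕ => Real.exp (n * (-r)) :=
    Real.summable_exp_nat_mul_iff.2 (neg_lt_zero.2 hr)
  rw [summable_int_iff_summable_nat_and_neg]
  constructor <;> refine h.congr fun n => ?_ <;> simp [mul_comm]

lemma summable_of_abs_le_exp {h : ℝ → ℝ} {C c T : ℝ} (hc : 0 < c) (hT : 0 < T)
    (hb : ∀ t, |h t| ≤ C * Real.exp (-c * |t|)) (t : ℝ) :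
    Summable fun n : ℤ => h (t + n * T) := by
  have hC : 0 ≤ C := by
    have := (abs_nonneg _).trans (hb 0)
    simpa using this
  refine Summable.of_norm_bounded (g := fun n : ℤ =>
    C * Real.exp (c * |t|) * Real.exp (-(c * T) * |(n : ℝ)|))
    ((summable_exp_neg_mul_abs_int (mul_pos hc hT)).mul_left _) fun n => ?_
  rw [Real.norm_eq_abs]
  refine (hb _).trans ?_
  rw [mul_assoc, ← Real.exp_add]
  refine mul_le_mul_of_nonneg_left (Real.exp_le_exp.2 ?_) hC
  have h1 : |(n : ℝ)| * T ≤ |t + n * T| + |t| := by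
    rw [← abs_of_pos hT, ← abs_mul, abs_of_pos hT]
    have := abs_sub (t + n * T) t
    rwa [add_sub_cancel_left] at this
  nlinarith

/-- Poisson summation along `T ℤ` for a continuous exponentially decaying function whose
Fourier coefficients are known. -/
lemma tsum_eq_of_abs_le_exp {h : ℝ → ℝ} (hcont : Continuous h) {C c T : ℝ} (hc : 0 < c)
    (hT : 0 < T) (hb : ∀ t, |h t| ≤ C * Real.exp (-c * |t|)) {F : ℤ → ℂ}
    (hF : ∀ n : ℤ, ∫ t : ℝ,
      Complex.exp (-((n : ℂ) * ((2 * Real.pi / T : ℝ) : ℂ) * Complex.I) * t) * (h t : ℂ) = F n)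
    (hFs : Summable F) (t : ℝ) :
    ((∑' n : ℤ, h (t + n * T) : ℝ) : ℂ) =
      (T : ℂ)⁻¹ * ∑' n : ℤ, F n *
        Complex.exp ((n : ℂ) * ((2 * Real.pi / T : ℝ) : ℂ) * Complex.I * t) := by
  set f : ℝ → ℂ := fun x => (h (T * x) : ℂ) with hf
  have hT' : (T : ℂ) ≠ 0 := by exact_mod_cast hT.ne'
  have hfc : Continuous f := by fun_prop
  have hC : 0 ≤ C := by
    have := (abs_nonneg _).trans (hb 0)
    simpa using this
  have hfourier : ∀ n : ℤ, 𝓕 f n = (T : ℂ)⁻¹ * F n := by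
    intro n
    rw [Real.fourier_real_eq_integral_exp_smul, ← hF n]
    have h1 := Measure.integral_comp_mul_left (fun y : ℝ =>
      Complex.exp (-((n : ℂ) * ((2 * Real.pi / T : ℝ) : ℂ) * Complex.I) * y) * (h y : ℂ)) T
    rw [abs_of_pos (inv_pos.2 hT), Complex.real_smul, Complex.ofReal_inv] at h1
    rw [← h1]
    refine integral_congr_ae (Eventually.of_forall fun x => ?_)
    simp only [smul_eq_mul, hf]
    congr 2
    push_cast
    field_simp
  have hO : f =O[cocompact ℝ] fun x => |x| ^ (-2 : ℝ) := by
    refine Asymptotics.IsBigO.of_bound (2 * C / (c * T) ^ 2) ?_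
    have hev : ∀ᶠ x : ℝ in cocompact ℝ, x ≠ 0 := by
      have : ({0} : Set ℝ)ᶜ ∈ cocompact ℝ := isCompact_singleton.compl_mem_cocompact
      exact this
    filter_upwards [hev] with x hx
    have hx0 : 0 < |x| := abs_pos.2 hx
    rw [hf, Complex.norm_real, Real.norm_eq_abs, Real.norm_of_nonneg (by positivity)]
    refine (hb _).trans ?_
    rw [abs_mul, abs_of_pos hT, Real.rpow_neg hx0.le]
    -- From e^x ≥ x²/2, exponential decay implies the quadratic decay required for Poisson
    -- summation.
    have h1 := Real.quadratic_le_exp_of_nonneg (x := c * (T * |x|)) (by positivity)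
    have h2 : (c * (T * |x|)) ^ 2 / 2 ≤ Real.exp (c * (T * |x|)) := by
      have : 0 ≤ c * (T * |x|) := by positivity
      linarith
    have h3 : Real.exp (-c * (T * |x|)) ≤ ((c * (T * |x|)) ^ 2 / 2)⁻¹ := by
      rw [neg_mul, Real.exp_neg]
      exact inv_anti₀ (by positivity) h2
    refine (mul_le_mul_of_nonneg_left h3 hC).trans (le_of_eq ?_)
    have : |x| ^ (2 : ℝ) = |x| ^ 2 := by exact_mod_cast Real.rpow_natCast |x| 2
    rw [this]
    field_simp
  have hP := Real.tsum_eq_tsum_fourier_of_rpow_decay_of_summable hfc one_lt_two hO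
    ((hFs.mul_left _).congr fun n => (hfourier n).symm) (t / T)
  rw [Complex.ofReal_tsum, ← tsum_mul_left]
  have hl : ∀ n : ℤ, f (t / T + n) = ((h (t + n * T) : ℝ) : ℂ) := fun n => by
    simp only [hf]
    congr 2
    field_simp
  have hr : ∀ n : ℤ, 𝓕 f n * fourier n ((t / T : ℝ) : UnitAddCircle) = (T : ℂ)⁻¹ *
      (F n * Complex.exp ((n : ℂ) * ((2 * Real.pi / T : ℝ) : ℂ) * Complex.I * t)) := fun n => by
    rw [hfourier, fourier_coe_apply, mul_assoc]
    congr 3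
    push_cast
    field_simp
  simpa only [hl, hr] using hP

end ExponentialDecay

/-! ### The profile of a monophase tile and its Mellin transform. -/

section Profile

/-- The contribution `x ^ (D - d) V(x)`, at `x = exp (-t)`, of a monophase tile of inradius `g` and
coefficients `κ` to the normalised tube volume. -/
noncomputable def tileProfile (d : ℕ) (D g : ℝ) (κ : ℕ → ℝ) (t : ℝ) : ℝ :=
  if t ≤ -Real.log g then -κ d * Real.exp ((d - D) * t)
  else ∑ k ∈ Finset.range d, κ k * Real.exp (-(D - k) * t)

/-- The Mellin transform `∑_{k ≤ d} g ^ (s - k) / (s - k) κ_k` of a monophase tile. -/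
noncomputable def tileMellin (d : ℕ) (g : ℝ) (κ : ℕ → ℝ) (s : ℂ) : ℂ :=
  ∑ k ∈ Finset.range (d + 1), (g : ℂ) ^ (s - (k : ℂ)) / (s - (k : ℂ)) * ((κ k : ℝ) : ℂ)

variable {d : ℕ} {D g : ℝ} {κ : ℕ → ℝ}

lemma sub_one_le_of_mem_range {k : ℕ} (hk : k ∈ Finset.range d) : D - d + 1 ≤ D - k := by
  have : k + 1 ≤ d := Finset.mem_range.1 hk
  have : (k : ℝ) + 1 ≤ d := by exact_mod_cast this
  linarith

/-- The two branches meet at `t = -log g` precisely because the tube polynomial equals the volume at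
the inradius. -/
lemma continuous_tileProfile (hg : 0 < g)
    (hκ : ∑ k ∈ Finset.range (d + 1), κ k * g ^ (d - k) = 0) :
    Continuous (tileProfile d D g κ) := by
  refine Continuous.if_le (by fun_prop) (by fun_prop) continuous_id continuous_const ?_
  rintro _ rfl
  rw [Finset.sum_range_succ] at hκ
  simp only [Nat.sub_self, pow_zero, mul_one] at hκ
  rw [show -κ d = ∑ k ∈ Finset.range d, κ k * g ^ (d - k) by linarith, Finset.sum_mul]
  refine Finset.sum_congr rfl fun k hk => ?_
  have hk' : k ≤ d := (Finset.mem_range.1 hk).le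
  rw [mul_assoc]
  congr 1
  rw [← Real.rpow_natCast, Nat.cast_sub hk', Real.rpow_def_of_pos hg, ← Real.exp_add]
  congr 1
  ring

/-- The left branch decays at rate d - D, the right one at rates D - k ≥ D - d + 1. The estimate is
natural around the breakpoint `-log g`; recentring at 0 only changes the constant. -/
lemma exists_abs_tileProfile_le (h1 : (d : ℝ) - 1 < D) (h2 : D < d) :
    ∃ C, ∀ t, |tileProfile d D g κ t| ≤ C * Real.exp (-min (D - d + 1) (d - D) * |t|) := by
  set c := min (D - d + 1) (d - D) with hc
  have hc0 : 0 < c := lt_min (by linarith) (by linarith)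
  set C₁ := ∑ k ∈ Finset.range (d + 1), |κ k| * Real.exp ((D - k) * Real.log g)
  have hterm : ∀ k ∈ Finset.range (d + 1), 0 ≤ |κ k| * Real.exp ((D - k) * Real.log g) :=
    fun k _ => by positivity
  have key : ∀ t, |tileProfile d D g κ t| ≤ C₁ * Real.exp (-c * |t + Real.log g|) := by
    intro t
    unfold tileProfile
    split_ifs with ht
    · rw [abs_mul, abs_neg, Real.abs_exp]
      have hs := Finset.single_le_sum hterm (Finset.mem_range.2 d.lt_succ_self)
      refine le_trans ?_ (mul_le_mul_of_nonneg_right hs (Real.exp_pos _).le)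
      rw [mul_assoc, ← Real.exp_add]
      refine mul_le_mul_of_nonneg_left (Real.exp_le_exp.2 ?_) (abs_nonneg _)
      rw [abs_of_nonpos (by linarith)]
      have : c ≤ d - D := min_le_right _ _
      nlinarith
    · push Not at ht
      refine (Finset.abs_sum_le_sum_abs _ _).trans ?_
      rw [Finset.sum_mul]
      refine (Finset.sum_le_sum fun k hk => ?_).trans (Finset.sum_le_sum_of_subset_of_nonneg
        (Finset.range_mono d.le_succ) fun k hk _ => mul_nonneg (hterm k hk) (Real.exp_pos _).le)
      rw [abs_mul, Real.abs_exp, mul_assoc, ← Real.exp_add]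
      refine mul_le_mul_of_nonneg_left (Real.exp_le_exp.2 ?_) (abs_nonneg _)
      rw [abs_of_nonneg (by linarith)]
      have h3 : c ≤ D - k := (min_le_left _ _).trans (sub_one_le_of_mem_range hk)
      nlinarith
  refine ⟨C₁ * Real.exp (c * |Real.log g|), fun t => (key t).trans ?_⟩
  rw [mul_assoc, ← Real.exp_add]
  refine mul_le_mul_of_nonneg_left (Real.exp_le_exp.2 ?_) (Finset.sum_nonneg hterm)
  have h3 : |t| ≤ |t + Real.log g| + |Real.log g| := by
    have := abs_sub (t + Real.log g) (Real.log g)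
    rwa [add_sub_cancel_right] at this
  nlinarith

lemma ofReal_cpow_eq_exp (hg : 0 < g) (s : ℂ) :
    (g : ℂ) ^ s = Complex.exp (-s * ((-Real.log g : ℝ) : ℂ)) := by
  rw [Complex.cpow_def_of_ne_zero (by exact_mod_cast hg.ne'), ← Complex.ofReal_log hg.le]
  push_cast
  ring_nf

/-- The Fourier transform of the profile of a tile. -/
lemma integral_exp_mul_tileProfile (hg : 0 < g) (h1 : (d : ℝ) - 1 < D) (h2 : D < d) {z : ℂ}
    (hz : z.re = 0) :
    ∫ t : ℝ, Complex.exp (-z * t) * (tileProfile d D g κ t : ℂ) =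
      tileMellin d g κ ((D : ℂ) + z) := by
  set c := -Real.log g with hc
  set F : ℝ → ℂ := fun t => Complex.exp (-z * t) * (tileProfile d D g κ t : ℂ)
  have hre : ∀ k : ℕ, (-((D : ℂ) + z - k)).re = -(D - k) := fun k => by simp [hz]
  have hpos : ∀ k ∈ Finset.range d, (-((D : ℂ) + z - k)).re < 0 := fun k hk => by
    rw [hre]
    have := sub_one_le_of_mem_range (D := D) hk
    linarith
  have hneg : 0 < (-((D : ℂ) + z - d)).re := by rw [hre]; linarith
  have hF1 : Set.EqOn F (fun t : ℝ => -(κ d : ℂ) * Complex.exp (-((D : ℂ) + z - d) * t))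
      (Set.Iic c) := by
    intro t ht
    have ht' : t ≤ -Real.log g := ht
    simp only [F, tileProfile, if_pos ht']
    push_cast
    rw [mul_left_comm, ← Complex.exp_add]
    ring_nf
  have hF2 : Set.EqOn F (fun t : ℝ => ∑ k ∈ Finset.range d,
      (κ k : ℂ) * Complex.exp (-((D : ℂ) + z - k) * t)) (Set.Ioi c) := by
    intro t ht
    have ht' : ¬ t ≤ -Real.log g := not_le.2 ht
    simp only [F, tileProfile, if_neg ht']
    push_cast
    rw [Finset.mul_sum]
    refine Finset.sum_congr rfl fun k _ => ?_
    rw [mul_left_comm, ← Complex.exp_add]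
    ring_nf
  have hI1 : IntegrableOn (fun t : ℝ => -(κ d : ℂ) * Complex.exp (-((D : ℂ) + z - d) * t))
      (Set.Iic c) := (integrableOn_exp_mul_complex_Iic hneg c).const_mul _
  have hI2' : ∀ k ∈ Finset.range d, IntegrableOn (fun t : ℝ =>
      (κ k : ℂ) * Complex.exp (-((D : ℂ) + z - k) * t)) (Set.Ioi c) := fun k hk =>
    (integrableOn_exp_mul_complex_Ioi (hpos k hk) c).const_mul _
  have hI2 : IntegrableOn (fun t : ℝ => ∑ k ∈ Finset.range d,
      (κ k : ℂ) * Complex.exp (-((D : ℂ) + z - k) * t)) (Set.Ioi c) :=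
    integrable_finsetSum _ hI2'
  rw [← intervalIntegral.integral_Iic_add_Ioi (b := c)
    (hI1.congr_fun hF1.symm measurableSet_Iic) (hI2.congr_fun hF2.symm measurableSet_Ioi),
    setIntegral_congr_fun measurableSet_Iic hF1, setIntegral_congr_fun measurableSet_Ioi hF2,
    integral_finsetSum _ hI2', integral_const_mul, integral_exp_mul_complex_Iic hneg, tileMellin,
    Finset.sum_range_succ, add_comm]
  congr 1
  · refine Finset.sum_congr rfl fun k hk => ?_
    rw [integral_const_mul, integral_exp_mul_complex_Ioi (hpos k hk), ofReal_cpow_eq_exp hg, ← hc,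
      neg_div_neg_eq, mul_comm]
  · rw [ofReal_cpow_eq_exp hg, ← hc, div_neg, mul_neg, neg_mul, neg_neg, mul_comm]

/-- Because the tube polynomial matches the volume at the inradius, the terms of the Mellin
transform can be regrouped. -/
lemma tileMellin_eq (hg : 0 < g) (hκ : ∑ k ∈ Finset.range (d + 1), κ k * g ^ (d - k) = 0) {s : ℂ}
    (hs : ∀ k ∈ Finset.range (d + 1), s - k ≠ 0) :
    tileMellin d g κ s = ∑ k ∈ Finset.range d,
      (g : ℂ) ^ (s - (k : ℂ)) * ((κ k : ℝ) : ℂ) * ((k : ℂ) - d) / ((s - k) * (s - d)) := by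
  have hg' : (g : ℂ) ≠ 0 := by exact_mod_cast hg.ne'
  have hd := hs d (Finset.mem_range.2 d.lt_succ_self)
  have h0 : ∑ k ∈ Finset.range (d + 1), (g : ℂ) ^ (s - (k : ℂ)) * ((κ k : ℝ) : ℂ) = 0 := by
    have h1 : ((∑ k ∈ Finset.range (d + 1), κ k * g ^ (d - k) : ℝ) : ℂ) = 0 := by rw [hκ]; simp
    have h2 : ∑ k ∈ Finset.range (d + 1), (g : ℂ) ^ (s - (k : ℂ)) * ((κ k : ℝ) : ℂ) =
        (g : ℂ) ^ (s - d) * ((∑ k ∈ Finset.range (d + 1), κ k * g ^ (d - k) : ℝ) : ℂ) := by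
      push_cast
      rw [Finset.mul_sum]
      refine Finset.sum_congr rfl fun k hk => ?_
      have hk' : k ≤ d := Nat.lt_succ_iff.1 (Finset.mem_range.1 hk)
      rw [mul_comm ((κ k : ℝ) : ℂ), ← mul_assoc]
      congr 1
      rw [← Complex.cpow_natCast, ← Complex.cpow_add _ _ hg', Nat.cast_sub hk']
      congr 1
      ring
    rw [h2, h1, mul_zero]
  have h3 : tileMellin d g κ s = ∑ k ∈ Finset.range (d + 1),
      (g : ℂ) ^ (s - (k : ℂ)) * ((κ k : ℝ) : ℂ) * ((k : ℂ) - d) / ((s - k) * (s - d)) := by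
    -- A multiple of the vanishing sum `h0` is subtracted so that 1/(s - k) - 1/(s - d) = (k -
    -- d)/((s - k)(s - d)).
    have h4 : tileMellin d g κ s = tileMellin d g κ s -
        (∑ k ∈ Finset.range (d + 1), (g : ℂ) ^ (s - (k : ℂ)) * ((κ k : ℝ) : ℂ)) / (s - d) := by
      rw [h0, zero_div, sub_zero]
    rw [h4, tileMellin, Finset.sum_div, ← Finset.sum_sub_distrib]
    refine Finset.sum_congr rfl fun k hk => ?_
    have := hs k hk
    field_simp
    ring
  rw [h3, Finset.sum_range_succ, sub_self]
  simp

/-- In the regrouped form each term has two denominators of modulus at least |Im s|. This quadratic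
decay makes the residues absolutely summable. -/
lemma norm_tileMellin_le (hg : 0 < g) (hκ : ∑ k ∈ Finset.range (d + 1), κ k * g ^ (d - k) = 0)
    {s : ℂ} (hre : s.re = D) (him : s.im ≠ 0) :
    ‖tileMellin d g κ s‖ ≤
      (∑ k ∈ Finset.range d, g ^ (D - k) * |κ k| * (d - k)) / s.im ^ 2 := by
  have hle : ∀ k : ℕ, |s.im| ≤ ‖s - k‖ := fun k => by
    simpa using Complex.abs_im_le_norm (s - k)
  have hne : ∀ k : ℕ, s - k ≠ 0 := fun k h => by
    have := hle k
    rw [h, norm_zero] at this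
    exact him (abs_nonpos_iff.1 this)
  rw [tileMellin_eq hg hκ fun k _ => hne k, Finset.sum_div]
  refine norm_sum_le_of_le _ fun k hk => ?_
  have hkd : (k : ℝ) ≤ d := by exact_mod_cast (Finset.mem_range.1 hk).le
  have hnorm : ‖(k : ℂ) - d‖ = d - k := by
    have : (k : ℂ) - d = ((k - d : ℝ) : ℂ) := by push_cast; ring
    rw [this, Complex.norm_real, Real.norm_eq_abs, abs_of_nonpos (by linarith)]
    ring
  rw [norm_div, norm_mul, norm_mul, norm_mul, hnorm, Complex.norm_cpow_eq_rpow_re_of_pos hg,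
    Complex.norm_real, Real.norm_eq_abs]
  have hre' : (s - (k : ℂ)).re = D - k := by simp [hre]
  rw [hre']
  have h0 : 0 ≤ g ^ (D - k) * |κ k| * (d - k) :=
    mul_nonneg (by positivity) (by linarith)
  refine div_le_div_of_nonneg_left h0 (by positivity) ?_
  rw [← sq_abs, sq]
  exact mul_le_mul (hle k) (hle d) (abs_nonneg _) (norm_nonneg _)

/-- Ties the nonvanishing assumption of the theorem to the Mellin transform at `D`: they differ by
the positive factor 1/(d - D). -/
lemma tileMellin_ofReal (hg : 0 < g) (hκ : ∑ k ∈ Finset.range (d + 1), κ k * g ^ (d - k) = 0)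
    (h1 : (d : ℝ) - 1 < D) (h2 : D < d) :
    tileMellin d g κ (D : ℂ) = (((d - D)⁻¹ * ∑ k ∈ Finset.range d,
      g ^ (D - (k : ℝ)) / (D - (k : ℝ)) * ((d : ℝ) - (k : ℝ)) * κ k : ℝ) : ℂ) := by
  have hdD : (D : ℝ) - d ≠ 0 := by linarith
  have hne : ∀ k ∈ Finset.range (d + 1), (D : ℂ) - k ≠ 0 := by
    intro k hk
    have : (D : ℝ) - k ≠ 0 := by
      rcases Nat.lt_succ_iff_lt_or_eq.1 (Finset.mem_range.1 hk) with h | rfl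
      · have := sub_one_le_of_mem_range (D := D) (Finset.mem_range.2 h)
        linarith
      · exact hdD
    exact_mod_cast this
  rw [tileMellin_eq hg hκ hne, Finset.mul_sum, Complex.ofReal_sum]
  refine Finset.sum_congr rfl fun k hk => ?_
  have e1 := hne k (Finset.mem_range.2 ((Finset.mem_range.1 hk).trans d.lt_succ_self))
  have e2 := hne d (Finset.mem_range.2 d.lt_succ_self)
  have e3 : (d : ℂ) - D ≠ 0 := by rw [← neg_sub]; exact neg_ne_zero.2 e2
  push_cast
  rw [Complex.ofReal_cpow hg.le]
  push_cast
  field_simp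
  ring

end Profile

/-! ### Exponential polynomials and linear recurrences. -/

section ExponentialPolynomial

open Polynomial

/-- The shift operator on two-sided sequences. -/
noncomputable def seqShift : Module.End ℂ (ℤ → ℂ) where
  toFun a n := a (n + 1)
  map_add' _ _ := rfl
  map_smul' _ _ := rfl

lemma seqShift_pow_apply (k : ℕ) (a : ℤ → ℂ) (n : ℤ) : (seqShift ^ k) a n = a (n + k) := by
  induction k generalizing n with
  | zero => simp
  | succ k ih =>
    rw [pow_succ', Module.End.mul_apply]
    change (seqShift ^ k) a (n + 1) = _
    rw [ih]
    congr 1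
    push_cast
    ring

/-- Two-sided sequences satisfying a linear recurrence which determines them backwards. -/
def IsBackwardRecurrent (a : ℤ → ℂ) : Prop :=
  ∃ p : ℂ[X], p.eval 0 ≠ 0 ∧ aeval seqShift p a = 0

lemma isBackwardRecurrent_zero : IsBackwardRecurrent 0 := ⟨1, by simp, by simp⟩

lemma IsBackwardRecurrent.add {a b : ℤ → ℂ} (ha : IsBackwardRecurrent a)
    (hb : IsBackwardRecurrent b) : IsBackwardRecurrent (a + b) := by
  obtain ⟨p, hp, hpa⟩ := ha
  obtain ⟨q, hq, hqb⟩ := hb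
  refine ⟨p * q, by simp [hp, hq], ?_⟩
  have h1 : aeval seqShift (p * q) a = 0 := by
    rw [mul_comm, map_mul, Module.End.mul_apply, hpa, map_zero]
  have h2 : aeval seqShift (p * q) b = 0 := by
    rw [map_mul, Module.End.mul_apply, hqb, map_zero]
  rw [map_add, h1, h2, add_zero]

lemma IsBackwardRecurrent.sum {ι : Type*} {s : Finset ι} {a : ι → ℤ → ℂ}
    (ha : ∀ i ∈ s, IsBackwardRecurrent (a i)) : IsBackwardRecurrent (∑ i ∈ s, a i) :=
  Finset.sum_induction _ _ (fun _ _ => IsBackwardRecurrent.add) isBackwardRecurrent_zero ha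

lemma IsBackwardRecurrent.smul {a : ℤ → ℂ} (ha : IsBackwardRecurrent a) (c : ℂ) :
    IsBackwardRecurrent (c • a) := by
  obtain ⟨p, hp, hpa⟩ := ha
  exact ⟨p, hp, by rw [map_smul, hpa, smul_zero]⟩

lemma isBackwardRecurrent_zpow {l : ℂ} (hl : l ≠ 0) : IsBackwardRecurrent fun n : ℤ => l ^ n := by
  refine ⟨X - C l, by simpa using hl, ?_⟩
  ext n
  simp only [map_sub, aeval_X, aeval_C, LinearMap.sub_apply, Pi.sub_apply,
    Module.algebraMap_end_apply, Pi.smul_apply, smul_eq_mul, Pi.zero_apply]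
  change l ^ (n + 1) - l * l ^ n = 0
  rw [zpow_add_one₀ hl]
  ring

/-- Shift S and multiplication by n satisfy S n = n S + S, so the commutator of p(S) with n is S
p'(S). -/
lemma aeval_seqShift_mul_id (p : ℂ[X]) (a : ℤ → ℂ) :
    aeval seqShift p (fun n : ℤ => (n : ℂ) * a n) =
      (fun n : ℤ => (n : ℂ) * aeval seqShift p a n) +
        seqShift (aeval seqShift (derivative p) a) := by
  induction p using Polynomial.induction_on' with
  | add p q hp hq =>
    rw [map_add, LinearMap.add_apply, hp, hq]
    ext n
    simp only [map_add, LinearMap.add_apply, Pi.add_apply]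
    ring
  | monomial k c =>
    ext n
    simp only [aeval_monomial, derivative_monomial, Module.End.mul_apply,
      Module.algebraMap_end_apply, Pi.add_apply, Pi.smul_apply, smul_eq_mul, seqShift_pow_apply]
    change _ = _ + c * k * (seqShift ^ (k - 1)) a (n + 1)
    rw [seqShift_pow_apply]
    rcases k with _ | k
    · simp; ring
    · have : n + 1 + ((k + 1 - 1 : ℕ) : ℤ) = n + ((k + 1 : ℕ) : ℤ) := by
        push_cast [Nat.add_sub_cancel]; ring
      rw [this]
      push_cast
      ring

/-- By the commutator formula p(S) sends n a_n to S p'(S) a, which a second p(S) kills; p² is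
therefore an annihilator. -/
lemma IsBackwardRecurrent.id_mul {a : ℤ → ℂ} (ha : IsBackwardRecurrent a) :
    IsBackwardRecurrent fun n : ℤ => (n : ℂ) * a n := by
  obtain ⟨p, hp, hpa⟩ := ha
  refine ⟨p * p, by simp [hp], ?_⟩
  have h1 : aeval seqShift p (fun n : ℤ => (n : ℂ) * a n) =
      aeval seqShift (X * derivative p) a := by
    rw [aeval_seqShift_mul_id, hpa, map_mul, aeval_X, Module.End.mul_apply]
    ext n
    simp
  rw [map_mul, Module.End.mul_apply, h1, ← Module.End.mul_apply, ← map_mul, mul_comm, map_mul,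
    Module.End.mul_apply, hpa, map_zero]

lemma IsBackwardRecurrent.affine_mul {a : ℤ → ℂ} (ha : IsBackwardRecurrent a) (α β : ℂ) :
    IsBackwardRecurrent fun n : ℤ => (α + n * β) * a n := by
  convert (ha.smul α).add (ha.id_mul.smul β) using 1
  ext n
  simp only [Pi.add_apply, Pi.smul_apply, smul_eq_mul]
  ring

lemma IsBackwardRecurrent.prod_affine_mul {ι : Type*} (s : Finset ι) (α β : ι → ℂ) {a : ℤ → ℂ}
    (ha : IsBackwardRecurrent a) :
    IsBackwardRecurrent fun n : ℤ => (∏ i ∈ s, (α i + n * β i)) * a n := by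
  classical
  induction s using Finset.induction_on with
  | empty => simpa using ha
  | insert i s hi ih =>
    convert ih.affine_mul (α i) (β i) using 2 with n
    rw [Finset.prod_insert hi]
    ring

/-- The nonzero constant coefficient expresses each entry through later ones, so vanishing spreads
backwards. -/
lemma IsBackwardRecurrent.eq_zero {a : ℤ → ℂ} (ha : IsBackwardRecurrent a) {N : ℤ}
    (hN : ∀ n, N ≤ n → a n = 0) (n : ℤ) : a n = 0 := by
  obtain ⟨p, hp, hpa⟩ := ha
  have step : ∀ m : ℤ, (∀ n, m < n → a n = 0) → a m = 0 := by
    intro m hm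
    have h := congrFun hpa m
    rw [aeval_eq_sum_range, LinearMap.sum_apply, Finset.sum_apply,
      Finset.sum_eq_single_of_mem 0 (by simp)] at h
    · rw [LinearMap.smul_apply, Pi.smul_apply, seqShift_pow_apply, smul_eq_mul,
        Pi.zero_apply, coeff_zero_eq_eval_zero] at h
      simpa [hp] using h
    · intro i _ hi
      rw [LinearMap.smul_apply, Pi.smul_apply, seqShift_pow_apply, hm _ (by omega), smul_zero]
  have key : ∀ k : ℕ, ∀ n, N - k ≤ n → a n = 0 := by
    intro k
    induction k with
    | zero => simpa using hN
    | succ k ih =>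
      intro n hn
      rcases eq_or_lt_of_le hn with h | h
      · refine step n fun m hm => ih m (by push_cast at h; omega)
      · exact ih n (by push_cast at h; omega)
  exact key (N - n).toNat n (by omega)

end ExponentialPolynomial

/-! ### The lattice renewal theorem. -/

section Periodization

variable {ι : Type*} [Fintype ι] {p τ : ι → ℝ}

lemma tendsto_tsum_nat_translates {h : ℝ → ℝ} {C c T : ℝ} (hc : 0 < c) (hT : 0 < T)
    (hb : ∀ t, |h t| ≤ C * Real.exp (-c * |t|)) :
    Tendsto (fun t => ∑' n : ℕ, h (t + n * T)) atTop (𝓝 0) := by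
  have hs : Summable fun n : ℕ => C * Real.exp (n * (-(c * T))) :=
    (Real.summable_exp_nat_mul_iff.2 (neg_lt_zero.2 (mul_pos hc hT))).mul_left C
  set K := ∑' n : ℕ, C * Real.exp (n * (-(c * T)))
  have hlim : Tendsto (fun t : ℝ => K * Real.exp (-c * t)) atTop (𝓝 0) := by
    have h1 : Tendsto (fun t : ℝ => -c * t) atTop atBot :=
      tendsto_id.const_mul_atTop_of_neg (neg_lt_zero.2 hc)
    simpa using (Real.tendsto_exp_atBot.comp h1).const_mul K
  refine squeeze_zero_norm' ?_ hlim
  filter_upwards [eventually_ge_atTop (0 : ℝ)] with t ht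
  have h1 : ∀ n : ℕ, ‖h (t + n * T)‖ ≤ C * Real.exp (n * (-(c * T))) * Real.exp (-c * t) := by
    intro n
    refine (hb _).trans (le_of_eq ?_)
    rw [abs_of_nonneg (by positivity), mul_assoc, ← Real.exp_add]
    ring_nf
  have h2 := tsum_of_norm_bounded (hs.mul_right (Real.exp (-c * t))).hasSum h1
  rwa [tsum_mul_right] at h2

/-- The lattice renewal theorem: a solution of the renewal equation is asymptotic to the
periodization of the inhomogeneity. -/
lemma tendsto_sub_periodization [Nonempty ι] (hp : ∀ i, 0 < p i) (hp1 : ∑ i, p i = 1)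
    {T : ℝ} (hT : 0 < T) {k : ι → ℕ} (hk : ∀ i, 0 < k i) (hτ : ∀ i, τ i = k i * T)
    (hmem : T ∈ AddSubgroup.closure (Set.range τ))
    {z h : ℝ → ℝ} {B B' C c : ℝ} (hc : 0 < c)
    (hb : ∀ t, |h t| ≤ C * Real.exp (-c * |t|)) (hB : ∀ t, |z t| ≤ B)
    (hz : ∀ t, z t = h t + ∑ i, p i * z (t - τ i)) (hz0 : Tendsto z atBot (𝓝 0))
    (hB' : ∀ t, |∑' n : ℤ, h (t + n * T)| ≤ B') :
    Tendsto (fun t => z t - (∑ i, p i * k i)⁻¹ * ∑' n : ℤ, h (t + n * T)) atTop (𝓝 0) := by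
  set m := ∑ i, p i * k i with hm
  have hm0 : 0 < m :=
    Finset.sum_pos (fun i _ => mul_pos (hp i) (by exact_mod_cast hk i)) Finset.univ_nonempty
  set S : ℝ → ℝ := fun t => ∑' n : ℤ, h (t + n * T) with hS
  have hper : ∀ (j : ℕ) t, S (t - j * T) = S t := by
    intro j t
    simp only [hS]
    rw [← (Equiv.addRight (j : ℤ)).tsum_eq]
    refine tsum_congr fun n => ?_
    congr 1
    simp only [Equiv.coe_addRight]
    push_cast
    ring
  have hh0 : Tendsto h atTop (𝓝 0) := by
    have h1 : Tendsto (fun t : ℝ => -c * t) atTop atBot :=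
      tendsto_id.const_mul_atTop_of_neg (neg_lt_zero.2 hc)
    have h2 : Tendsto (fun t : ℝ => C * Real.exp (-c * t)) atTop (𝓝 0) := by
      simpa using (Real.tendsto_exp_atBot.comp h1).const_mul C
    refine squeeze_zero_norm' ?_ h2
    filter_upwards [eventually_ge_atTop (0 : ℝ)] with t ht
    simpa [abs_of_nonneg ht] using hb t
  set I : ℝ → ℝ := fun t => ∑ i, p i * ∑ n ∈ Finset.range (k i), z (t - n * T) with hI
  -- Discrete counterpart of the window integral: the inner sums telescope, and the renewal equation
  -- leaves `h`.
  have hIsub : ∀ t, I t - I (t - T) = h t := by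
    intro t
    have h1 : I t - I (t - T) = ∑ i, p i * (z t - z (t - τ i)) := by
      simp only [hI]
      rw [← Finset.sum_sub_distrib]
      refine Finset.sum_congr rfl fun i _ => ?_
      rw [← mul_sub, ← Finset.sum_sub_distrib, hτ]
      congr 1
      have := Finset.sum_range_sub' (fun n : ℕ => z (t - n * T)) (k i)
      simp only [Nat.cast_zero, zero_mul, sub_zero] at this
      rw [← this]
      refine Finset.sum_congr rfl fun n _ => ?_
      congr 2
      push_cast
      ring
    rw [h1]
    simp only [mul_sub, Finset.sum_sub_distrib, ← Finset.sum_mul, hp1, one_mul]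
    linarith [hz t]
  have hI0 : Tendsto I atBot (𝓝 0) := by
    have : Tendsto I atBot (𝓝 (∑ i, p i * ∑ n ∈ Finset.range (k i), (0 : ℝ))) := by
      refine tendsto_finsetSum _ fun i _ => Tendsto.const_mul _ (tendsto_finsetSum _ fun n _ => ?_)
      exact hz0.comp (tendsto_atBot_add_const_right _ (-(n * T)) tendsto_id)
    simpa using this
  have hsum : ∀ t, Summable fun n : ℤ => h (t + n * T) := summable_of_abs_le_exp hc hT hb
  have hItsum : ∀ t, ∑' n : ℕ, h (t - n * T) = I t := by
    intro t
    have hs : Summable fun n : ℕ => h (t - n * T) := by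
      refine (summable_int_iff_summable_nat_and_neg.1 (hsum t)).2.congr fun n => ?_
      congr 1
      push_cast
      ring
    refine tendsto_nhds_unique hs.hasSum.tendsto_sum_nat ?_
    have h1 : ∀ N : ℕ, ∑ n ∈ Finset.range N, h (t - n * T) = I t - I (t - N * T) := by
      intro N
      have := Finset.sum_range_sub' (fun n : ℕ => I (t - n * T)) N
      simp only [Nat.cast_zero, zero_mul, sub_zero] at this
      rw [← this]
      refine Finset.sum_congr rfl fun n _ => ?_
      rw [← hIsub (t - n * T)]
      congr 2
      push_cast
      ring
    simp only [h1]
    have h2 : Tendsto (fun N : ℕ => t - N * T) atTop atBot := by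
      have : Tendsto (fun N : ℕ => (N : ℝ) * T) atTop atTop :=
        tendsto_natCast_atTop_atTop.atTop_mul_const hT
      exact tendsto_atBot_add_const_left _ t (tendsto_neg_atTop_atBot.comp this)
    simpa using tendsto_const_nhds.sub (hI0.comp h2)
  -- As `I` vanishes at -∞, it is the sum of `h` over all backward translates; it differs from the
  -- full periodization only by the forward ones, which tend to 0.
  have hSI : ∀ t, I t - S t = h t - ∑' n : ℕ, h (t + n * T) := by
    intro t
    have h1 := tsum_of_nat_of_neg_add_one (f := fun n : ℤ => h (t + n * T))
      ((summable_int_iff_summable_nat_and_neg.1 (hsum t)).1)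
      ((summable_nat_add_iff 1).2 (summable_int_iff_summable_nat_and_neg.1 (hsum t)).2 |>.congr
        fun n => by push_cast; rfl)
    have h2 : ∑' n : ℕ, h (t + ((-(n + 1) : ℤ) : ℝ) * T) = I (t - T) := by
      rw [← hItsum]
      refine tsum_congr fun n => ?_
      congr 1
      push_cast
      ring
    have h3 : S t = ∑' n : ℕ, h (t + ((n : ℤ) : ℝ) * T) +
        ∑' n : ℕ, h (t + ((-(n + 1) : ℤ) : ℝ) * T) := h1
    rw [h2] at h3
    simp only [Int.cast_natCast] at h3
    linarith [hIsub t]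
  refine tendsto_zero_of_lattice_renewal hp hp1 hT hk hτ hmem (B := B + m⁻¹ * B') ?_ ?_ ?_
  · intro t
    refine (abs_sub _ _).trans (add_le_add (hB t) ?_)
    rw [abs_mul, abs_of_pos (inv_pos.2 hm0)]
    exact mul_le_mul_of_nonneg_left (hB' t) (inv_pos.2 hm0).le
  · refine hh0.congr fun t => ?_
    have h1 : ∀ i, p i * (z (t - τ i) - m⁻¹ * S (t - τ i)) =
        p i * z (t - τ i) - p i * (m⁻¹ * S t) := fun i => by
      rw [hτ, hper, mul_sub]
    change _ = z t - m⁻¹ * S t - ∑ i, p i * (z (t - τ i) - m⁻¹ * S (t - τ i))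
    simp only [h1, Finset.sum_sub_distrib, ← Finset.sum_mul, hp1]
    linarith [hz t]
  · have h1 : Tendsto (fun t => I t - S t) atTop (𝓝 0) := by
      simp only [hSI]
      simpa using hh0.sub (tendsto_tsum_nat_translates hc hT hb)
    refine h1.congr fun t => ?_
    change _ = ∑ i, p i * ∑ n ∈ Finset.range (k i), (z (t - n * T) - m⁻¹ * S (t - n * T))
    simp only [hper, Finset.sum_sub_distrib, Finset.sum_const, Finset.card_range, nsmul_eq_mul,
      mul_sub, ← mul_assoc, ← Finset.sum_mul]
    rw [← hm, mul_inv_cancel₀ hm0.ne', one_mul]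

end Periodization

/-! ### Uniqueness of Fourier coefficients. -/

section TrigonometricSeries

/-- Uniqueness of the coefficients of absolutely convergent trigonometric series. -/
lemma eq_zero_of_tsum_exp_eq_zero {a : ℤ → ℂ} (ha : Summable a) {T : ℝ} (hT : 0 < T)
    (h : ∀ t : ℝ, ∑' n : ℤ, a n *
      Complex.exp ((n : ℂ) * ((2 * Real.pi / T : ℝ) : ℂ) * Complex.I * t) = 0) (m : ℤ) :
    a m = 0 := by
  set q : ℂ := ((2 * Real.pi / T : ℝ) : ℂ) with hq
  have hT' : (T : ℂ) ≠ 0 := by exact_mod_cast hT.ne'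
  have hq0 : q ≠ 0 := by
    rw [hq]; exact_mod_cast (by positivity : (2 * Real.pi / T : ℝ) ≠ 0)
  -- The frequency `m` is twisted to 0, so integration over one period isolates `a m`.
  let f : ℤ → C(ℝ, ℂ) := fun n =>
    ⟨fun t => a n * Complex.exp (((n - m : ℤ) : ℂ) * q * Complex.I * t), by fun_prop⟩
  have hnorm : ∀ n (t : ℝ), ‖f n t‖ = ‖a n‖ := by
    intro n t
    have : ((n - m : ℤ) : ℂ) * q * Complex.I * t =
        (((n - m : ℤ) * (2 * Real.pi / T) * t : ℝ) : ℂ) * Complex.I := by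
      rw [hq]; push_cast; ring
    simp only [f, ContinuousMap.coe_mk]
    rw [this, norm_mul, Complex.norm_exp_ofReal_mul_I, mul_one]
  have hs : HasSum (fun n => ∫ t in (0 : ℝ)..T, f n t) (∫ t in (0 : ℝ)..T, ∑' n, f n t) := by
    refine intervalIntegral.hasSum_integral_of_dominated_convergence (fun n _ => ‖a n‖)
      (fun n => (f n).continuous.aestronglyMeasurable)
      (fun n => Eventually.of_forall fun t _ => (hnorm n t).le)
      (Eventually.of_forall fun _ _ => ha.norm) intervalIntegrable_const
      (Eventually.of_forall fun t _ => ?_)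
    exact (Summable.of_norm_bounded ha.norm fun n => (hnorm n t).le).hasSum
  have h0 : ∫ t in (0 : ℝ)..T, ∑' n, f n t = 0 := by
    have : ∀ t : ℝ, ∑' n, f n t = 0 := by
      intro t
      have h1 : ∀ n, f n t = Complex.exp (-(m : ℂ) * q * Complex.I * t) *
          (a n * Complex.exp ((n : ℂ) * q * Complex.I * t)) := by
        intro n
        simp only [f, ContinuousMap.coe_mk]
        rw [mul_left_comm, ← Complex.exp_add]
        push_cast
        ring_nf
      simp only [h1, tsum_mul_left, h t, mul_zero]
    simp [this]
  have hint : ∀ n, ∫ t in (0 : ℝ)..T, f n t = if n = m then a m * T else 0 := by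
    intro n
    simp only [f, ContinuousMap.coe_mk, intervalIntegral.integral_const_mul]
    split_ifs with hnm
    · simp [hnm]
    · have hc : ((n - m : ℤ) : ℂ) * q * Complex.I ≠ 0 := by
        refine mul_ne_zero (mul_ne_zero ?_ hq0) Complex.I_ne_zero
        exact_mod_cast sub_ne_zero.2 hnm
      rw [integral_exp_mul_complex hc]
      have h2 : ((n - m : ℤ) : ℂ) * q * Complex.I * T =
          ((n - m : ℤ) : ℂ) * (2 * Real.pi * Complex.I) := by
        rw [hq]; push_cast; field_simp
      rw [h2, Complex.exp_int_mul_two_pi_mul_I]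
      simp
  rw [h0] at hs
  have h3 := hs.unique (by
    simpa only [hint] using hasSum_ite_eq m (a m * (T : ℂ)))
  rcases mul_eq_zero.1 h3.symm with h4 | h4
  · exact h4
  · exact absurd h4 hT'

end TrigonometricSeries

section NearZero

lemma tendsto_exp_neg_nhdsGT : Tendsto (fun t : ℝ => Real.exp (-t)) atTop (𝓝[>] 0) :=
  Real.tendsto_exp_atBot_nhdsGT.comp tendsto_neg_atTop_atBot

lemma tendsto_nhdsGT_zero_iff_exp_neg {α : Type*} {f : ℝ → α} {l : Filter α} :
    Tendsto f (𝓝[>] 0) l ↔ Tendsto (fun t => f (Real.exp (-t))) atTop l := by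
  refine ⟨fun h => h.comp tendsto_exp_neg_nhdsGT, fun h => ?_⟩
  have h1 : Tendsto (fun ε : ℝ => -Real.log ε) (𝓝[>] 0) atTop :=
    tendsto_neg_atBot_atTop.comp Real.tendsto_log_nhdsGT_zero
  refine (h.comp h1).congr' ?_
  filter_upwards [self_mem_nhdsWithin] with ε hε
  simp [Real.exp_log (show (0 : ℝ) < ε from hε)]

end NearZero

/-! ### Mellin transforms along a vertical progression. -/

section MellinSums

variable {d Q : ℕ} {D : ℝ} {g : Fin Q → ℝ} {κ : Fin Q → ℕ → ℝ}

/-- A sum of tile Mellin transforms cannot vanish at almost all points of a vertical arithmetic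
progression without vanishing on all of it. -/
lemma infinite_setOf_sum_tileMellin_ne_zero (hg : ∀ q, 0 < g q)
    (hD : ∀ k ∈ Finset.range (d + 1), D - k ≠ 0) (p : ℝ)
    (h0 : ∑ q, tileMellin d (g q) (κ q) (D : ℂ) ≠ 0) :
    {n : ℤ | ∑ q, tileMellin d (g q) (κ q) ((D : ℂ) + (n : ℂ) * (p : ℂ) * Complex.I) ≠ 0}.Infinite
    := by
  intro hfin
  obtain ⟨N, hN⟩ := hfin.bddAbove
  set R := Finset.range (d + 1)
  -- `W` is the common denominator; its factors have real part D - k ≠ 0. Clearing it leaves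
  -- polynomials in `n` times powers (g_q^{ip})^n.
  set W : ℤ → ℂ := fun n => ∏ k ∈ R, (((D : ℂ) - (k : ℂ)) + n * ((p : ℂ) * Complex.I)) with hW
  have hden : ∀ n : ℤ, ∀ k ∈ R, ((D : ℂ) - (k : ℂ)) + n * ((p : ℂ) * Complex.I) ≠ 0 := by
    intro n k hk h
    have := congrArg Complex.re h
    simp at this
    exact hD k hk this
  have hW0 : ∀ n, W n ≠ 0 := fun n => Finset.prod_ne_zero_iff.2 (hden n)
  set a : ℤ → ℂ := fun n =>
    W n * ∑ q, tileMellin d (g q) (κ q) ((D : ℂ) + (n : ℂ) * (p : ℂ) * Complex.I) with ha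
  have harec : IsBackwardRecurrent a := by
    have heq : a = ∑ q, ∑ k ∈ R, (((g q : ℂ) ^ ((D : ℂ) - (k : ℂ)) * ((κ q k : ℝ) : ℂ)) •
        fun n : ℤ => (∏ l ∈ R.erase k, (((D : ℂ) - (l : ℂ)) + n * ((p : ℂ) * Complex.I))) *
          ((g q : ℂ) ^ ((p : ℂ) * Complex.I)) ^ n) := by
      ext n
      simp only [ha, tileMellin, Finset.sum_apply, Pi.smul_apply, smul_eq_mul, Finset.mul_sum]
      refine Finset.sum_congr rfl fun q _ => Finset.sum_congr rfl fun k hk => ?_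
      have hgq : (g q : ℂ) ≠ 0 := by exact_mod_cast (hg q).ne'
      have e1 : (D : ℂ) + (n : ℂ) * (p : ℂ) * Complex.I - k =
          ((D : ℂ) - (k : ℂ)) + n * ((p : ℂ) * Complex.I) := by ring
      rw [e1, Complex.cpow_add _ _ hgq, Complex.cpow_int_mul]
      simp only [hW]
      rw [← Finset.mul_prod_erase R _ hk]
      have hX := hden n k hk
      generalize ((D : ℂ) - (k : ℂ)) + n * ((p : ℂ) * Complex.I) = X at hX ⊢
      generalize ∏ l ∈ R.erase k, (((D : ℂ) - (l : ℂ)) + n * ((p : ℂ) * Complex.I)) = Y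
      field_simp
    rw [heq]
    refine IsBackwardRecurrent.sum fun q _ => IsBackwardRecurrent.sum fun k _ => ?_
    have hgq : (g q : ℂ) ≠ 0 := by exact_mod_cast (hg q).ne'
    exact ((isBackwardRecurrent_zpow (by
      rw [Complex.cpow_def_of_ne_zero hgq]; exact Complex.exp_ne_zero _)).prod_affine_mul
        (R.erase k) (fun l => (D : ℂ) - (l : ℂ)) fun _ => (p : ℂ) * Complex.I).smul _
  have hzero := harec.eq_zero (N := N + 1) (fun n hn => by
    have : ∑ q, tileMellin d (g q) (κ q) ((D : ℂ) + (n : ℂ) * (p : ℂ) * Complex.I) = 0 := by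
      by_contra hne
      have := hN hne
      omega
    simp only [ha, this, mul_zero]) 0
  rcases mul_eq_zero.1 hzero with h | h
  · exact hW0 0 h
  · exact h0 (by simpa using h)

lemma summable_tileMellin {g : ℝ} {κ : ℕ → ℝ} (hg : 0 < g)
    (hκ : ∑ k ∈ Finset.range (d + 1), κ k * g ^ (d - k) = 0) {p : ℝ} (hp : 0 < p) :
    Summable fun n : ℤ => tileMellin d g κ ((D : ℂ) + (n : ℂ) * (p : ℂ) * Complex.I) := by
  set K := ∑ k ∈ Finset.range d, g ^ (D - k) * |κ k| * (d - k)
  have hs : Summable fun n : ℤ => K / p ^ 2 * (1 / (n : ℝ) ^ 2) :=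
    (Real.summable_one_div_int_pow.2 one_lt_two).mul_left _
  refine Summable.of_norm_bounded_eventually hs ?_
  have hev : ∀ᶠ n : ℤ in cofinite, n ≠ 0 := by
    rw [eventually_cofinite]
    simp
  filter_upwards [hev] with n hn
  have hn' : (n : ℝ) ≠ 0 := by exact_mod_cast hn
  have him : ((D : ℂ) + (n : ℂ) * (p : ℂ) * Complex.I).im = n * p := by simp
  have h := norm_tileMellin_le (D := D) hg hκ (s := (D : ℂ) + (n : ℂ) * (p : ℂ) * Complex.I)
    (by simp) (by rw [him]; exact mul_ne_zero hn' hp.ne')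
  rw [him] at h
  refine h.trans (le_of_eq ?_)
  field_simp
  rfl

lemma continuousAt_tileMellin {g : ℝ} {κ : ℕ → ℝ} (hg : 0 < g) {s : ℂ}
    (hs : ∀ k ∈ Finset.range (d + 1), s - k ≠ 0) : ContinuousAt (tileMellin d g κ) s := by
  have hg' : (g : ℂ) ≠ 0 := by exact_mod_cast hg.ne'
  unfold tileMellin
  refine tendsto_finsetSum _ fun k hk => ?_
  refine ContinuousAt.mul (ContinuousAt.div ?_ ?_ (hs k hk)) continuousAt_const
  · exact (continuousAt_const_cpow hg').comp (f := fun s : ℂ => s - k)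
      (continuousAt_id.sub continuousAt_const)
  · exact continuousAt_id.sub continuousAt_const

end MellinSums

/-! ### The normalised tube volume of the tiling. -/

namespace SelfSimilarSystem

variable {d J Q : ℕ} {Φ : SelfSimilarSystem d J} {F : Set (EuclideanSpace ℝ (Fin d))}
  {G : Fin Q → Set (EuclideanSpace ℝ (Fin d))} {κ : Fin Q → ℕ → ℝ} {D : ℝ}

lemma tubeVolume_exp_neg_mul [Nontrivial (EuclideanSpace ℝ (Fin d))]
    {A : Set (EuclideanSpace ℝ (Fin d))} (hA : IsOpen A) (hb : Bornology.IsBounded A)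
    (hne : A.Nonempty) {κ : ℕ → ℝ} (hκ : IsMonophase A κ) (t : ℝ) :
    tubeVolume A (Real.exp (-t)) * Real.exp ((d - D) * t) =
      tileProfile d D (inradius A) κ t := by
  have hg := inradius_pos hA hb hne
  unfold tileProfile
  split_ifs with ht
  · rw [tubeVolume_of_inradius_le hA hb, hκ.2, neg_neg]
    rw [← Real.log_le_iff_le_exp hg]
    linarith
  · have hlt : Real.exp (-t) < inradius A := by
      rw [← Real.lt_log_iff_exp_lt hg]
      linarith
    rw [hκ.1 _ (Real.exp_pos _) hlt, Finset.sum_mul]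
    refine Finset.sum_congr rfl fun k hk => ?_
    have hk' : k ≤ d := (Finset.mem_range.1 hk).le
    rw [mul_assoc, ← Real.exp_nat_mul, ← Real.exp_add, Nat.cast_sub hk']
    ring_nf

variable (Φ G D) in
/-- The normalised tube volume `ε ^ (D - d) V(T, ε)` of the tiling at `ε = exp (-t)`. -/
noncomputable def normalizedTube (t : ℝ) : ℝ :=
  tubeVolume (Φ.tiling G) (Real.exp (-t)) * Real.exp ((d - D) * t)

variable (G κ D) in
/-- The normalised inner tube volume of the generators. -/
noncomputable def generatorProfile (t : ℝ) : ℝ :=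
  ∑ q, tileProfile d D (inradius (G q)) (κ q) t

lemma normalizedTube_nonneg (t : ℝ) : 0 ≤ Φ.normalizedTube G D t :=
  mul_nonneg (tubeVolume_nonneg _ _) (Real.exp_pos _).le

lemma normalizedTube_le (hG : Φ.IsGenerators F G) (hF : Φ.IsAttractor F) (t : ℝ) :
    Φ.normalizedTube G D t ≤ (volume (Φ.tiling G)).toReal * Real.exp ((d - D) * t) := by
  refine mul_le_mul_of_nonneg_right ?_ (Real.exp_pos _).le
  exact ENNReal.toReal_mono (isBounded_tiling hG hF).measure_lt_top.ne
    (measure_mono (innerNeighborhood_subset _ _))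

/-- The product is the tube volume itself, monotone in ε. This supplies the slow increase needed in
the nonlattice renewal theorem. -/
lemma antitone_exp_mul_normalizedTube (hG : Φ.IsGenerators F G) (hF : Φ.IsAttractor F) :
    Antitone fun t => Real.exp (-(d - D) * t) * Φ.normalizedTube G D t := by
  have h : (fun t => Real.exp (-(d - D) * t) * Φ.normalizedTube G D t) =
      fun t => tubeVolume (Φ.tiling G) (Real.exp (-t)) := by
    ext t
    rw [normalizedTube, mul_left_comm, ← Real.exp_add,
      show -((d : ℝ) - D) * t + (d - D) * t = 0 by ring, Real.exp_zero, mul_one]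
  rw [h]
  intro s t hst
  exact tubeVolume_mono (isBounded_tiling hG hF) (Real.exp_le_exp.2 (neg_le_neg hst))

lemma normalizedTube_pos [Nontrivial (EuclideanSpace ℝ (Fin d))] (hF : Φ.IsAttractor F)
    (hT : Φ.TilesetCondition F) (hG : Φ.IsGenerators F G)
    (hC : (interior (convexHull ℝ F)).Nonempty) : ∃ t, 0 < Φ.normalizedTube G D t := by
  have hTo := isOpen_tiling hG hF hC
  have hTb := isBounded_tiling hG hF
  have hTn := tiling_nonempty hT hG
  refine ⟨-Real.log (inradius (Φ.tiling G)), mul_pos ?_ (Real.exp_pos _)⟩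
  rw [neg_neg, Real.exp_log (inradius_pos hTo hTb hTn), tubeVolume_of_inradius_le hTo hTb le_rfl]
  exact volume_toReal_pos_of_isOpen hTo hTb hTn

lemma generatorProfile_nonneg [Nontrivial (EuclideanSpace ℝ (Fin d))] (hF : Φ.IsAttractor F)
    (hG : Φ.IsGenerators F G) (hC : (interior (convexHull ℝ F)).Nonempty)
    (hκ : ∀ q, IsMonophase (G q) (κ q)) (t : ℝ) : 0 ≤ generatorProfile G κ D t := by
  refine Finset.sum_nonneg fun q _ => ?_
  rw [← tubeVolume_exp_neg_mul (hG.isOpen hF hC q) (hG.isBounded hF q) (hG.nonempty q) (hκ q)]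
  exact mul_nonneg (tubeVolume_nonneg _ _) (Real.exp_pos _).le

/-- Dividing ε by r_j shifts `t` by `logStep j`, and the normalisation turns the weight r_j^d into
the probability r_j^D. -/
lemma normalizedTube_eq [Nontrivial (EuclideanSpace ℝ (Fin d))] (hF : Φ.IsAttractor F)
    (hT : Φ.TilesetCondition F) (hG : Φ.IsGenerators F G)
    (hC : (interior (convexHull ℝ F)).Nonempty) (hκ : ∀ q, IsMonophase (G q) (κ q)) (t : ℝ) :
    Φ.normalizedTube G D t = generatorProfile G κ D t +
      ∑ j, Φ.ratio j ^ D * Φ.normalizedTube G D (t - Φ.logStep j) := by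
  rw [normalizedTube, tubeVolume_tiling hF hT hG hC, add_mul, Finset.sum_mul, Finset.sum_mul,
    generatorProfile]
  congr 1
  · refine Finset.sum_congr rfl fun q _ => ?_
    exact tubeVolume_exp_neg_mul (hG.isOpen hF hC q) (hG.isBounded hF q) (hG.nonempty q) (hκ q) t
  · refine Finset.sum_congr rfl fun j _ => ?_
    have h1 : Real.exp (-t) / Φ.ratio j = Real.exp (-(t - Φ.logStep j)) := by
      rw [← Φ.exp_neg_logStep, ← Real.exp_sub]
      ring_nf
    have h2 : Φ.ratio j ^ d * Real.exp ((d - D) * t) =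
        Φ.ratio j ^ D * Real.exp ((d - D) * (t - Φ.logStep j)) := by
      rw [← Real.rpow_natCast, ← Φ.exp_neg_logStep, ← Real.exp_mul, ← Real.exp_mul,
        ← Real.exp_add, ← Real.exp_add]
      ring_nf
    rw [h1, normalizedTube, mul_right_comm, h2]
    ring

lemma exists_abs_generatorProfile_le (h1 : (d : ℝ) - 1 < D) (h2 : D < d) :
    ∃ C, ∀ t, |generatorProfile G κ D t| ≤
      C * Real.exp (-min (D - d + 1) (d - D) * |t|) := by
  choose C hC using fun q =>
    exists_abs_tileProfile_le (g := inradius (G q)) (κ := κ q) h1 h2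
  refine ⟨∑ q, C q, fun t => (Finset.abs_sum_le_sum_abs _ _).trans ?_⟩
  rw [Finset.sum_mul]
  exact Finset.sum_le_sum fun q _ => hC q t

lemma tendsto_generatorProfile (h1 : (d : ℝ) - 1 < D) (h2 : D < d) :
    Tendsto (generatorProfile G κ D) atTop (𝓝 0) := by
  obtain ⟨C, hC⟩ := exists_abs_generatorProfile_le (G := G) (κ := κ) h1 h2
  set c := min (D - d + 1) (d - D)
  have hc : 0 < c := lt_min (by linarith) (by linarith)
  have h3 : Tendsto (fun t : ℝ => -c * t) atTop atBot :=
    tendsto_id.const_mul_atTop_of_neg (neg_lt_zero.2 hc)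
  have h4 : Tendsto (fun t : ℝ => C * Real.exp (-c * t)) atTop (𝓝 0) := by
    simpa using (Real.tendsto_exp_atBot.comp h3).const_mul C
  refine squeeze_zero_norm' ?_ h4
  filter_upwards [eventually_ge_atTop (0 : ℝ)] with t ht
  simpa [abs_of_nonneg ht] using hC t

lemma exists_normalizedTube_le [Nontrivial (EuclideanSpace ℝ (Fin d))] (hF : Φ.IsAttractor F)
    (hT : Φ.TilesetCondition F) (hG : Φ.IsGenerators F G)
    (hC : (interior (convexHull ℝ F)).Nonempty) (hκ : ∀ q, IsMonophase (G q) (κ q))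
    (hD : ∑ j, Φ.ratio j ^ D = 1) (h1 : (d : ℝ) - 1 < D) (h2 : D < d) :
    ∃ B, ∀ t, Φ.normalizedTube G D t ≤ B := by
  have := Φ.index_nonempty
  obtain ⟨C, hCb⟩ := exists_abs_generatorProfile_le (G := G) (κ := κ) h1 h2
  have hC0 : 0 ≤ C := by
    have := (abs_nonneg _).trans (hCb 0)
    simpa using this
  refine exists_forall_le_of_renewal (p := fun j => Φ.ratio j ^ D) (τ := Φ.logStep)
    (a := min (D - d + 1) (d - D)) (C := C) (T := 0) (B := (volume (Φ.tiling G)).toReal)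
    (fun j => Real.rpow_pos_of_pos (Φ.ratio_pos j) D) hD Φ.logStep_pos
    (lt_min (by linarith) (by linarith)) hC0 (fun t ht => ?_) fun t ht => ?_
  · rw [normalizedTube_eq hF hT hG hC hκ]
    have := (le_abs_self _).trans (hCb t)
    rw [abs_of_nonneg ht] at this
    linarith
  · refine (normalizedTube_le hG hF t).trans ?_
    have h3 : Real.exp ((d - D) * t) ≤ 1 := Real.exp_le_one_iff.2 (by nlinarith)
    exact mul_le_of_le_one_right ENNReal.toReal_nonneg h3

lemma tendsto_normalizedTube_atBot (hG : Φ.IsGenerators F G) (hF : Φ.IsAttractor F)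
    (h2 : D < d) : Tendsto (Φ.normalizedTube G D) atBot (𝓝 0) := by
  have h3 : Tendsto (fun t : ℝ => (d - D) * t) atBot atBot :=
    tendsto_id.const_mul_atBot (by linarith)
  refine squeeze_zero normalizedTube_nonneg (normalizedTube_le hG hF) ?_
  simpa using (Real.tendsto_exp_atBot.comp h3).const_mul (volume (Φ.tiling G)).toReal

lemma normalizedTube_eq_tubeVolume_mul_rpow (t : ℝ) :
    tubeVolume (Φ.tiling G) (Real.exp (-t)) * Real.exp (-t) ^ (-((d : ℝ) - D)) =
      Φ.normalizedTube G D t := by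
  rw [normalizedTube, ← Real.exp_mul]
  ring_nf

lemma minkowskiMeasurable_tiling_iff :
    MinkowskiMeasurable (Φ.tiling G) D ↔
      ∃ M, 0 < M ∧ Tendsto (Φ.normalizedTube G D) atTop (𝓝 M) := by
  refine exists_congr fun M => and_congr_right fun _ => ?_
  rw [tendsto_nhdsGT_zero_iff_exp_neg]
  simp only [normalizedTube_eq_tubeVolume_mul_rpow]

/-- In the nonlattice case the tiling is Minkowski measurable. -/
lemma minkowskiMeasurable_of_not_isLattice [Nontrivial (EuclideanSpace ℝ (Fin d))]
    (hF : Φ.IsAttractor F) (hT : Φ.TilesetCondition F) (hG : Φ.IsGenerators F G)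
    (hC : (interior (convexHull ℝ F)).Nonempty) (hκ : ∀ q, IsMonophase (G q) (κ q))
    (hD : ∑ j, Φ.ratio j ^ D = 1) (h1 : (d : ℝ) - 1 < D) (h2 : D < d) (h : ¬ Φ.IsLattice) :
    MinkowskiMeasurable (Φ.tiling G) D := by
  have := Φ.index_nonempty
  rw [minkowskiMeasurable_tiling_iff]
  obtain ⟨B, hB⟩ := exists_normalizedTube_le hF hT hG hC hκ hD h1 h2
  have hren := normalizedTube_eq (D := D) hF hT hG hC hκ
  refine exists_tendsto_of_nonlattice_renewal (p := fun j => Φ.ratio j ^ D) (τ := Φ.logStep)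
    (b := d - D) (fun j => Real.rpow_pos_of_pos (Φ.ratio_pos j) D) hD Φ.logStep_pos
    (Φ.dense_stepGroup h) (by linarith) normalizedTube_nonneg hB (fun t => ?_) ?_
    (antitone_exp_mul_normalizedTube hG hF) (normalizedTube_pos hF hT hG hC)
  · rw [hren t]
    linarith [generatorProfile_nonneg (D := D) hF hG hC hκ t]
  · refine (tendsto_generatorProfile (G := G) (κ := κ) h1 h2).congr fun t => ?_
    rw [hren t, add_sub_cancel_right]

/-- The coefficient of index `n` of the leading oscillatory part in the lattice case, for the
oscillatory period `p`. -/
noncomputable def residueCoeff (Φ : SelfSimilarSystem d J)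
    (G : Fin Q → Set (EuclideanSpace ℝ (Fin d))) (κ : Fin Q → ℕ → ℝ) (D p : ℝ) (n : ℤ) : ℂ :=
  (Φ.meanStep D : ℂ)⁻¹ *
    ∑ q, tileMellin d (inradius (G q)) (κ q) ((D : ℂ) + (n : ℂ) * (p : ℂ) * Complex.I)

section Lattice

variable {T : ℝ}

/-- The periodization of the profile of the generators is the sum of the Fourier series formed
with the residues. -/
lemma tsum_generatorProfile_eq (h1 : (d : ℝ) - 1 < D) (h2 : D < d)
    (hg : ∀ q, 0 < inradius (G q))
    (hsum : ∀ q, ∑ k ∈ Finset.range (d + 1), κ q k * inradius (G q) ^ (d - k) = 0)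
    (hT : 0 < T) (t : ℝ) :
    (((Φ.meanStep D / T)⁻¹ * ∑' n : ℤ, generatorProfile G κ D (t + n * T) : ℝ) : ℂ) =
      ∑' n : ℤ, residueCoeff Φ G κ D (2 * Real.pi / T) n *
        Complex.exp ((n : ℂ) * ((2 * Real.pi / T : ℝ) : ℂ) * Complex.I * t) := by
  have hc : 0 < min (D - d + 1) (d - D) := lt_min (by linarith) (by linarith)
  have hp : 0 < 2 * Real.pi / T := by positivity
  have hq : ∀ q, ((∑' n : ℤ, tileProfile d D (inradius (G q)) (κ q) (t + n * T) : ℝ) : ℂ) =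
      (T : ℂ)⁻¹ * ∑' n : ℤ, tileMellin d (inradius (G q)) (κ q)
        ((D : ℂ) + (n : ℂ) * ((2 * Real.pi / T : ℝ) : ℂ) * Complex.I) *
        Complex.exp ((n : ℂ) * ((2 * Real.pi / T : ℝ) : ℂ) * Complex.I * t) := by
    intro q
    obtain ⟨C, hC⟩ := exists_abs_tileProfile_le (g := inradius (G q)) (κ := κ q) h1 h2
    refine tsum_eq_of_abs_le_exp (continuous_tileProfile (hg q) (hsum q)) hc hT hC (fun n => ?_)
      (summable_tileMellin (hg q) (hsum q) hp) t
    exact integral_exp_mul_tileProfile (hg q) h1 h2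
      (by simp [-Complex.ofReal_div, -Complex.ofReal_mul])
  have hs1 : ∀ q, Summable fun n : ℤ => tileProfile d D (inradius (G q)) (κ q) (t + n * T) := by
    intro q
    obtain ⟨C, hC⟩ := exists_abs_tileProfile_le (g := inradius (G q)) (κ := κ q) h1 h2
    exact summable_of_abs_le_exp hc hT hC t
  have hs2 : ∀ q, Summable fun n : ℤ => tileMellin d (inradius (G q)) (κ q)
        ((D : ℂ) + (n : ℂ) * ((2 * Real.pi / T : ℝ) : ℂ) * Complex.I) *
        Complex.exp ((n : ℂ) * ((2 * Real.pi / T : ℝ) : ℂ) * Complex.I * t) := by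
    intro q
    refine Summable.of_norm_bounded
      (summable_tileMellin (D := D) (hg q) (hsum q) hp).norm fun n => ?_
    have : (n : ℂ) * ((2 * Real.pi / T : ℝ) : ℂ) * Complex.I * t =
        ((n * (2 * Real.pi / T) * t : ℝ) : ℂ) * Complex.I := by push_cast; ring
    rw [norm_mul, this, Complex.norm_exp_ofReal_mul_I, mul_one]
  simp only [generatorProfile, residueCoeff]
  rw [Summable.tsum_finsetSum fun q _ => hs1 q]
  simp only [mul_assoc (Φ.meanStep D : ℂ)⁻¹, Finset.sum_mul, tsum_mul_left]
  rw [Summable.tsum_finsetSum fun q _ => hs2 q]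
  rw [Complex.ofReal_mul, Complex.ofReal_sum]
  simp only [hq]
  rw [← Finset.mul_sum, ← mul_assoc]
  congr 1
  have hT' : (T : ℂ) ≠ 0 := by exact_mod_cast hT.ne'
  have hm' : (Φ.meanStep D : ℂ) ≠ 0 := by exact_mod_cast (Φ.meanStep_pos D).ne'
  push_cast
  field_simp

lemma summable_residueCoeff (hg : ∀ q, 0 < inradius (G q))
    (hsum : ∀ q, ∑ k ∈ Finset.range (d + 1), κ q k * inradius (G q) ^ (d - k) = 0) {p : ℝ}
    (hp : 0 < p) : Summable (residueCoeff Φ G κ D p) :=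
  (summable_sum fun q _ => summable_tileMellin (hg q) (hsum q) hp).mul_left _

/-- At index 0 the coefficient is a nonzero multiple of the sum assumed not to vanish; the
recurrence argument spreads this to infinitely many indices. -/
lemma infinite_setOf_residueCoeff_ne_zero (h1 : (d : ℝ) - 1 < D) (h2 : D < d)
    (hg : ∀ q, 0 < inradius (G q))
    (hsum : ∀ q, ∑ k ∈ Finset.range (d + 1), κ q k * inradius (G q) ^ (d - k) = 0)
    (hne : ∑ q, ∑ k ∈ Finset.range d,
        inradius (G q) ^ (D - (k : ℝ)) / (D - (k : ℝ)) * ((d : ℝ) - (k : ℝ)) * κ q k ≠ 0)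
    (p : ℝ) : {n : ℤ | residueCoeff Φ G κ D p n ≠ 0}.Infinite := by
  have h0 : ∑ q, tileMellin d (inradius (G q)) (κ q) (D : ℂ) ≠ 0 := by
    simp only [fun q => tileMellin_ofReal (hg q) (hsum q) h1 h2]
    rw [← Complex.ofReal_sum, ← Finset.mul_sum]
    exact_mod_cast mul_ne_zero (inv_ne_zero (by linarith)) hne
  have hD : ∀ k ∈ Finset.range (d + 1), D - (k : ℝ) ≠ 0 := by
    intro k hk
    rcases Nat.lt_succ_iff_lt_or_eq.1 (Finset.mem_range.1 hk) with h | rfl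
    · have := sub_one_le_of_mem_range (D := D) (Finset.mem_range.2 h)
      linarith
    · linarith
  refine (infinite_setOf_sum_tileMellin_ne_zero hg hD p h0).mono fun n hn => ?_
  exact mul_ne_zero (inv_ne_zero (by exact_mod_cast (Φ.meanStep_pos D).ne')) hn

/-- The tube volume in the lattice case. -/
lemma tendsto_normalizedTube_sub [Nontrivial (EuclideanSpace ℝ (Fin d))]
    (hF : Φ.IsAttractor F) (hTc : Φ.TilesetCondition F) (hG : Φ.IsGenerators F G)
    (hC : (interior (convexHull ℝ F)).Nonempty) (hκ : ∀ q, IsMonophase (G q) (κ q))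
    (hD : ∑ j, Φ.ratio j ^ D = 1) (h1 : (d : ℝ) - 1 < D) (h2 : D < d)
    (hg : ∀ q, 0 < inradius (G q))
    (hsum : ∀ q, ∑ k ∈ Finset.range (d + 1), κ q k * inradius (G q) ^ (d - k) = 0)
    (hT : 0 < T) (hgrp : Φ.stepGroup = AddSubgroup.zmultiples T) :
    Tendsto (fun t => Φ.normalizedTube G D t -
      (Φ.meanStep D / T)⁻¹ * ∑' n : ℤ, generatorProfile G κ D (t + n * T)) atTop (𝓝 0) := by
  have := Φ.index_nonempty
  have hstep : ∀ j, ∃ k : ℕ, 0 < k ∧ Φ.logStep j = k * T := by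
    intro j
    have := Φ.logStep_mem_stepGroup j
    rw [hgrp] at this
    obtain ⟨n, hn⟩ := this
    simp only [zsmul_eq_mul] at hn
    have hpos : (0 : ℝ) < n := by
      have := Φ.logStep_pos j
      rw [← hn] at this
      exact pos_of_mul_pos_left this hT.le
    have hpos' : 0 < n := by exact_mod_cast hpos
    obtain ⟨k, rfl⟩ := Int.eq_ofNat_of_zero_le hpos'.le
    exact ⟨k, by exact_mod_cast hpos', by rw [← hn]; simp⟩
  choose k hk0 hk using hstep
  obtain ⟨B, hB⟩ := exists_normalizedTube_le hF hTc hG hC hκ hD h1 h2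
  obtain ⟨C, hCb⟩ := exists_abs_generatorProfile_le (G := G) (κ := κ) h1 h2
  have hm : Φ.meanStep D / T = ∑ j, Φ.ratio j ^ D * k j := by
    rw [meanStep, Finset.sum_div]
    refine Finset.sum_congr rfl fun j _ => ?_
    rw [hk]
    field_simp
  -- The periodization is bounded by the absolute sum of its Fourier coefficients.
  have hbd : ∀ t, |∑' n : ℤ, generatorProfile G κ D (t + n * T)| ≤
      (Φ.meanStep D / T) * ∑' n : ℤ, ‖residueCoeff Φ G κ D (2 * Real.pi / T) n‖ := by
    intro t
    have hm0 : 0 < Φ.meanStep D / T := div_pos (Φ.meanStep_pos D) hT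
    have h3 := tsum_generatorProfile_eq (Φ := Φ) h1 h2 hg hsum hT t
    have h4 := tsum_of_norm_bounded
      (summable_residueCoeff (Φ := Φ) (D := D) hg hsum
        (show 0 < 2 * Real.pi / T by positivity)).norm.hasSum
      (f := fun n : ℤ => residueCoeff Φ G κ D (2 * Real.pi / T) n *
        Complex.exp ((n : ℂ) * ((2 * Real.pi / T : ℝ) : ℂ) * Complex.I * t)) (fun n => by
        have : (n : ℂ) * ((2 * Real.pi / T : ℝ) : ℂ) * Complex.I * t =
          ((n * (2 * Real.pi / T) * t : ℝ) : ℂ) * Complex.I := by push_cast; ring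
        rw [norm_mul, this, Complex.norm_exp_ofReal_mul_I, mul_one])
    rw [← h3, Complex.norm_real, Real.norm_eq_abs, abs_mul, abs_of_pos (inv_pos.2 hm0),
      inv_mul_le_iff₀ hm0] at h4
    exact h4
  have := tendsto_sub_periodization (p := fun j => Φ.ratio j ^ D) (τ := Φ.logStep)
    (z := Φ.normalizedTube G D) (h := generatorProfile G κ D) (B := B)
    (c := min (D - d + 1) (d - D))
    (fun j => Real.rpow_pos_of_pos (Φ.ratio_pos j) D) hD hT hk0 hk
    (by
      change T ∈ Φ.stepGroup
      rw [hgrp]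
      exact AddSubgroup.mem_zmultiples T)
    (lt_min (by linarith) (by linarith)) hCb
    (fun t => by rw [abs_of_nonneg (normalizedTube_nonneg t)]; exact hB t)
    (normalizedTube_eq hF hTc hG hC hκ) (tendsto_normalizedTube_atBot hG hF h2) hbd
  rwa [← hm] at this

/-- In the lattice case the tiling is not Minkowski measurable. -/
lemma not_minkowskiMeasurable_of_tendsto_sub (h1 : (d : ℝ) - 1 < D) (h2 : D < d)
    (hg : ∀ q, 0 < inradius (G q))
    (hsum : ∀ q, ∑ k ∈ Finset.range (d + 1), κ q k * inradius (G q) ^ (d - k) = 0)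
    (hne : ∑ q, ∑ k ∈ Finset.range d,
        inradius (G q) ^ (D - (k : ℝ)) / (D - (k : ℝ)) * ((d : ℝ) - (k : ℝ)) * κ q k ≠ 0)
    (hT : 0 < T)
    (hlim : Tendsto (fun t => Φ.normalizedTube G D t -
      (Φ.meanStep D / T)⁻¹ * ∑' n : ℤ, generatorProfile G κ D (t + n * T)) atTop (𝓝 0)) :
    ¬ MinkowskiMeasurable (Φ.tiling G) D := by
  rw [minkowskiMeasurable_tiling_iff]
  rintro ⟨M, -, hM⟩
  set S : ℝ → ℝ := fun t =>
    (Φ.meanStep D / T)⁻¹ * ∑' n : ℤ, generatorProfile G κ D (t + n * T) with hS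
  have hSlim : Tendsto S atTop (𝓝 M) := by
    have h3 := hM.sub hlim
    rw [sub_zero] at h3
    exact h3.congr fun t => sub_sub_cancel _ _
  have hper : ∀ t, S (t + T) = S t := by
    intro t
    simp only [hS]
    congr 1
    rw [← (Equiv.addRight (1 : ℤ)).tsum_eq (fun n : ℤ => generatorProfile G κ D (t + n * T))]
    refine tsum_congr fun n => ?_
    congr 1
    simp only [Equiv.coe_addRight]
    push_cast
    ring
  -- A periodic function with a limit at infinity is constant.
  have hconst : ∀ t, S t = M := by
    intro t
    have h3 : ∀ n : ℕ, S (t + n * T) = S t := by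
      intro n
      induction n with
      | zero => simp
      | succ n ih =>
        rw [← ih, ← hper (t + n * T)]
        push_cast
        ring_nf
    have h4 : Tendsto (fun n : ℕ => t + n * T) atTop atTop :=
      tendsto_atTop_add_const_left _ t (tendsto_natCast_atTop_atTop.atTop_mul_const hT)
    have h5 := hSlim.comp h4
    refine tendsto_nhds_unique (tendsto_const_nhds.congr fun n => ?_) h5
    exact (h3 n).symm
  set c := residueCoeff Φ G κ D (2 * Real.pi / T) with hcdef
  have hcs : Summable c := summable_residueCoeff hg hsum (by positivity)
  set a : ℤ → ℂ := fun n => c n - if n = 0 then (M : ℂ) else 0 with ha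
  have hdelta : HasSum (fun n : ℤ => if n = 0 then (M : ℂ) else 0) M := hasSum_ite_eq 0 (M : ℂ)
  have has : Summable a := hcs.sub hdelta.summable
  have hzero : ∀ n, a n = 0 := by
    refine eq_zero_of_tsum_exp_eq_zero has hT fun t => ?_
    have h3 := tsum_generatorProfile_eq (Φ := Φ) h1 h2 hg hsum hT t
    have h4 : (S t : ℂ) = _ := h3
    rw [hconst t] at h4
    have h5 : ∀ n : ℤ, a n *
        Complex.exp ((n : ℂ) * ((2 * Real.pi / T : ℝ) : ℂ) * Complex.I * t) =
        c n * Complex.exp ((n : ℂ) * ((2 * Real.pi / T : ℝ) : ℂ) * Complex.I * t) -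
          if n = 0 then (M : ℂ) else 0 := by
      intro n
      simp only [ha, sub_mul]
      congr 1
      split_ifs with hn
      · simp [hn]
      · simp
    have h6 : Summable fun n : ℤ => c n *
        Complex.exp ((n : ℂ) * ((2 * Real.pi / T : ℝ) : ℂ) * Complex.I * t) := by
      refine Summable.of_norm_bounded hcs.norm fun n => ?_
      have : (n : ℂ) * ((2 * Real.pi / T : ℝ) : ℂ) * Complex.I * t =
          ((n * (2 * Real.pi / T) * t : ℝ) : ℂ) * Complex.I := by push_cast; ring
      rw [norm_mul, this, Complex.norm_exp_ofReal_mul_I, mul_one]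
    simp only [h5]
    rw [h6.tsum_sub hdelta.summable, hdelta.tsum_eq, ← h4, sub_self]
  refine infinite_setOf_residueCoeff_ne_zero (Φ := Φ) h1 h2 hg hsum hne (2 * Real.pi / T)
    ((Set.finite_singleton (0 : ℤ)).subset fun n hn => ?_)
  by_contra hn0
  have h3 := hzero n
  simp only [ha] at h3
  rw [if_neg (by simpa using hn0), sub_zero] at h3
  exact hn h3

/-- The residues of the tubular zeta function on the line `re s = D`. -/
lemma IsScalingZeta.tendsto_tubularZeta {ζ : ℂ → ℂ} (hζ : Φ.IsScalingZeta ζ)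
    (hD : ∑ j, Φ.ratio j ^ D = 1) (h1 : (d : ℝ) - 1 < D) (h2 : D < d)
    (hg : ∀ q, 0 < inradius (G q)) {p : ℝ} {n : ℤ}
    (hω : Φ.dirichletPoly ((D : ℂ) + (n : ℂ) * (p : ℂ) * Complex.I) = 1) {ε : ℝ} (hε : 0 < ε) :
    Tendsto (fun s : ℂ => (s - ((D : ℂ) + (n : ℂ) * (p : ℂ) * Complex.I)) *
        tubularZeta G κ ζ ε s) (𝓝[≠] ((D : ℂ) + (n : ℂ) * (p : ℂ) * Complex.I))
      (𝓝 (residueCoeff Φ G κ D p n *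
        (ε : ℂ) ^ ((d : ℂ) - ((D : ℂ) + (n : ℂ) * (p : ℂ) * Complex.I)))) := by
  set ω : ℂ := (D : ℂ) + (n : ℂ) * (p : ℂ) * Complex.I with hωdef
  have hre : ω.re = D := by simp [hωdef]
  have hε' : (ε : ℂ) ≠ 0 := by exact_mod_cast hε.ne'
  -- Since d - 1 < D < d, no integer 0, …, d lies on the line, so the Mellin factor is regular at
  -- `ω` and only `ζ` contributes a pole.
  have hne : ∀ k ∈ Finset.range (d + 1), ω - k ≠ 0 := by
    intro k hk h
    have h3 := congrArg Complex.re h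
    simp only [Complex.sub_re, hre, Complex.natCast_re, Complex.zero_re] at h3
    rcases Nat.lt_succ_iff_lt_or_eq.1 (Finset.mem_range.1 hk) with h | rfl
    · have := sub_one_le_of_mem_range (D := D) (Finset.mem_range.2 h)
      linarith
    · linarith
  have hres := hζ.tendsto_residue hD hre hω
  have hpow : Tendsto (fun s : ℂ => (ε : ℂ) ^ ((d : ℂ) - s)) (𝓝[≠] ω)
      (𝓝 ((ε : ℂ) ^ ((d : ℂ) - ω))) := by
    have : ContinuousAt (fun s : ℂ => (ε : ℂ) ^ ((d : ℂ) - s)) ω :=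
      (continuousAt_const_cpow hε').comp (f := fun s : ℂ => (d : ℂ) - s)
        (continuousAt_const.sub continuousAt_id)
    exact this.tendsto.mono_left nhdsWithin_le_nhds
  have hmel : Tendsto (fun s : ℂ => ∑ q, tileMellin d (inradius (G q)) (κ q) s) (𝓝[≠] ω)
      (𝓝 (∑ q, tileMellin d (inradius (G q)) (κ q) ω)) :=
    (tendsto_finsetSum _ fun q _ => (continuousAt_tileMellin (hg q) hne).tendsto).mono_left
      nhdsWithin_le_nhds
  have hall := (hres.mul hmel).mul hpow
  refine hall.congr fun s => ?_
  have : tubularZeta G κ ζ ε s = (ε : ℂ) ^ ((d : ℂ) - s) * ζ s *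
      ∑ q, tileMellin d (inradius (G q)) (κ q) s := rfl
  rw [this]
  ring

end Lattice

end SelfSimilarSystem

/-! ### Conclusion. -/

open SelfSimilarSystem

theorem corollary8p3 {d J Q : ℕ} (Φ : SelfSimilarSystem d J)
    (F : Set (EuclideanSpace ℝ (Fin d))) (hF : Φ.IsAttractor F)
    (hT : Φ.TilesetCondition F)
    (G : Fin Q → Set (EuclideanSpace ℝ (Fin d))) (hG : Φ.IsGenerators F G)
    (κ : Fin Q → ℕ → ℝ) (hκ : ∀ q, IsMonophase (G q) (κ q))
    (D : ℝ) (hD : ∑ j, Φ.ratio j ^ D = 1)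
    (ζ : ℂ → ℂ) (hζ : Φ.IsScalingZeta ζ) :
    -- under the mild conditions on the residues: measurable iff nonlattice, and in the lattice
    -- case infinitely many oscillatory terms of leading order appear in the tube volume
    ((d : ℝ) - 1 < D →
      ∑ q, ∑ k ∈ Finset.range d,
        inradius (G q) ^ (D - (k : ℝ)) / (D - (k : ℝ)) * ((d : ℝ) - (k : ℝ)) * κ q k ≠ 0 →
      (MinkowskiMeasurable (Φ.tiling G) D ↔ ¬ Φ.IsLattice) ∧
      (Φ.IsLattice → ∃ (p : ℝ) (c : ℤ → ℂ), 0 < p ∧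
        complexDimensions d ζ ∩ {ω | ω.re = D}
          = Set.range (fun n : ℤ => (D : ℂ) + (n : ℂ) * (p : ℂ) * Complex.I) ∧
        (∀ n : ℤ, ∀ ε : ℝ, 0 < ε →
          Tendsto
            (fun s : ℂ => (s - ((D : ℂ) + (n : ℂ) * (p : ℂ) * Complex.I)) *
              tubularZeta G κ ζ ε s)
            (𝓝[≠] ((D : ℂ) + (n : ℂ) * (p : ℂ) * Complex.I))
            (𝓝 (c n * (ε : ℂ) ^ ((d : ℂ) - ((D : ℂ) + (n : ℂ) * (p : ℂ) * Complex.I))))) ∧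
        {n : ℤ | c n ≠ 0}.Infinite ∧
        Summable c ∧
        Tendsto
          (fun ε : ℝ => ((tubeVolume (Φ.tiling G) ε * ε ^ (-((d : ℝ) - D)) : ℝ) : ℂ) -
            ∑' n : ℤ, c n * (ε : ℂ) ^ (-((n : ℂ) * (p : ℂ) * Complex.I)))
          (𝓝[>] 0) (𝓝 0))) ∧
    -- lattice case: infinitely many complex dimensions on the line, all of them simple
    (Φ.IsLattice →
      (complexDimensions d ζ ∩ {ω | ω.re = D}).Infinite ∧
      ∀ ω ∈ complexDimensions d ζ, ω.re = D → meromorphicOrderAt ζ ω = -1) ∧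
    -- nonlattice case: `D` is the only complex dimension on the line, and it is simple
    (¬ Φ.IsLattice →
      complexDimensions d ζ ∩ {ω | ω.re = D} = {(D : ℂ)} ∧
      meromorphicOrderAt ζ (D : ℂ) = -1) := by
  refine ⟨fun hdD hne => ?_, fun hL => ⟨infinite_complexDimensions_inter hζ hD hL,
    fun ω hω hre => hζ.meromorphicOrderAt_eq_neg_one hD hre
      ((mem_complexDimensions_iff hζ hD hre).1 hω)⟩,
    fun hN => ⟨complexDimensions_inter_of_not_isLattice hζ hD hN,
      hζ.meromorphicOrderAt_eq_neg_one hD (Complex.ofReal_re D) (Φ.dirichletPoly_ofReal hD)⟩⟩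
  have hd : 0 < d := by
    rcases Nat.eq_zero_or_pos d with rfl | h
    · simp at hne
    · exact h
  have : Nonempty (Fin d) := ⟨⟨0, hd⟩⟩
  -- Otherwise no generator contains a ball, every inradius is the default value 0 of an empty
  -- supremum, and the positive powers 0^(D - k) annihilate the sum assumed nonzero.
  have hC : (interior (convexHull ℝ F)).Nonempty := by
    by_contra hcon
    refine hne (Finset.sum_eq_zero fun q _ => Finset.sum_eq_zero fun k hk => ?_)
    have h0 : inradius (G q) = 0 := by
      by_contra h
      exact hcon (interior_nonempty_of_inradius_ne_zero hG h)
    have hk' := sub_one_le_of_mem_range (D := D) hk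
    rw [h0, Real.zero_rpow (by linarith)]
    simp
  have h2 : D < d := dimension_lt hF hT hG hC hD
  have hg : ∀ q, 0 < inradius (G q) := fun q =>
    inradius_pos (hG.isOpen hF hC q) (hG.isBounded hF q) (hG.nonempty q)
  have hsum : ∀ q, ∑ k ∈ Finset.range (d + 1), κ q k * inradius (G q) ^ (d - k) = 0 := fun q =>
    (hκ q).sum_eq_zero (hG.isOpen hF hC q) (hG.isBounded hF q) (hG.nonempty q)
  refine ⟨⟨fun hM hL => ?_, minkowskiMeasurable_of_not_isLattice hF hT hG hC hκ hD hdD h2⟩,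
    fun hL => ?_⟩
  all_goals obtain ⟨T, hT0, hgrp⟩ := hL.exists_stepGroup_eq
  all_goals have hlim := tendsto_normalizedTube_sub hF hT hG hC hκ hD hdD h2 hg hsum hT0 hgrp
  · exact not_minkowskiMeasurable_of_tendsto_sub hdD h2 hg hsum hne hT0 hlim hM
  · have hp : 0 < 2 * Real.pi / T := by positivity
    refine ⟨2 * Real.pi / T, residueCoeff Φ G κ D (2 * Real.pi / T), hp,
      complexDimensions_inter_of_stepGroup hζ hD hT0 hgrp, fun n ε hε => ?_,
      infinite_setOf_residueCoeff_ne_zero hdD h2 hg hsum hne _,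
      summable_residueCoeff hg hsum hp, ?_⟩
    · exact hζ.tendsto_tubularZeta hD hdD h2 hg
        ((Φ.dirichletPoly_eq_one_iff_of_stepGroup hD hT0 hgrp
          (by simp [-Complex.ofReal_div, -Complex.ofReal_mul])).2 ⟨n, rfl⟩) hε
    · rw [tendsto_nhdsGT_zero_iff_exp_neg]
      have h3 := (Complex.continuous_ofReal.tendsto 0).comp hlim
      rw [Complex.ofReal_zero] at h3
      refine h3.congr fun t => ?_
      rw [Function.comp_apply, Complex.ofReal_sub,
        tsum_generatorProfile_eq hdD h2 hg hsum hT0, normalizedTube_eq_tubeVolume_mul_rpow]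
      congr 1
      refine tsum_congr fun n => ?_
      rw [ofReal_cpow_eq_exp (Real.exp_pos _), Real.log_exp, neg_neg, neg_neg]
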